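/- **The $D_N$ potentials.** Let $N\ge 4$. For $a=(a_1,\dots,a_{N-1})\in\mathbb Z_{\ge0}^{N-1}$ put $|a|=\sum_k a_k$, $\|a\|=\sum_{k=1}^{N-1}(N-k)a_k$, $v^{(a)}=\prod_{k=1}^{N-1} v_k^{a_k}/a_k!$, and let $c_{\gamma,m}=(-1)^m\prod_{k=0}^{m-1}(2\gamma-1+2k(N-1))$ for $m\ge 0$. For $1\le\gamma\le N-1$ define polynomials in $v_1,\dots,v_N$ by $$\psi^{(1)}_\gamma=\sum_{\|a\|=N-\gamma}c_{\gamma,|a|-1}\,v^{(a)},\qquad \psi^{(2)}_\gamma=\sum_{\|a\|=2N-1-\gamma}c_{\gamma,|a|-2}\,v^{(a)}+\frac{v_N^2}{2}\sum_{\|a\|=N-1-\gamma}c_{\gamma,\max(|a|-1,0)}\,v^{(a)},$$ and $\psi^{(1)}_N=v_N$, $\psi^{(2)}_N=v_1v_N$. Put $\bar\alpha=N-\alpha$ for $\alpha<N$ and $\bar N=N$. The potential $F_{D_N}\in\mathbb Q[t_1,\dots,t_N]$ of the $D_N$ Frobenius manifold is the polynomial (unique up to a constant) with $\partial F_{D_N}/\partial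 t_\alpha=\psi^{(2)}_{\bar\alpha}(v)$, $1\le\alpha\le N$, where the flat coordinates are $t_\alpha=\psi^{(1)}_\alpha(v)$. **The $D$ hierarchy.** For $m\ge1$ and $1\le\gamma_k<N$ put $$R^{(D_N)}_{\alpha,\beta;\gamma_1,\dots,\gamma_m}=\frac1{m!}\frac{\partial^{m+2}F_{D_N}}{\partial t_\alpha\partial t_\beta\partial t_{N-\gamma_1}\cdots\partial t_{N-\gamma_m}}\Big|_{t=0},\qquad R^{(D_N)}_{\alpha;\gamma_1,\dots,\gamma_m}=\frac1{m!}\frac{\partial^{m+1}v_1}{\partial t_\alpha\partial t_{N-\gamma_1}\cdots\partial t_{N-\gamma_m}}\Big|_{t=0},$$ where $\partial v_1/\partial t_\alpha=\partial^3F_{D_N}/\partial t_\alpha\partial t_N^2$; if some $\gamma_k\ge N$, both numbers are $0$ by convention. For a formal power series $f(t_0,t_1,t_2,\dots)$ over $\mathbb C$, with $\partial_k=\partial/\partial t_k$, consider the system, for all $\alpha,\beta\ge2$, $$\partial_\alpha\partial_\beta f=\sum_{m\ge1}\sum_{\gamma_1,\dots,\gamma_m\ge1}R^{(\mathrm D,1)}_{\alpha,\beta;\gamma_1,\dots,\gamma_m}\prod_{k=1}^m\partial_1\partial_{\gamma_k}f,\qquad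 \partial_0\partial_\alpha f=\partial_0\partial_1f\cdot\sum_{m\ge1}\sum_{\gamma_1,\dots,\gamma_m\ge1}R^{(\mathrm D,2)}_{\alpha;\gamma_1,\dots,\gamma_m}\prod_{k=1}^m\partial_1\partial_{\gamma_k}f,\tag{D}$$ where $R^{(\mathrm D,1)}_{\alpha,\beta;\bullet}=R^{(D_N)}_{\alpha,\beta;\bullet}$ for $N=\max(4,\alpha+\beta)$ and $R^{(\mathrm D,2)}_{\alpha;\bullet}=R^{(D_N)}_{\alpha;\bullet}$ for $N=\max(4,\alpha+1)$. **The reduced 2-component BKP hierarchy.** For a formal power series $F_0(t_1,t_3,\dots;\bar t_1,\bar t_3,\dots)$ over $\mathbb C$ put $D(z)=\sum_{n\ge0}\frac{z^{-2n-1}}{2n+1}\partial_{2n+1}$ and $\bar D(z)=\sum_{n\ge0}\frac{z^{-2n-1}}{2n+1}\bar\partial_{2n+1}$. The dispersionless 2-component BKP hierarchy consists of the Fay identities $$\Big(1-\tfrac{\partial_1(2D(z_1)+2D(z_2))F_0}{z_1+z_2}\Big)e^{2D(z_1)2D(z_2)F_0}=1-\tfrac{\partial_1(2D(z_1)-2D(z_2))F_0}{z_1-z_2},\tag{1}$$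 $$\Big(1-\tfrac{\bar\partial_1(2\bar D(z_1)+2\bar D(z_2))F_0}{z_1+z_2}\Big)e^{2\bar D(z_1)2\bar D(z_2)F_0}=1-\tfrac{\bar\partial_1(2\bar D(z_1)-2\bar D(z_2))F_0}{z_1-z_2},\tag{2}$$ $$\big(z_1-\partial_1(2D(z_1)+2\bar D(z_2))F_0\big)e^{2D(z_1)2\bar D(z_2)F_0}=z_1-\partial_1(2D(z_1)-2\bar D(z_2))F_0,\tag{3}$$ $$\big(z_2-\bar\partial_1(2D(z_1)+2\bar D(z_2))F_0\big)e^{2D(z_1)2\bar D(z_2)F_0}=z_2-\bar\partial_1(2\bar D(z_2)-2D(z_1))F_0.\tag{4}$$ Its reduction in the second set of times requires $\bar D(z)F_0=z^{-1}\bar\partial_1F_0$ (that is, $F_0$ does not depend on $\bar t_3,\bar t_5,\dots$), equation (1), equation (2) modulo $(z_1^{-2},z_2^{-2})$, and equations (3) and (4) modulo $z_2^{-2}$. **Theorem.** The polynomials $F_{D_N}$, $N\ge4$, exist. The coefficients stabilize: for $\alpha,\beta\ge1$ the numbers $R^{(D_N)}_{\alpha,\beta;\gamma_1,\dots,\gamma_m}$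 are the same for all $N\ge\max(4,\alpha+\beta)$, and $R^{(D_N)}_{\alpha;\gamma_1,\dots,\gamma_m}$ are the same for all $N\ge\max(4,\alpha+1)$. For $F_0$ with $\bar D(z)F_0=z^{-1}\bar\partial_1F_0$, the reduced hierarchy is equivalent to equation (1) together with $$D(z_1)\bar\partial_1\,2F_0=\sum_{m\ge1}\bar\partial_1\partial_1 2F_0\cdot z_1^{-m}\big(\partial_1D(z_1)2F_0\big)^{m-1}.$$ The change of variables and substitution $$f(t_0,t_1,t_2,t_3,\dots)=2F_0\big(t_1,\tfrac{t_2}{3},\tfrac{t_3}{5},\dots;\bar t_1=t_0\big)$$ (that is, $t_{2k-1}$ is replaced by $t_k/(2k-1)$ and $\bar t_1$ by $t_0$) is a bijection from the series $F_0$ with $\bar D(z)F_0=z^{-1}\bar\partial_1F_0$ onto all series $f$, and $f$ solves the system (D) if and only if $F_0$ solves the reduced 2-component BKP hierarchy. -/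

import Mathlib

noncomputable section

namespace DHierarchy

/-! ### The potentials of the `D_N` Frobenius manifolds

Polynomials in `v_1, …, v_N` or in `t_1, …, t_N` are elements of `MvPolynomial ℕ ℚ`,
the variable with number `k` being `X k`. -/

/-- All multi-indices `a = (a_1, …, a_{N-1})` with `∑ (N - k) a_k = w`
(each `a_k` is then at most `w`). -/
def multiIndices (N w : ℕ) : Finset (ℕ →₀ ℕ) :=
  ((Finset.Icc 1 (N - 1)).finsupp (fun _ => Finset.range (w + 1))).filter
    (fun a => ∑ k ∈ Finset.Icc 1 (N - 1), (N - k) * a k = w)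

/-- `|a| = ∑ a_k`. -/
def size (N : ℕ) (a : ℕ →₀ ℕ) : ℕ := ∑ k ∈ Finset.Icc 1 (N - 1), a k

/-- The monomial `∏ v_k ^ {a_k} / a_k !`. -/
def dividedMonomial (N : ℕ) (a : ℕ →₀ ℕ) : MvPolynomial ℕ ℚ :=
  MvPolynomial.monomial a (∏ k ∈ Finset.Icc 1 (N - 1), ((a k).factorial : ℚ))⁻¹

/-- `∏_{k=0}^{m-1} (2γ - 1 + 2k(N-1))`. -/
def oddProd (N γ m : ℕ) : ℚ :=
  ∏ k ∈ Finset.range m, (2 * (γ : ℚ) - 1 + 2 * (k : ℚ) * ((N : ℚ) - 1))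

/-- The flat coordinate `t_γ` of `D_N` as a polynomial in the unfolding coordinates `v`. -/
def psi1 (N γ : ℕ) : MvPolynomial ℕ ℚ :=
  if γ = N then MvPolynomial.X N
  else ∑ a ∈ multiIndices N (N - γ),
    MvPolynomial.C ((-1) ^ (size N a - 1) * oddProd N γ (size N a - 1)) * dividedMonomial N a

/-- The derivative of the potential of `D_N` with respect to the flat coordinate dual to `t_γ`,
as a polynomial in `v`. In the first sum always `2 ≤ |a|`; in the second sum `a = 0` occurs only
for `γ = N - 1`, with coefficient `1`. -/
def psi2 (N γ : ℕ) : MvPolynomial ℕ ℚ :=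
  if γ = N then MvPolynomial.X 1 * MvPolynomial.X N
  else
    (∑ a ∈ multiIndices N (2 * (N - 1) + 1 - γ),
      MvPolynomial.C ((-1) ^ (size N a - 2) * oddProd N γ (size N a - 2)) * dividedMonomial N a)
    + (∑ a ∈ multiIndices N (N - 1 - γ),
        MvPolynomial.C ((-1) ^ (size N a - 1) * oddProd N γ (size N a - 1)) *
          dividedMonomial N a) *
      (MvPolynomial.C (1 / 2) * MvPolynomial.X N ^ 2)

/-- The involution `α ↦ ᾱ` of `{1, …, N}`: `N̄ = N` and `ᾱ = N - α` for `α < N`. -/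
def bar (N α : ℕ) : ℕ := if α = N then N else N - α

/-- `F ∈ ℚ[t_1, …, t_N]` is a potential of the `D_N` Frobenius manifold: in the flat coordinates
`t_α = ψ¹_α(v)` its gradient is `∂F/∂t_α = ψ²_ᾱ(v)`. -/
def IsDPotential (N : ℕ) (F : MvPolynomial ℕ ℚ) : Prop :=
  F.vars ⊆ Finset.Icc 1 N ∧
  ∀ α ∈ Finset.Icc 1 N,
    MvPolynomial.aeval (psi1 N) (MvPolynomial.pderiv α F) = psi2 N (bar N α)

/-! ### The hierarchy -/

/-- The iterated partial derivative of `p` in the variables listed in `l`, at the origin. -/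
def derivAtZero (l : List ℕ) (p : MvPolynomial ℕ ℚ) : ℚ :=
  MvPolynomial.constantCoeff (l.foldr (fun i q => MvPolynomial.pderiv i q) p)

/-- `R^{(D_N)}_{α,β;γ_1,…,γ_m} = (1/m!) ∂^{m+2} F / ∂t_α ∂t_β ∂t_{N-γ_1} ⋯ ∂t_{N-γ_m}` at `0`,
for `1 ≤ γ_k < N`. -/
def coeffA (N : ℕ) (F : MvPolynomial ℕ ℚ) (α β : ℕ) (γ : List ℕ) : ℚ :=
  if ∀ c ∈ γ, 1 ≤ c ∧ c < N then
    derivAtZero (γ.map (bar N) ++ [α, β]) F / (γ.length.factorial : ℚ)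
  else 0

/-- `R^{(D_N)}_{α,N;γ_1,…,γ_m} = (1/m!) ∂^{m+1} v_1 / ∂t_α ∂t_{N-γ_1} ⋯ ∂t_{N-γ_m}` at `0`,
for `1 ≤ γ_k < N`. Since `∂F/∂t_N = t_N v_1`, with `v_1` independent of `t_N`, the derivative
`∂v_1/∂t_α` is `∂^3 F / ∂t_α ∂t_N ∂t_N`. -/
def coeffB (N : ℕ) (F : MvPolynomial ℕ ℚ) (α : ℕ) (γ : List ℕ) : ℚ :=
  if ∀ c ∈ γ, 1 ≤ c ∧ c < N then
    derivAtZero (γ.map (bar N) ++ [α, N, N]) F / (γ.length.factorial : ℚ)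
  else 0

/-- The stable coefficients `R^{(D,1)}_{α,β;γ}`, read off at the least `N` in the stable range. -/
def stableA (P : ℕ → MvPolynomial ℕ ℚ) (α β : ℕ) (γ : List ℕ) : ℚ :=
  coeffA (max 4 (α + β)) (P (max 4 (α + β))) α β γ

/-- The stable coefficients `R^{(D,2)}_{α;γ}`, read off at the least `N` in the stable range. -/
def stableB (P : ℕ → MvPolynomial ℕ ℚ) (α : ℕ) (γ : List ℕ) : ℚ :=
  coeffB (max 4 (α + 1)) (P (max 4 (α + 1))) α γ

/-- Functions `f(t_0, t_1, t_2, …)`, as formal power series. -/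
abbrev TSeries : Type := MvPowerSeries ℕ ℂ

/-- `∂_k = ∂/∂t_k`. -/
def dt (k : ℕ) (f : TSeries) : TSeries := MvPowerSeries.pderiv ℂ k f

/-- The system of PDEs built from the potentials `P N` of `D_N`. Only finitely many
coefficients are non-zero for given `α`, `β`, so the sums over all `γ_1, …, γ_m` are finite. -/
structure SolvesDHierarchy (P : ℕ → MvPolynomial ℕ ℚ) (f : TSeries) : Prop where
  flowA : ∀ α β : ℕ, 2 ≤ α → 2 ≤ β →
    dt α (dt β f) = ∑ᶠ (γ : List ℕ) (_ : γ ≠ []),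
      (stableA P α β γ : ℂ) • (γ.map (fun c => dt 1 (dt c f))).prod
  flowB : ∀ α : ℕ, 2 ≤ α →
    dt 0 (dt α f) = dt 0 (dt 1 f) * ∑ᶠ (γ : List ℕ) (_ : γ ≠ []),
      (stableB P α γ : ℂ) • (γ.map (fun c => dt 1 (dt c f))).prod

/-! ### The dispersionless 2-component BKP hierarchy -/

/-- Functions `F(t_1, t_3, …; t̄_1, t̄_3, …)`, as formal power series: `Sum.inl n` is the index of
`t_{2n+1}` and `Sum.inr n` is the index of `t̄_{2n+1}`. -/
abbrev BKPSeries : Type := MvPowerSeries (ℕ ⊕ ℕ) ℂ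

/-- `∂_{2n+1}`. -/
def dT (n : ℕ) (F : BKPSeries) : BKPSeries := MvPowerSeries.pderiv ℂ (Sum.inl n) F

/-- `∂̄_{2n+1}`. -/
def dTbar (n : ℕ) (F : BKPSeries) : BKPSeries := MvPowerSeries.pderiv ℂ (Sum.inr n) F

/-- Power series in `z_1⁻¹` and `z_2⁻¹` (the variables `X 0` and `X 1`) whose coefficients are
functions of the times. -/
abbrev ZSeries : Type := MvPowerSeries (Fin 2) BKPSeries

/-- A field that contains `ZSeries` and in which `z_1`, `z_2` live. -/
abbrev ZField : Type := FractionRing ZSeries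

/-- The inclusion of `ZSeries`. -/
def incl (G : ZSeries) : ZField := algebraMap ZSeries ZField G

/-- `z_1 = z 0` and `z_2 = z 1`. -/
def z (i : Fin 2) : ZField := (incl (MvPowerSeries.X i))⁻¹

/-- A function of the times as a series that is constant in `z_1⁻¹` and `z_2⁻¹`. -/
def const (F : BKPSeries) : ZSeries := MvPowerSeries.C F

/-- A differential operator in the times, acting on the coefficients of a series. -/
def onCoeffs (d : BKPSeries → BKPSeries) (G : ZSeries) : ZSeries :=
  fun e => d (MvPowerSeries.coeff e G)

/-- The operator `∑_{n ≥ 0} z_i^{-2n-1} / (2n+1) · d n`. -/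
def oddOp (d : ℕ → BKPSeries → BKPSeries) (i : Fin 2) (G : ZSeries) : ZSeries :=
  fun e => ∑ n ∈ (Finset.range (e i)).filter (fun n => 2 * n + 1 ≤ e i),
    (1 / (2 * (n : ℂ) + 1)) • d n (MvPowerSeries.coeff (e - Finsupp.single i (2 * n + 1)) G)

/-- `D^B(z_i)`. -/
def DB (i : Fin 2) (G : ZSeries) : ZSeries := oddOp dT i G

/-- `D̄^B(z_i)`. -/
def DBbar (i : Fin 2) (G : ZSeries) : ZSeries := oddOp dTbar i G

/-- The exponential of a series without constant term in `z_1⁻¹`, `z_2⁻¹`. -/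
def fexp (G : ZSeries) : ZSeries := PowerSeries.subst G (PowerSeries.exp ℚ)

/-- Left-hand side of the first dispersionless Fay identity. -/
def fay1L (F : BKPSeries) : ZField :=
  (1 - incl (onCoeffs (dT 0) (2 * DB 0 (const F) + 2 * DB 1 (const F))) / (z 0 + z 1)) *
    incl (fexp (2 * DB 0 (2 * DB 1 (const F))))

/-- Right-hand side of the first dispersionless Fay identity. -/
def fay1R (F : BKPSeries) : ZField :=
  1 - incl (onCoeffs (dT 0) (2 * DB 0 (const F) - 2 * DB 1 (const F))) / (z 0 - z 1)

/-- Left-hand side of the second dispersionless Fay identity. -/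
def fay2L (F : BKPSeries) : ZField :=
  (1 - incl (onCoeffs (dTbar 0) (2 * DBbar 0 (const F) + 2 * DBbar 1 (const F))) /
      (z 0 + z 1)) *
    incl (fexp (2 * DBbar 0 (2 * DBbar 1 (const F))))

/-- Right-hand side of the second dispersionless Fay identity. -/
def fay2R (F : BKPSeries) : ZField :=
  1 - incl (onCoeffs (dTbar 0) (2 * DBbar 0 (const F) - 2 * DBbar 1 (const F))) / (z 0 - z 1)

/-- Left-hand side of the third dispersionless Fay identity. -/
def fay3L (F : BKPSeries) : ZField :=
  (z 0 - incl (onCoeffs (dT 0) (2 * DB 0 (const F) + 2 * DBbar 1 (const F)))) *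
    incl (fexp (2 * DB 0 (2 * DBbar 1 (const F))))

/-- Right-hand side of the third dispersionless Fay identity. -/
def fay3R (F : BKPSeries) : ZField :=
  z 0 - incl (onCoeffs (dT 0) (2 * DB 0 (const F) - 2 * DBbar 1 (const F)))

/-- Left-hand side of the fourth dispersionless Fay identity. -/
def fay4L (F : BKPSeries) : ZField :=
  (z 1 - incl (onCoeffs (dTbar 0) (2 * DB 0 (const F) + 2 * DBbar 1 (const F)))) *
    incl (fexp (2 * DB 0 (2 * DBbar 1 (const F))))

/-- Right-hand side of the fourth dispersionless Fay identity. -/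
def fay4R (F : BKPSeries) : ZField :=
  z 1 - incl (onCoeffs (dTbar 0) (2 * DBbar 1 (const F) - 2 * DB 0 (const F)))

/-! ### The reduction -/

/-- `D̄^B(z) F = z⁻¹ ∂̄_1 F`. -/
def BarReduced (F : BKPSeries) : Prop :=
  DBbar 0 (const F) = MvPowerSeries.X 0 * onCoeffs (dTbar 0) (const F)

/-- Equality up to terms of order at least two in `z_2⁻¹`. -/
def EqFirstOrder (L R : ZField) : Prop :=
  ∃ g : ZSeries, L - R = incl (MvPowerSeries.X 1 ^ 2 * g)

/-- Equality up to terms of order at least two in `z_1⁻¹` or in `z_2⁻¹`. -/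
def EqFirstOrderBoth (L R : ZField) : Prop :=
  ∃ g h : ZSeries, L - R = incl (MvPowerSeries.X 0 ^ 2 * g + MvPowerSeries.X 1 ^ 2 * h)

/-- The reduction of the dispersionless 2-component BKP hierarchy in the second set of times:
`D̄^B(z) = z⁻¹ ∂̄_1`, and in the four Fay identities the operators `D̄^B(z_i)` are kept to the
first order in `z_i⁻¹`. -/
structure SolvesReduced2BKP (F : BKPSeries) : Prop where
  reduced : BarReduced F
  fay1 : fay1L F = fay1R F
  fay2 : EqFirstOrderBoth (fay2L F) (fay2R F)
  fay3 : EqFirstOrder (fay3L F) (fay3R F)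
  fay4 : EqFirstOrder (fay4L F) (fay4R F)

/-- The equation
`D^B(z_1) ∂̄_1 2F = ∑_{m ≥ 1} ∂̄_1 ∂_1 2F · z_1^{-m} (∂_1 D^B(z_1) 2F)^{m-1}`, coefficient by
coefficient; the `m`-th summand only has terms of order at least `m` in `z_1⁻¹`. -/
def ReducedFay3 (F : BKPSeries) : Prop :=
  ∀ e : Fin 2 →₀ ℕ,
    MvPowerSeries.coeff e (DB 0 (const (dTbar 0 (2 * F)))) =
      ∑ m ∈ Finset.Icc 1 (e 0), MvPowerSeries.coeff e
        (const (dTbar 0 (dT 0 (2 * F))) * MvPowerSeries.X 0 ^ m *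
          onCoeffs (dT 0) (DB 0 (const (2 * F))) ^ (m - 1))

/-- The change of variables: `t_{2n+1}` is replaced by `t_{n+1} / (2n+1)`, `t̄_1` by `t_0`, and the
times `t̄_3, t̄_5, …`, on which the reduced functions do not depend, by `0`. -/
def newTimes : ℕ ⊕ ℕ → TSeries :=
  Sum.elim (fun n => MvPowerSeries.C (1 / (2 * (n : ℂ) + 1)) * MvPowerSeries.X (n + 1))
    (fun n => if n = 0 then MvPowerSeries.X 0 else 0)

/-- The function `f(t_0, t_1, t_2, …) = 2 F(t_1, t_2 / 3, t_3 / 5, …; t_0, 0, 0, …)`. -/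
def changeVars (F : BKPSeries) : TSeries := MvPowerSeries.subst newTimes (2 * F)

/-- The substitution is legitimate for arbitrary formal power series. -/
theorem hasSubst_newTimes : MvPowerSeries.HasSubst newTimes where
  const_coeff s := by
    rcases s with n | n
    · simp [newTimes]
    · by_cases h : n = 0 <;> simp [newTimes, h]
  coeff_zero d := by
    have hfin : (Sum.inl '' {n : ℕ | n + 1 ∈ d.support} ∪ {Sum.inr 0} : Set (ℕ ⊕ ℕ)).Finite :=
      ((d.support.finite_toSet.preimage (fun a _ b _ h => by simpa using h)).image _).union
        (Set.finite_singleton _)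
    refine hfin.subset ?_
    rintro (n | n) hs
    · left
      refine ⟨n, ?_, rfl⟩
      classical
      simp only [newTimes, Sum.elim_inl, MvPowerSeries.coeff_C_mul, MvPowerSeries.coeff_X,
        Set.mem_ofPred_eq] at hs
      by_cases h : d = Finsupp.single (n + 1) 1
      · simp [h]
      · simp [h] at hs
    · right
      by_cases h : n = 0
      · simp [h]
      · simp [newTimes, h] at hs

end DHierarchy

end

/-! Both hierarchies say that the second derivatives of `f` are the same universal polynomials in
`q_γ = ∂_1 ∂_γ f`. These come from the odd function `p(z) = z - ∑ q_γ z^(1-2γ) = z D(1/z)`, where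
`D` is `evenSeries q`. `flowPolyA α β` is a normalised Grunsky coefficient of `p` with odd indices,
that is, a coefficient of `x₀ ∂/∂x₀ log ((p(z₀) - p(z₁)) / (z₀ - z₁))`, `x_i = 1/z_i`, and
`flowPolyB α` is a coefficient of `1/D`.

Frobenius side. Let `λ = p^h (1 + h V(p⁻²))` be the superpotential of `D_N`, `h = 2(N-1)`, and `ζ =
λ^(1/h)`. The flat coordinates and the gradients of `psi1` and `psi2` are expansion coefficients of
powers of `ζ` in `1/p` (`mul_psi1`, `pderiv_psi1`, `mul_pderiv_psi2`, `mul_pderiv_top_psi2`). Invert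
to `p = ζ D(1/ζ)`. The `n`-th Faber polynomial of `p` is `ζ^n - ∑ g_{b,n} ζ^(-b)` with `g` the
Grunsky coefficients, so the negative part of `ζ^n` is a combination of the `ζ^(-b)`
(`InversePair.coeff_pow_add`). The odd powers `ζ^(-b)` carry the Jacobian of the flat coordinates,
so the chain rule identifies the Hessian of the potential with `flowPolyA` at `q_γ = t_{N-γ}` and
`∂v_1/∂t_β` with `flowPolyB β` (`exists_flat_expansion`, `exists_flatHessian`). Symmetry of the
Grunsky coefficients makes the gradient closed, so the potential exists (`exists_isDPotential`). By
weight, `flowPolyA α β` only contains `q_γ` with `γ < α + β`; this is the stabilization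
(`coeffA_eq`, `coeffB_eq`). The sums over lists `γ` are Taylor expansions (`finsum_derivAtZero`).

BKP side. For `p(z) = z - ∂_1 2D(z) F₀` the first Fay identity equates `exp(2D(z₀) 2D(z₁) F₀)` with
the quotient of `(p(z₀) - p(z₁)) / (z₀ - z₁)` by `(p(z₀) + p(z₁)) / (z₀ + z₁)`; its logarithmic
derivative says that the second derivatives of `F₀` are Grunsky coefficients (`fay1_iff`). Under the
reduction the second and fourth identities hold automatically to the required order, and the third
becomes the geometric series `ReducedFay3`, whose coefficients are the `flowPolyB`
(`fay3_iff_of_barReduced`, `reducedFay3_iff_flowB`). The change of variables rescales each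
coefficient by a nonzero factor. -/

noncomputable section

namespace DHierarchy

open Finset.HasAntidiagonal (antidiagonal mem_antidiagonal)

/-! ### Series in two variables -/

section TwoVariables

variable {A : Type*} [CommRing A]

/-- The exponent of `x₀ ^ n * x₁ ^ b`. -/
def pt (n b : ℕ) : Fin 2 →₀ ℕ := Finsupp.single 0 n + Finsupp.single 1 b

@[simp] lemma pt_zero_apply (n b : ℕ) : pt n b 0 = n := by simp [pt]

@[simp] lemma pt_one_apply (n b : ℕ) : pt n b 1 = b := by simp [pt]

lemma eq_pt (e : Fin 2 →₀ ℕ) : e = pt (e 0) (e 1) := by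
  ext i; fin_cases i <;> simp

lemma pt_inj {n b n' b' : ℕ} : pt n b = pt n' b' ↔ n = n' ∧ b = b' := by
  refine ⟨fun h => ⟨?_, ?_⟩, fun h => by rw [h.1, h.2]⟩
  · simpa using DFunLike.congr_fun h 0
  · simpa using DFunLike.congr_fun h 1

lemma pt_add (n b n' b' : ℕ) : pt n b + pt n' b' = pt (n + n') (b + b') := by
  ext i; fin_cases i <;> simp

@[simp] lemma pt_zero_zero : pt 0 0 = 0 := by simp [pt]

lemma ext_pt {F G : MvPowerSeries (Fin 2) A}
    (h : ∀ n b, MvPowerSeries.coeff (pt n b) F = MvPowerSeries.coeff (pt n b) G) : F = G := by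
  ext e; rw [eq_pt e]; exact h _ _

lemma coeff_pt_mul (F G : MvPowerSeries (Fin 2) A) (n b : ℕ) :
    MvPowerSeries.coeff (pt n b) (F * G) =
      ∑ i ∈ antidiagonal n, ∑ j ∈ antidiagonal b,
        MvPowerSeries.coeff (pt i.1 j.1) F * MvPowerSeries.coeff (pt i.2 j.2) G := by
  classical
  rw [MvPowerSeries.coeff_mul, ← Finset.sum_product']
  refine Finset.sum_nbij' (fun e => ((e.1 0, e.2 0), (e.1 1, e.2 1)))
    (fun ij => (pt ij.1.1 ij.2.1, pt ij.1.2 ij.2.2)) ?_ ?_ ?_ ?_ ?_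
  · intro e he
    rw [mem_antidiagonal] at he
    simp only [Finset.mem_product, mem_antidiagonal]
    exact ⟨by rw [← Finsupp.add_apply, he]; simp, by rw [← Finsupp.add_apply, he]; simp⟩
  · intro ij h
    simp only [Finset.mem_product, mem_antidiagonal] at h
    rw [mem_antidiagonal, pt_add, h.1, h.2]
  · intro e _
    simp [← eq_pt]
  · intro ij _
    simp
  · intro e _
    simp [← eq_pt]

lemma pt_succ_left (n b : ℕ) : pt (n + 1) b = Finsupp.single 0 1 + pt n b := by
  ext i; fin_cases i <;> simp [add_comm]

lemma pt_succ_right (n b : ℕ) : pt n (b + 1) = Finsupp.single 1 1 + pt n b := by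
  ext i; fin_cases i <;> simp [add_comm]

lemma coeff_pt_X0_mul (F : MvPowerSeries (Fin 2) A) (n b : ℕ) :
    MvPowerSeries.coeff (pt (n + 1) b) (MvPowerSeries.X 0 * F) =
      MvPowerSeries.coeff (pt n b) F := by
  rw [pt_succ_left, MvPowerSeries.X, MvPowerSeries.coeff_add_monomial_mul, one_mul]

lemma coeff_pt_X1_mul (F : MvPowerSeries (Fin 2) A) (n b : ℕ) :
    MvPowerSeries.coeff (pt n (b + 1)) (MvPowerSeries.X 1 * F) =
      MvPowerSeries.coeff (pt n b) F := by
  rw [pt_succ_right, MvPowerSeries.X, MvPowerSeries.coeff_add_monomial_mul, one_mul]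

lemma coeff_pt_zero_X0_mul (F : MvPowerSeries (Fin 2) A) (b : ℕ) :
    MvPowerSeries.coeff (pt 0 b) (MvPowerSeries.X 0 * F) = 0 := by
  classical
  rw [MvPowerSeries.X, MvPowerSeries.coeff_monomial_mul, if_neg]
  intro h
  simpa using h 0

lemma coeff_pt_zero_X1_mul (F : MvPowerSeries (Fin 2) A) (n : ℕ) :
    MvPowerSeries.coeff (pt n 0) (MvPowerSeries.X 1 * F) = 0 := by
  classical
  rw [MvPowerSeries.X, MvPowerSeries.coeff_monomial_mul, if_neg]
  intro h
  simpa using h 1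

lemma coeff_pt_pderiv_zero (F : MvPowerSeries (Fin 2) A) (n b : ℕ) :
    MvPowerSeries.coeff (pt n b) (MvPowerSeries.pderiv A 0 F) =
      MvPowerSeries.coeff (pt (n + 1) b) F * (n + 1) := by
  rw [MvPowerSeries.coeff_pderiv, pt_zero_apply, pt_succ_left, add_comm]

lemma coeff_pt_pderiv_one (F : MvPowerSeries (Fin 2) A) (n b : ℕ) :
    MvPowerSeries.coeff (pt n b) (MvPowerSeries.pderiv A 1 F) =
      MvPowerSeries.coeff (pt n (b + 1)) F * (b + 1) := by
  rw [MvPowerSeries.coeff_pderiv, pt_one_apply, pt_succ_right, add_comm]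

lemma coeff_pt_X0_mul_pderiv (F : MvPowerSeries (Fin 2) A) (n b : ℕ) :
    MvPowerSeries.coeff (pt n b) (MvPowerSeries.X 0 * MvPowerSeries.pderiv A 0 F) =
      n * MvPowerSeries.coeff (pt n b) F := by
  rcases n with _ | n
  · simp [coeff_pt_zero_X0_mul]
  · rw [coeff_pt_X0_mul, coeff_pt_pderiv_zero, mul_comm]; push_cast; ring

lemma coeff_pt_X1_mul_pderiv (F : MvPowerSeries (Fin 2) A) (n b : ℕ) :
    MvPowerSeries.coeff (pt n b) (MvPowerSeries.X 1 * MvPowerSeries.pderiv A 1 F) =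
      b * MvPowerSeries.coeff (pt n b) F := by
  rcases b with _ | b
  · simp [coeff_pt_zero_X1_mul]
  · rw [coeff_pt_X1_mul, coeff_pt_pderiv_one, mul_comm]; push_cast; ring

/-- A series in one variable as a series in `x_i`. -/
def inX (i : Fin 2) : PowerSeries A →ₐ[A] MvPowerSeries (Fin 2) A :=
  PowerSeries.substAlgHom (PowerSeries.HasSubst.X i)

lemma coeff_pt_inX_zero (D : PowerSeries A) (n b : ℕ) :
    MvPowerSeries.coeff (pt n b) (inX 0 D) = if b = 0 then PowerSeries.coeff n D else 0 := by
  rw [inX, PowerSeries.coe_substAlgHom, PowerSeries.coeff_subst_single]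
  have : pt n b = Finsupp.single 0 n ↔ b = 0 := by
    rw [show Finsupp.single (0 : Fin 2) n = pt n 0 by simp [pt], pt_inj]; simp
  simp [this]

lemma coeff_pt_inX_one (D : PowerSeries A) (n b : ℕ) :
    MvPowerSeries.coeff (pt n b) (inX 1 D) = if n = 0 then PowerSeries.coeff b D else 0 := by
  rw [inX, PowerSeries.coe_substAlgHom, PowerSeries.coeff_subst_single]
  have : pt n b = Finsupp.single 1 b ↔ n = 0 := by
    rw [show Finsupp.single (1 : Fin 2) b = pt 0 b by simp [pt], pt_inj]; simp
  simp [this]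

lemma inX_X (i : Fin 2) : inX i (PowerSeries.X : PowerSeries A) = MvPowerSeries.X i := by
  rw [inX, PowerSeries.substAlgHom_X]

lemma coeff_pt_inX_zero_mul (D : PowerSeries A) (F : MvPowerSeries (Fin 2) A) (n b : ℕ) :
    MvPowerSeries.coeff (pt n b) (inX 0 D * F) =
      ∑ i ∈ antidiagonal n, PowerSeries.coeff i.1 D * MvPowerSeries.coeff (pt i.2 b) F := by
  rw [coeff_pt_mul]
  refine Finset.sum_congr rfl fun i _ => ?_
  rw [Finset.sum_eq_single (0, b)]
  · simp [coeff_pt_inX_zero]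
  · rintro ⟨j, k⟩ hj hne
    rw [mem_antidiagonal] at hj
    have : j ≠ 0 := by rintro rfl; exact hne (by simpa using hj)
    simp [coeff_pt_inX_zero, this]
  · intro h; exact absurd (by simp [mem_antidiagonal]) h

lemma coeff_pt_inX_one_mul (D : PowerSeries A) (F : MvPowerSeries (Fin 2) A) (n b : ℕ) :
    MvPowerSeries.coeff (pt n b) (inX 1 D * F) =
      ∑ j ∈ antidiagonal b, PowerSeries.coeff j.1 D * MvPowerSeries.coeff (pt n j.2) F := by
  rw [coeff_pt_mul, Finset.sum_eq_single (0, n)]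
  · simp [coeff_pt_inX_one]
  · rintro ⟨j, k⟩ hj hne
    rw [mem_antidiagonal] at hj
    have : j ≠ 0 := by rintro rfl; exact hne (by simpa using hj)
    simp [coeff_pt_inX_one, this]
  · intro h; exact absurd (by simp [mem_antidiagonal]) h

/-! ### Grunsky coefficients -/

/-- For `p(z) = z D(z⁻¹)`, the difference quotient `(p(z₀) - p(z₁)) / (z₀ - z₁)` as a series in
`x_i = z_i⁻¹`. -/
def diffQuot (D : PowerSeries A) : MvPowerSeries (Fin 2) A := fun e =>
  if e = 0 then 1 else if e 0 = 0 ∨ e 1 = 0 then 0 else - PowerSeries.coeff (e 0 + e 1) D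

lemma coeff_diffQuot (D : PowerSeries A) (n b : ℕ) :
    MvPowerSeries.coeff (pt n b) (diffQuot D) =
      if n = 0 ∧ b = 0 then 1 else if n = 0 ∨ b = 0 then 0 else - PowerSeries.coeff (n + b) D := by
  have : pt n b = 0 ↔ n = 0 ∧ b = 0 := by rw [← pt_zero_zero, pt_inj]
  change (if pt n b = 0 then (1 : A) else if pt n b 0 = 0 ∨ pt n b 1 = 0 then 0 else
    - PowerSeries.coeff (pt n b 0 + pt n b 1) D) = _
  simp [this]

lemma constantCoeff_diffQuot (D : PowerSeries A) :
    MvPowerSeries.constantCoeff (diffQuot D) = 1 := by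
  rw [← MvPowerSeries.coeff_zero_eq_constantCoeff_apply, ← pt_zero_zero, coeff_diffQuot]; simp

/-- This is `p(z₀) - p(z₁)` with denominators cleared by `x₀ x₁`, since `z₀ - z₁ = (x₁ - x₀) / (x₀
x₁)`. -/
lemma sub_mul_diffQuot (D : PowerSeries A) (hD : PowerSeries.constantCoeff D = 1) :
    (MvPowerSeries.X 1 - MvPowerSeries.X 0) * diffQuot D =
      MvPowerSeries.X 1 * inX 0 D - MvPowerSeries.X 0 * inX 1 D := by
  have hD0 : PowerSeries.coeff 0 D = 1 := by simpa using hD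
  refine ext_pt fun n b => ?_
  rw [sub_mul, map_sub, map_sub]
  rcases n with _ | n <;> rcases b with _ | b <;>
  simp only [coeff_pt_zero_X0_mul, coeff_pt_zero_X1_mul, coeff_pt_X0_mul, coeff_pt_X1_mul,
    coeff_diffQuot, coeff_pt_inX_zero, coeff_pt_inX_one]
  · by_cases hb : b = 0 <;> simp [hb, hD0]
  · by_cases hn : n = 0 <;> simp [hn, hD0]
  · rcases Nat.eq_zero_or_pos b with rfl | hb <;> rcases Nat.eq_zero_or_pos n with rfl | hn
    · simp
    · simp [hn.ne']
    · simp [hb.ne', add_comm]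
    · simp [hb.ne', hn.ne', show n + 1 + b = n + (b + 1) by ring]

/-- `x₀ ∂/∂x₀ log ((p(z₀) - p(z₁)) / (z₀ - z₁))`. -/
def grunskySeries (D : PowerSeries A) : MvPowerSeries (Fin 2) A :=
  MvPowerSeries.X 0 * MvPowerSeries.pderiv A 0 (diffQuot D) *
    MvPowerSeries.invOfUnit (diffQuot D) 1

/-- The coefficients of `grunskySeries D`. -/
def grunsky (D : PowerSeries A) (b n : ℕ) : A := MvPowerSeries.coeff (pt n b) (grunskySeries D)

lemma diffQuot_mul_inv (D : PowerSeries A) :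
    diffQuot D * MvPowerSeries.invOfUnit (diffQuot D) 1 = 1 :=
  MvPowerSeries.mul_invOfUnit _ _ (by simp [constantCoeff_diffQuot])

lemma diffQuot_mul_grunskySeries (D : PowerSeries A) :
    diffQuot D * grunskySeries D = MvPowerSeries.X 0 * MvPowerSeries.pderiv A 0 (diffQuot D) := by
  rw [grunskySeries, mul_left_comm, diffQuot_mul_inv, mul_one]

lemma eq_of_diffQuot_mul_eq (D : PowerSeries A) {F G : MvPowerSeries (Fin 2) A}
    (h : diffQuot D * F = diffQuot D * G) : F = G := by
  have := congrArg (MvPowerSeries.invOfUnit (diffQuot D) 1 * ·) h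
  simpa only [← mul_assoc, mul_comm (MvPowerSeries.invOfUnit _ _) (diffQuot D), diffQuot_mul_inv,
    one_mul] using this

/-- Differentiate `sub_mul_diffQuot` in `x₀`, replace the derivative of the difference quotient by
the quotient times its logarithmic derivative, and compare coefficients of `x₀^(n+1) x₁^(b+1)`. It
is the coefficient form of the rule for multiplying a Faber polynomial by `p`. -/
lemma grunsky_recursion (D : PowerSeries A) (hD : PowerSeries.constantCoeff D = 1) (n b : ℕ) :
    ∑ i ∈ antidiagonal (n + 1), PowerSeries.coeff i.1 D * grunsky D b i.2 -
      ∑ j ∈ antidiagonal (b + 1), PowerSeries.coeff j.1 D * grunsky D j.2 n =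
    (if b = 0 then (n + 1) * PowerSeries.coeff (n + 1) D else 0) -
      PowerSeries.coeff (n + b + 1) D := by
  have key : (MvPowerSeries.X 1 * inX 0 D - MvPowerSeries.X 0 * inX 1 D) * grunskySeries D =
      MvPowerSeries.X 0 * (MvPowerSeries.X 1 * MvPowerSeries.pderiv A 0 (inX 0 D) - inX 1 D
        + diffQuot D) := by
    have h0 : MvPowerSeries.pderiv A 0 (inX 1 D) = 0 := by
      refine ext_pt fun n b => ?_
      simp [coeff_pt_pderiv_zero, coeff_pt_inX_one]
    have h1 := congrArg (MvPowerSeries.pderiv A 0) (sub_mul_diffQuot D hD)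
    have h2 : MvPowerSeries.pderiv A (0 : Fin 2) (MvPowerSeries.X 1) = 0 :=
      MvPowerSeries.pderiv_X_of_ne (by decide)
    simp only [Derivation.leibniz, map_sub, h0, h2, MvPowerSeries.pderiv_X_self, smul_eq_mul] at h1
    rw [← sub_mul_diffQuot D hD, mul_assoc, diffQuot_mul_grunskySeries]
    linear_combination MvPowerSeries.X 0 * h1
  have := congrArg (MvPowerSeries.coeff (pt (n + 1) (b + 1))) key
  rw [sub_mul, map_sub, mul_assoc, mul_assoc, coeff_pt_X1_mul, coeff_pt_X0_mul, coeff_pt_X0_mul,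
    coeff_pt_inX_zero_mul, coeff_pt_inX_one_mul, map_add, map_sub, coeff_pt_X1_mul,
    coeff_pt_pderiv_zero, coeff_pt_inX_zero, coeff_pt_inX_one, coeff_diffQuot] at this
  simp only [grunsky]
  rw [this]
  rcases Nat.eq_zero_or_pos n with rfl | hn
  · by_cases hb : b = 0 <;> simp [hb]
  · by_cases hb : b = 0
    · simp [hb, hn.ne', mul_comm]; ring
    · simp [hb, hn.ne', add_assoc]

lemma grunsky_zero_right (D : PowerSeries A) (b : ℕ) : grunsky D b 0 = 0 := by
  rw [grunsky, grunskySeries, mul_assoc, coeff_pt_zero_X0_mul]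

/-- At `x₁ = 0` the difference quotient is `1`, so its logarithmic derivative vanishes there. -/
lemma grunsky_zero_left (D : PowerSeries A) (n : ℕ) : grunsky D 0 n = 0 := by
  induction n using Nat.strong_induction_on with
  | _ n ih =>
    have := congrArg (MvPowerSeries.coeff (pt n 0)) (diffQuot_mul_grunskySeries D)
    rw [coeff_pt_mul, coeff_pt_X0_mul_pderiv] at this
    simp only [Finset.HasAntidiagonal.antidiagonal_zero, Finset.sum_singleton] at this
    rw [Finset.sum_eq_single (0, n)] at this
    · rw [coeff_diffQuot, coeff_diffQuot] at this
      rw [grunsky]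
      rcases n with _ | n
      · simpa using this
      · simpa using this
    · rintro ⟨j, k⟩ hj hne
      rw [mem_antidiagonal] at hj
      have : j ≠ 0 := by rintro rfl; exact hne (by simpa using hj)
      simp [coeff_diffQuot, this]
    · intro h; exact absurd (by simp [mem_antidiagonal]) h

lemma grunsky_one_left (D : PowerSeries A) (hD : PowerSeries.constantCoeff D = 1) (n : ℕ) :
    grunsky D 1 n = - (n * PowerSeries.coeff (n + 1) D) := by
  have := grunsky_recursion D hD n 0
  simp [grunsky_zero_left, Finset.Nat.antidiagonal_succ, hD] at this
  linear_combination -this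

lemma grunsky_one_right (D : PowerSeries A) (hD : PowerSeries.constantCoeff D = 1) (b : ℕ)
    (hb : b ≠ 0) : grunsky D b 1 = - PowerSeries.coeff (b + 1) D := by
  have := grunsky_recursion D hD 0 b
  simp [grunsky_zero_right, Finset.Nat.antidiagonal_succ, hD, hb] at this
  exact this

/-! ### Faber polynomials -/

/-- `x ^ n` times the Faber polynomial of degree `n`, evaluated at `p = D(x) / x`. -/
def faberSeries (D : PowerSeries A) (n : ℕ) : PowerSeries A :=
  1 - PowerSeries.X ^ n * PowerSeries.mk (fun b => grunsky D b n)

lemma coeff_faberSeries_of_le (D : PowerSeries A) {n k : ℕ} (hk : k ≤ n) :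
    PowerSeries.coeff k (faberSeries D n) = if k = 0 then 1 else 0 := by
  rw [faberSeries, map_sub, PowerSeries.coeff_one, PowerSeries.coeff_X_pow_mul']
  split_ifs with h0 h1 h1
  · have : n = 0 := by omega
    simp [h0, this, grunsky_zero_left]
  · simp
  · have : k - n = 0 := by omega
    simp [this, grunsky_zero_left]
  · simp

lemma coeff_faberSeries_add (D : PowerSeries A) (n b : ℕ) (h : n + b ≠ 0) :
    PowerSeries.coeff (n + b) (faberSeries D n) = - grunsky D b n := by
  rw [faberSeries, map_sub, PowerSeries.coeff_one, if_neg h, PowerSeries.coeff_X_pow_mul',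
    if_pos (by omega)]
  simp

/-- Divided by `x^(n+1)` this is `p F_n = ∑ D_i F_{n+1-i} + (n+1) D_{n+1}` for the Faber polynomials
`F_n`. In degrees up to `n` both sides agree with `D`; from degree `n + 1` on it is
`grunsky_recursion`. -/
lemma faberSeries_recursion (D : PowerSeries A) (hD : PowerSeries.constantCoeff D = 1) (n : ℕ) :
    D * faberSeries D n =
      ∑ i ∈ Finset.range (n + 1), PowerSeries.C (PowerSeries.coeff i D) * PowerSeries.X ^ i *
        faberSeries D (n + 1 - i) +
      PowerSeries.C ((n + 1) * PowerSeries.coeff (n + 1) D) * PowerSeries.X ^ (n + 1) := by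
  ext k
  simp only [map_add, map_sum, mul_assoc, PowerSeries.coeff_C_mul, PowerSeries.coeff_X_pow_mul']
  have hL : PowerSeries.coeff k (D * faberSeries D n) = PowerSeries.coeff k D -
      if n ≤ k then ∑ j ∈ antidiagonal (k - n), PowerSeries.coeff j.1 D * grunsky D j.2 n
      else 0 := by
    rw [faberSeries, mul_sub, mul_one, map_sub, mul_left_comm, PowerSeries.coeff_X_pow_mul']
    simp [PowerSeries.coeff_mul]
  rw [hL, PowerSeries.coeff_X_pow]
  rcases Nat.lt_or_ge k (n + 1) with hk | hk
  · rw [if_neg hk.ne, mul_zero, mul_zero, add_zero]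
    have h2 : (if n ≤ k then ∑ j ∈ antidiagonal (k - n),
        PowerSeries.coeff j.1 D * grunsky D j.2 n else 0) = 0 := by
      split_ifs with h
      · rw [show k - n = 0 by omega]
        simp [grunsky_zero_left]
      · rfl
    rw [h2, sub_zero, Finset.sum_eq_single_of_mem k (by simpa using hk)]
    · rw [if_pos le_rfl, coeff_faberSeries_of_le D (by omega)]; simp
    · intro i hi hik
      rw [Finset.mem_range] at hi
      split_ifs with h
      · rw [coeff_faberSeries_of_le D (by omega), if_neg (by omega), mul_zero]
      · rw [mul_zero]
  · obtain ⟨b, rfl⟩ := Nat.exists_eq_add_of_le hk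
    have hR : ∑ i ∈ Finset.range (n + 1), PowerSeries.coeff i D *
        (if i ≤ n + 1 + b then
          PowerSeries.coeff (n + 1 + b - i) (faberSeries D (n + 1 - i)) else 0) =
        - ∑ i ∈ antidiagonal (n + 1), PowerSeries.coeff i.1 D * grunsky D b i.2 := by
      rw [Finset.Nat.sum_antidiagonal_eq_sum_range_succ
        (fun i j => PowerSeries.coeff i D * grunsky D b j), Finset.sum_range_succ _ (n + 1),
        Nat.sub_self, grunsky_zero_right, mul_zero, add_zero, ← Finset.sum_neg_distrib]
      refine Finset.sum_congr rfl fun i hi => ?_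
      rw [Finset.mem_range] at hi
      rw [if_pos (by omega), show n + 1 + b - i = (n + 1 - i) + b by omega,
        coeff_faberSeries_add D _ _ (by omega), mul_neg]
    rw [hR, if_pos (by omega), show n + 1 + b - n = b + 1 by omega]
    have := grunsky_recursion D hD n b
    rw [show n + b + 1 = n + 1 + b by ring] at this
    rcases Nat.eq_zero_or_pos b with rfl | hb
    · simp only [add_zero, if_true, mul_one] at this ⊢
      linear_combination this
    · rw [if_neg hb.ne'] at this
      rw [if_neg (by omega)]
      linear_combination this

/-! ### Naturality, symmetry, parity -/

lemma diffQuot_map {B : Type*} [CommRing B] (φ : A →+* B) (D : PowerSeries A) :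
    diffQuot (PowerSeries.map φ D) = MvPowerSeries.map φ (diffQuot D) := by
  refine ext_pt fun n b => ?_
  rw [MvPowerSeries.coeff_map, coeff_diffQuot, coeff_diffQuot]
  split_ifs <;> simp

lemma grunskySeries_map {B : Type*} [CommRing B] (φ : A →+* B) (D : PowerSeries A) :
    grunskySeries (PowerSeries.map φ D) = MvPowerSeries.map φ (grunskySeries D) := by
  apply eq_of_diffQuot_mul_eq (PowerSeries.map φ D)
  rw [diffQuot_mul_grunskySeries, diffQuot_map, ← map_mul, diffQuot_mul_grunskySeries]
  refine ext_pt fun n b => ?_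
  rw [MvPowerSeries.coeff_map, coeff_pt_X0_mul_pderiv, coeff_pt_X0_mul_pderiv,
    MvPowerSeries.coeff_map, map_mul, map_natCast]

/-- Naturality allows one computation over the polynomial ring in the `q_γ` to serve both the
potentials and the series in the times. -/
lemma grunsky_map {B : Type*} [CommRing B] (φ : A →+* B) (D : PowerSeries A) (b n : ℕ) :
    grunsky (PowerSeries.map φ D) b n = φ (grunsky D b n) := by
  rw [grunsky, grunskySeries_map, MvPowerSeries.coeff_map, grunsky]

/-- Exchanging the two variables. -/
def swapX (F : MvPowerSeries (Fin 2) A) : MvPowerSeries (Fin 2) A :=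
  fun e => MvPowerSeries.coeff (pt (e 1) (e 0)) F

lemma coeff_swapX (F : MvPowerSeries (Fin 2) A) (n b : ℕ) :
    MvPowerSeries.coeff (pt n b) (swapX F) = MvPowerSeries.coeff (pt b n) F := by
  change MvPowerSeries.coeff (pt (pt n b 1) (pt n b 0)) F = _
  simp

lemma swapX_mul (F G : MvPowerSeries (Fin 2) A) : swapX (F * G) = swapX F * swapX G := by
  refine ext_pt fun n b => ?_
  rw [coeff_swapX, coeff_pt_mul, coeff_pt_mul, Finset.sum_comm]
  simp [coeff_swapX]

lemma swapX_diffQuot (D : PowerSeries A) : swapX (diffQuot D) = diffQuot D := by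
  refine ext_pt fun n b => ?_
  rw [coeff_swapX, coeff_diffQuot, coeff_diffQuot]
  simp only [and_comm, or_comm, add_comm]

/-- Both sides are coefficients of the mixed second derivative of `log R`, where the difference
quotient `R` is symmetric in its two variables. -/
lemma grunsky_symm (D : PowerSeries A) (b n : ℕ) :
    (b : A) * grunsky D b n = n * grunsky D n b := by
  set R := diffQuot D with hR
  set O := grunskySeries D with hO
  have h1 : R * O = MvPowerSeries.X 0 * MvPowerSeries.pderiv A 0 R := diffQuot_mul_grunskySeries D
  have h2 : R * swapX O = MvPowerSeries.X 1 * MvPowerSeries.pderiv A 1 R := by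
    have := congrArg swapX h1
    rw [swapX_mul, hR, swapX_diffQuot] at this
    rw [hR, this]
    refine ext_pt fun n b => ?_
    rw [coeff_swapX, coeff_pt_X0_mul_pderiv, coeff_pt_X1_mul_pderiv]
    nth_rewrite 1 [← swapX_diffQuot]
    rw [coeff_swapX]
  have h3 : MvPowerSeries.X 1 * MvPowerSeries.pderiv A 1 O =
      MvPowerSeries.X 0 * MvPowerSeries.pderiv A 0 (swapX O) := by
    apply eq_of_diffQuot_mul_eq D
    -- Commuting the two Euler operators on `R` itself, with each first derivative written as `R`
    -- times a logarithmic derivative.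
    have h12 : MvPowerSeries.X 1 * MvPowerSeries.pderiv A 1 (R * O) =
        MvPowerSeries.X 0 * MvPowerSeries.pderiv A 0 (R * swapX O) := by
      rw [h1, h2]
      refine ext_pt fun n b => ?_
      simp only [coeff_pt_X0_mul_pderiv, coeff_pt_X1_mul_pderiv]
      ring
    simp only [Derivation.leibniz, smul_eq_mul] at h12
    rw [← hR]
    linear_combination h12 + O * h2 - swapX O * h1
  have := congrArg (MvPowerSeries.coeff (pt n b)) h3
  rwa [coeff_pt_X1_mul_pderiv, coeff_pt_X0_mul_pderiv, coeff_swapX] at this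

/-- The coefficient formula that determines the Grunsky coefficients by recursion on the degree. -/
lemma grunsky_eq (D : PowerSeries A) (b n : ℕ) :
    grunsky D b n = n * MvPowerSeries.coeff (pt n b) (diffQuot D) -
      ∑ i ∈ (antidiagonal n ×ˢ antidiagonal b).erase ((0, n), (0, b)),
        MvPowerSeries.coeff (pt i.1.1 i.2.1) (diffQuot D) * grunsky D i.2.2 i.1.2 := by
  have := congrArg (MvPowerSeries.coeff (pt n b)) (diffQuot_mul_grunskySeries D)
  rw [coeff_pt_mul, coeff_pt_X0_mul_pderiv, ← Finset.sum_product',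
    ← Finset.add_sum_erase _ _ (a := ((0, n), (0, b))) (by simp [mem_antidiagonal])] at this
  rw [← this]
  simp only [coeff_diffQuot, grunsky]
  simp

/-- A property of the coefficients that is graded by the degree is inherited. -/
lemma grunsky_mem {S : ℕ → Set A} (hzero : ∀ d, (0 : A) ∈ S d)
    (hsub : ∀ d x y, x ∈ S d → y ∈ S d → x - y ∈ S d)
    (hmul : ∀ d d' x y, x ∈ S d → y ∈ S d' → x * y ∈ S (d + d'))
    (D : PowerSeries A) (hD : ∀ d, d ≠ 0 → PowerSeries.coeff d D ∈ S d)
    (b n : ℕ) : grunsky D b n ∈ S (n + b) := by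
  have hadd : ∀ d x y, x ∈ S d → y ∈ S d → x + y ∈ S d := fun d x y hx hy => by
    have := hsub d x (0 - y) hx (hsub d 0 y (hzero d) hy)
    simpa using this
  have hsum : ∀ d {ι : Type} (s : Finset ι) (f : ι → A), (∀ i ∈ s, f i ∈ S d) →
      ∑ i ∈ s, f i ∈ S d := fun d ι s f hf =>
    Finset.sum_induction f (· ∈ S d) (hadd d) (hzero d) hf
  have hR : ∀ n b, n + b ≠ 0 → MvPowerSeries.coeff (pt n b) (diffQuot D) ∈ S (n + b) := by
    intro n b h
    rw [coeff_diffQuot, if_neg (by omega)]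
    split_ifs
    · exact hzero _
    · have := hsub _ 0 _ (hzero _) (hD _ h)
      simpa using this
  induction h : n + b using Nat.strong_induction_on generalizing n b with
  | _ d ih =>
    subst h
    rw [grunsky_eq]
    rcases Nat.eq_zero_or_pos (n + b) with h0 | h0
    · obtain ⟨rfl, rfl⟩ : n = 0 ∧ b = 0 := by omega
      simp [hzero]
    · refine hsub _ _ _ ?_ (hsum _ _ _ ?_)
      · have := hsum (n + b) (Finset.range n)
          (fun _ => MvPowerSeries.coeff (pt n b) (diffQuot D)) fun _ _ => hR _ _ h0.ne'
        simpa using this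
      · rintro ⟨⟨i, i'⟩, ⟨j, j'⟩⟩ h
        simp only [Finset.mem_erase, Finset.mem_product, mem_antidiagonal, ne_eq,
          Prod.mk.injEq] at h
        obtain ⟨hne, hi, hj⟩ := h
        rw [show n + b = (i + j) + (i' + j') by omega]
        have hij : i + j ≠ 0 := by
          intro h
          exact hne ⟨⟨by omega, by omega⟩, by omega, by omega⟩
        exact hmul _ _ _ _ (hR _ _ hij) (ih _ (by omega) _ _ rfl)

/-- The grading of `grunsky_mem` is used with everything allowed in even degree and only `0` in odd
degree. -/
lemma grunsky_eq_zero_of_odd (D : PowerSeries A)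
    (hD : ∀ d, Odd d → PowerSeries.coeff d D = 0) (b n : ℕ) (h : Odd (n + b)) :
    grunsky D b n = 0 := by
  refine grunsky_mem (S := fun d => {x | Odd d → x = 0}) (by simp) ?_ ?_ D (fun d _ => hD d) b n h
  · intro d x y hx hy h
    rw [hx h, hy h, sub_zero]
  · intro d d' x y hx hy h
    rcases Nat.even_or_odd d with hd | hd
    · rw [hy ((Nat.odd_add'.mp h).mpr hd), mul_zero]
    · rw [hx hd, zero_mul]

end TwoVariables

/-! ### Inversion: powers of the inverse function of `p = D(x) / x` -/

section Inversion

variable {A : Type*} [CommRing A]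

lemma coeff_subst_X_mul (u f : PowerSeries A) (j : ℕ) :
    PowerSeries.coeff j (f.subst (PowerSeries.X * u)) =
      ∑ b ∈ Finset.range (j + 1), PowerSeries.coeff b f * PowerSeries.coeff (j - b) (u ^ b) := by
  have hs : PowerSeries.HasSubst (PowerSeries.X * u) :=
    PowerSeries.HasSubst.of_constantCoeff_zero' (by simp)
  rw [PowerSeries.coeff_subst' hs]
  have hc : ∀ b, PowerSeries.coeff j ((PowerSeries.X * u) ^ b) =
      if b ≤ j then PowerSeries.coeff (j - b) (u ^ b) else 0 := fun b => by
    rw [mul_pow, PowerSeries.coeff_X_pow_mul']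
  rw [finsum_eq_sum_of_support_subset (s := Finset.range (j + 1))]
  · refine Finset.sum_congr rfl fun b hb => ?_
    rw [Finset.mem_range] at hb
    rw [hc, if_pos (by omega), smul_eq_mul]
  · intro b hb
    by_contra h
    apply hb
    simp only [Finset.coe_range, Set.mem_Iio, not_lt] at h
    simp only [hc, if_neg (show ¬ b ≤ j by omega), smul_zero]

/-- `m` and `D` describe mutually inverse functions: if `p = D(1/ζ) ζ`, then `ζ = p m(1/p)`. -/
structure InversePair (D Dinv m minv : PowerSeries A) : Prop where
  constD : PowerSeries.constantCoeff D = 1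
  mul_Dinv : D * Dinv = 1
  mul_minv : m * minv = 1
  subst_eq : D.subst (PowerSeries.X * minv) = minv

variable {D Dinv m minv : PowerSeries A}

lemma hasSubst_X_mul (u : PowerSeries A) : PowerSeries.HasSubst (PowerSeries.X * u) :=
  PowerSeries.HasSubst.of_constantCoeff_zero' (by simp)

/-- The Faber polynomial as a polynomial in `p`, with reversed coefficients. -/
def faberReversed (D m minv : PowerSeries A) (n : ℕ) : PowerSeries A :=
  m ^ n * (faberSeries D n).subst (PowerSeries.X * minv)

namespace InversePair

/-- The recursion for `faberSeries` under `x = 1/ζ = π minv(π)`, `π = 1/p`. The factor `D` becomes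
`minv`, and multiplication by `m^(n+1)` turns each term into `π^k F_k(p)`. -/
lemma faberReversed_recursion (h : InversePair D Dinv m minv) (n : ℕ) :
    faberReversed D m minv n =
      ∑ i ∈ Finset.range (n + 1), PowerSeries.C (PowerSeries.coeff i D) * PowerSeries.X ^ i *
        faberReversed D m minv (n + 1 - i) +
      PowerSeries.C ((n + 1) * PowerSeries.coeff (n + 1) D) * PowerSeries.X ^ (n + 1) := by
  have hs := hasSubst_X_mul minv
  have hC : ∀ a : A, PowerSeries.substAlgHom hs (PowerSeries.C a) = PowerSeries.C a := fun a => by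
    rw [PowerSeries.coe_substAlgHom, PowerSeries.subst_C]; rfl
  have hX : PowerSeries.substAlgHom hs (PowerSeries.X : PowerSeries A) = PowerSeries.X * minv :=
    PowerSeries.substAlgHom_X hs
  have key := congrArg (PowerSeries.substAlgHom hs) (faberSeries_recursion D h.constD n)
  simp only [map_mul (PowerSeries.substAlgHom hs), map_add (PowerSeries.substAlgHom hs),
    map_sum (PowerSeries.substAlgHom hs), map_pow (PowerSeries.substAlgHom hs), hC, hX] at key
  rw [PowerSeries.coe_substAlgHom, h.subst_eq] at key
  have key2 := congrArg (m ^ (n + 1) * ·) key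
  have hmm : ∀ i, m ^ i * minv ^ i = 1 := fun i => by rw [← mul_pow, h.mul_minv, one_pow]
  simp only [faberReversed]
  calc m ^ n * (faberSeries D n).subst (PowerSeries.X * minv)
      = m ^ (n + 1) * (minv * (faberSeries D n).subst (PowerSeries.X * minv)) := by
        rw [pow_succ]
        linear_combination -(m ^ n * (faberSeries D n).subst (PowerSeries.X * minv)) * h.mul_minv
    _ = _ := by
        rw [key, mul_add, Finset.mul_sum]
        congr 1
        · refine Finset.sum_congr rfl fun i hi => ?_
          rw [Finset.mem_range] at hi
          rw [show n + 1 = (n + 1 - i) + i by omega, pow_add, mul_pow, Nat.add_sub_cancel]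
          linear_combination (PowerSeries.C (PowerSeries.coeff i D) * PowerSeries.X ^ i *
            (m ^ (n + 1 - i) * (faberSeries D (n + 1 - i)).subst (PowerSeries.X * minv))) * hmm i
        · rw [mul_pow, map_mul]
          linear_combination (PowerSeries.C ((n : A) + 1) * PowerSeries.C (PowerSeries.coeff (n + 1) D) *
            PowerSeries.X ^ (n + 1)) * hmm (n + 1)

/-- The Faber polynomial `F_n` has degree at most `n` in `p`, without negative powers. As `D_0 = 1`,
the summand `i = 0` of the recursion gives `F_{n+1}` in terms of the earlier ones. -/
lemma coeff_faberReversed (h : InversePair D Dinv m minv) {n k : ℕ} (hk : n < k) :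
    PowerSeries.coeff k (faberReversed D m minv n) = 0 := by
  induction n using Nat.strong_induction_on generalizing k with
  | _ n ih =>
    rcases n with _ | n
    · have : faberReversed D m minv 0 = 1 := by
        have : PowerSeries.mk (fun b => grunsky D b 0) = 0 := by
          ext b; simp [grunsky_zero_right]
        rw [faberReversed, faberSeries, this, ← PowerSeries.coe_substAlgHom (hasSubst_X_mul minv)]
        simp
      rw [this, PowerSeries.coeff_one, if_neg (by omega)]
    · have key := congrArg (PowerSeries.coeff k) (h.faberReversed_recursion n)
      rw [ih n (by omega) (by omega), Finset.sum_range_succ', map_add, map_add, map_sum,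
        PowerSeries.coeff_C_mul, PowerSeries.coeff_X_pow, if_neg (by omega)] at key
      have hD0 : PowerSeries.coeff 0 D = 1 := by simpa using h.constD
      rw [Finset.sum_eq_zero] at key
      · simpa [hD0] using key.symm
      · intro i hi
        rw [Finset.mem_range] at hi
        rw [mul_assoc, PowerSeries.coeff_C_mul, PowerSeries.coeff_X_pow_mul']
        split_ifs
        · rw [ih _ (by omega) (by omega), mul_zero]
        · rw [mul_zero]

/-- This is `ζ^n = F_n(p) + ∑ g_{b,n} ζ^(-b)`, multiplied by `p^(-n)`. -/
lemma pow_eq (h : InversePair D Dinv m minv) (n : ℕ) :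
    m ^ n = faberReversed D m minv n +
      PowerSeries.X ^ n * (PowerSeries.mk fun b => grunsky D b n).subst (PowerSeries.X * minv) := by
  have hs := hasSubst_X_mul minv
  have hmm : m ^ n * minv ^ n = 1 := by rw [← mul_pow, h.mul_minv, one_pow]
  rw [faberReversed, faberSeries, ← PowerSeries.coe_substAlgHom hs, map_sub, map_one, map_mul,
    map_pow, PowerSeries.substAlgHom_X, mul_pow]
  linear_combination (PowerSeries.X ^ n * PowerSeries.substAlgHom hs
    (PowerSeries.mk fun b => grunsky D b n)) * hmm

/-- The negative part of `ζ ^ n` as a combination of negative powers of `ζ`. -/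
lemma coeff_pow_add (h : InversePair D Dinv m minv) (n j : ℕ) (hj : j ≠ 0) :
    PowerSeries.coeff (n + j) (m ^ n) =
      ∑ b ∈ Finset.range (j + 1), grunsky D b n * PowerSeries.coeff (j - b) (minv ^ b) := by
  rw [h.pow_eq n, map_add, h.coeff_faberReversed (by omega), zero_add,
    PowerSeries.coeff_X_pow_mul', if_pos (by omega), Nat.add_sub_cancel_left, coeff_subst_X_mul]
  simp

/-- `X * Dinv` is `1/p` as a series in `1/ζ`. Reading `1/p` as a combination of powers of `1/ζ`
later yields the derivatives of `v_1`. -/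
lemma subst_X_mul_Dinv (h : InversePair D Dinv m minv) :
    (PowerSeries.X * Dinv).subst (PowerSeries.X * minv) = PowerSeries.X := by
  have hs := hasSubst_X_mul minv
  have h1 := congrArg (PowerSeries.substAlgHom hs) h.mul_Dinv
  rw [map_mul, map_one, PowerSeries.coe_substAlgHom, h.subst_eq] at h1
  rw [← PowerSeries.coe_substAlgHom hs, map_mul, PowerSeries.substAlgHom_X,
    PowerSeries.coe_substAlgHom, mul_assoc, h1, mul_one]

/-- Lagrange inversion for `1 / p`. -/
lemma coeff_pow_pred (h : InversePair D Dinv m minv) (n : ℕ) :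
    PowerSeries.coeff n (m ^ (n + 1)) = (n + 1) * PowerSeries.coeff n Dinv := by
  set Q := faberReversed D m minv with hQ
  have hD0 : PowerSeries.coeff 0 D = 1 := by simpa using h.constD
  -- `a` collects the constant terms `F_n(0)` and `e` the linear coefficients `F_{n+1}'(0)`. The
  -- recursion at the powers `p^0` and `p^1` gives `D a = D - x D'` and `D e = a`, so `e` is the
  -- derivative of `x / D`.
  set a : PowerSeries A := PowerSeries.mk fun n => PowerSeries.coeff n (Q n) with ha
  set e : PowerSeries A := PowerSeries.mk fun n => PowerSeries.coeff n (Q (n + 1)) with he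
  have hcoeff : ∀ n k, PowerSeries.coeff k (Q n) =
      ∑ i ∈ Finset.range (n + 1), PowerSeries.coeff i D *
        (if i ≤ k then PowerSeries.coeff (k - i) (Q (n + 1 - i)) else 0) +
      (n + 1) * PowerSeries.coeff (n + 1) D * (if k = n + 1 then 1 else 0) := fun n k => by
    conv_lhs => rw [hQ, h.faberReversed_recursion n]
    simp only [map_add, map_sum, mul_assoc, PowerSeries.coeff_C_mul, PowerSeries.coeff_X_pow_mul',
      PowerSeries.coeff_X_pow, hQ]
  have hQ0 : PowerSeries.coeff 0 (Q 0) = 1 := by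
    have : PowerSeries.mk (fun b => grunsky D b 0) = 0 := by
      ext b; simp [grunsky_zero_right]
    rw [hQ, faberReversed, faberSeries, this,
      ← PowerSeries.coe_substAlgHom (hasSubst_X_mul minv)]
    simp
  have hDa : D * a = D - PowerSeries.X * PowerSeries.derivative A D := by
    ext k
    rw [PowerSeries.coeff_mul, map_sub]
    rcases k with _ | k
    · simp [ha, hD0, hQ0]
    -- The coefficient just above the degree of `F_k` vanishes, and the recursion turns this into a
    -- relation among constant terms.
    · have := hcoeff k (k + 1)
      rw [h.coeff_faberReversed (by omega), if_pos rfl, mul_one] at this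
      rw [Finset.Nat.sum_antidiagonal_eq_sum_range_succ
        (fun i j => PowerSeries.coeff i D * PowerSeries.coeff j a), Finset.sum_range_succ,
        PowerSeries.coeff_succ_X_mul, PowerSeries.coeff_derivative]
      have h2 : ∑ i ∈ Finset.range (k + 1), PowerSeries.coeff i D *
          PowerSeries.coeff (k + 1 - i) a = ∑ i ∈ Finset.range (k + 1), PowerSeries.coeff i D *
        (if i ≤ k + 1 then PowerSeries.coeff (k + 1 - i) (Q (k + 1 - i)) else 0) := by
        refine Finset.sum_congr rfl fun i hi => ?_
        rw [Finset.mem_range] at hi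
        rw [if_pos (by omega), ha, PowerSeries.coeff_mk]
      rw [h2, Nat.sub_self]
      simp only [ha, PowerSeries.coeff_mk, hQ0]
      linear_combination -this
  have hDe : D * e = a := by
    ext k
    rw [PowerSeries.coeff_mul, Finset.Nat.sum_antidiagonal_eq_sum_range_succ
        (fun i j => PowerSeries.coeff i D * PowerSeries.coeff j e)]
    have := hcoeff k k
    rw [if_neg (by omega), mul_zero, add_zero] at this
    simp only [ha, he, PowerSeries.coeff_mk]
    rw [this]
    refine Finset.sum_congr rfl fun i hi => ?_
    rw [Finset.mem_range] at hi
    rw [if_pos (by omega), show k - i + 1 = k + 1 - i by omega]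
  have hDinv' : PowerSeries.derivative A Dinv = - Dinv ^ 2 * PowerSeries.derivative A D :=
    (PowerSeries.derivative A).leibniz_of_mul_eq_one (by rw [mul_comm, h.mul_Dinv])
  have hE : e = PowerSeries.derivative A (PowerSeries.X * Dinv) := by
    have h1 : e = Dinv * (Dinv * (D - PowerSeries.X * PowerSeries.derivative A D)) := by
      rw [← hDa, ← hDe]
      linear_combination (-e * (D * Dinv + 1)) * h.mul_Dinv
    rw [h1, Derivation.leibniz, hDinv', PowerSeries.derivative_X, smul_eq_mul, smul_eq_mul]
    linear_combination Dinv * h.mul_Dinv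
  have hm : PowerSeries.coeff n (m ^ (n + 1)) = PowerSeries.coeff n e := by
    rw [h.pow_eq (n + 1), map_add, PowerSeries.coeff_X_pow_mul', if_neg (by omega), add_zero, he,
      PowerSeries.coeff_mk]
  rw [hm, hE, PowerSeries.coeff_derivative, PowerSeries.coeff_succ_X_mul, mul_comm]

end InversePair

/-- Every even series `m = M(π²)` belongs to an inverse pair with an even series `D`. -/
lemma exists_inversePair (M Minv : PowerSeries A) (hM : M * Minv = 1)
    (hM1 : PowerSeries.constantCoeff M = 1) :
    ∃ D Dinv : PowerSeries A, (∀ d, Odd d → PowerSeries.coeff d D = 0) ∧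
      InversePair D Dinv (M.subst (PowerSeries.X ^ 2 : PowerSeries A))
        (Minv.subst (PowerSeries.X ^ 2 : PowerSeries A)) := by
  have hMi1 : PowerSeries.constantCoeff Minv = 1 := by
    have := congrArg PowerSeries.constantCoeff hM
    rwa [map_mul, hM1, one_mul, map_one] at this
  -- `P` is `1/ζ²` as a series in `π²`, because `1/ζ = π minv(π)`. Its compositional inverse `I`
  -- gives `π²` in terms of `x² = 1/ζ²`, so `D(x) = Minv(I(x²))` is even.
  set P : PowerSeries A := PowerSeries.X * Minv ^ 2 with hP
  have hP0 : PowerSeries.constantCoeff P = 0 := by simp [hP]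
  have hP1 : IsUnit (PowerSeries.coeff 1 P) := by
    have : PowerSeries.coeff 1 P = 1 := by
      rw [hP, show (1 : ℕ) = 0 + 1 from rfl, PowerSeries.coeff_succ_X_mul]; simp [hMi1]
    rw [this]; exact isUnit_one
  set I := P.substInvOfIsUnit hP1 with hI
  have hIs : PowerSeries.HasSubst I := PowerSeries.HasSubst.substInvOfIsUnit ..
  have hPs : PowerSeries.HasSubst P := PowerSeries.HasSubst.of_constantCoeff_zero' hP0
  have h2s : PowerSeries.HasSubst (PowerSeries.X ^ 2 : PowerSeries A) :=
    PowerSeries.HasSubst.X_pow two_ne_zero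
  have hback : ∀ f : PowerSeries A, PowerSeries.subst P (PowerSeries.subst I f) = f := fun f => by
    rw [PowerSeries.subst_comp_subst_apply hIs hPs, PowerSeries.subst_substInvOfIsUnit_left]
    · exact PowerSeries.X_subst f
    all_goals exact hP0
  refine ⟨PowerSeries.subst (PowerSeries.X ^ 2 : PowerSeries A) (PowerSeries.subst I Minv),
    PowerSeries.subst (PowerSeries.X ^ 2 : PowerSeries A) (PowerSeries.subst I M), ?_, ?_, ?_, ?_, ?_⟩
  · intro d hd
    rw [PowerSeries.coeff_subst_X_pow two_ne_zero, if_neg]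
    rwa [← even_iff_two_dvd, Nat.not_even_iff_odd]
  · have hconst : PowerSeries.constantCoeff (Minv.subst I) = 1 := by
      have h0 : PowerSeries.constantCoeff ((Minv - 1).subst I) = 0 :=
        PowerSeries.constantCoeff_subst_eq_zero
          (PowerSeries.constantCoeff_substInvOfIsUnit ..) _ (by simp [hMi1])
      rw [← PowerSeries.coe_substAlgHom hIs, map_sub, map_one, map_sub, map_one,
        PowerSeries.coe_substAlgHom] at h0
      linear_combination h0
    rw [PowerSeries.constantCoeff_subst_X_pow two_ne_zero, hconst]; simp
  · rw [← PowerSeries.subst_mul h2s, ← PowerSeries.subst_mul hIs, mul_comm, hM,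
      ← PowerSeries.coe_substAlgHom hIs, map_one, ← PowerSeries.coe_substAlgHom h2s, map_one]
  · rw [← PowerSeries.subst_mul h2s, hM, ← PowerSeries.coe_substAlgHom h2s, map_one]
  · set minv := Minv.subst (PowerSeries.X ^ 2 : PowerSeries A) with hminv
    have hs := hasSubst_X_mul minv
    have h3 : (PowerSeries.X ^ 2 : PowerSeries A).subst (PowerSeries.X * minv) =
        P.subst (PowerSeries.X ^ 2 : PowerSeries A) := by
      rw [← PowerSeries.coe_substAlgHom hs, map_pow, PowerSeries.substAlgHom_X,
        ← PowerSeries.coe_substAlgHom h2s, hP, map_mul, map_pow, PowerSeries.substAlgHom_X,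
        PowerSeries.coe_substAlgHom, ← hminv]
      ring
    rw [PowerSeries.subst_comp_subst_apply h2s hs, h3,
      ← PowerSeries.subst_comp_subst_apply hPs h2s, hback]

end Inversion

/-! ### The series `(1 + h X) ^ (e / h)` -/

/-- The power series of `(1 + h X) ^ (e / h)`. -/
def powSeries (h e : ℚ) : PowerSeries ℚ :=
  PowerSeries.mk fun m => (∏ i ∈ Finset.range m, (e - i * h)) / m.factorial

lemma ring_choose_eq_prod (r : ℚ) (n : ℕ) :
    Ring.choose r n = (∏ i ∈ Finset.range n, (r - i)) / n.factorial := by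
  have : (descPochhammer ℤ n).smeval r = ∏ i ∈ Finset.range n, (r - i) := by
    induction n with
    | zero => simp
    | succ n ih =>
      rw [descPochhammer_succ_right, Polynomial.smeval_mul, ih, Finset.prod_range_succ]
      simp [Polynomial.smeval_sub, Polynomial.smeval_natCast]
  rw [Ring.choose_eq_smul, this, smul_eq_mul, div_eq_inv_mul]

lemma powSeries_eq_rescale {h : ℚ} (hh : h ≠ 0) (e : ℚ) :
    powSeries h e = PowerSeries.rescale h (PowerSeries.binomialSeries ℚ (e / h)) := by
  ext m
  rw [PowerSeries.coeff_rescale, PowerSeries.binomialSeries_coeff, ring_choose_eq_prod, powSeries,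
    PowerSeries.coeff_mk, smul_eq_mul, mul_one, ← mul_div_assoc]
  congr 1
  nth_rewrite 2 [← Finset.card_range m]
  rw [← Finset.prod_const, ← Finset.prod_mul_distrib]
  refine Finset.prod_congr rfl fun i _ => ?_
  field_simp

lemma powSeries_add {h : ℚ} (hh : h ≠ 0) (e e' : ℚ) :
    powSeries h (e + e') = powSeries h e * powSeries h e' := by
  rw [powSeries_eq_rescale hh, powSeries_eq_rescale hh, powSeries_eq_rescale hh, add_div,
    PowerSeries.binomialSeries_add, map_mul]

lemma powSeries_zero (h : ℚ) : powSeries h 0 = 1 := by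
  ext m
  rw [powSeries, PowerSeries.coeff_mk, PowerSeries.coeff_one]
  rcases m with _ | m
  · simp
  · rw [Finset.prod_range_succ']
    simp

lemma constantCoeff_powSeries (h e : ℚ) : PowerSeries.constantCoeff (powSeries h e) = 1 := by
  rw [← PowerSeries.coeff_zero_eq_constantCoeff_apply, powSeries, PowerSeries.coeff_mk]; simp

lemma powSeries_pow {h : ℚ} (hh : h ≠ 0) (e : ℚ) (n : ℕ) :
    powSeries h e ^ n = powSeries h (n * e) := by
  induction n with
  | zero => simp [powSeries_zero]
  | succ n ih => rw [pow_succ, ih, ← powSeries_add hh]; push_cast; ring_nf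

/-! ### Sums over multi-indices -/

lemma mem_multiIndices {N w : ℕ} {a : ℕ →₀ ℕ} :
    a ∈ multiIndices N w ↔ a.support ⊆ Finset.Icc 1 (N - 1) ∧
      ∑ k ∈ Finset.Icc 1 (N - 1), (N - k) * a k = w := by
  rw [multiIndices, Finset.mem_filter, Finset.mem_finsupp_iff]
  refine ⟨fun h => ⟨h.1.1, h.2⟩, fun h => ⟨⟨h.1, fun k hk => ?_⟩, h.2⟩⟩
  have h1 : (N - k) * a k ≤ w := by
    rw [← h.2]
    exact Finset.single_le_sum (f := fun k => (N - k) * a k) (fun _ _ => Nat.zero_le _) hk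
  have h2 : 1 ≤ N - k := by
    rw [Finset.mem_Icc] at hk; omega
  rw [Finset.mem_range]
  nlinarith

/-- The sum of `c_{|a|} v^{(a)}` over all multi-indices of weight `w`. -/
def indexSum (N : ℕ) (c : ℕ → ℚ) (w : ℕ) : MvPolynomial ℕ ℚ :=
  ∑ a ∈ multiIndices N w, MvPolynomial.C (c (size N a)) * dividedMonomial N a

lemma coeff_indexSum (N : ℕ) (c : ℕ → ℚ) (w : ℕ) (a : ℕ →₀ ℕ) :
    MvPolynomial.coeff a (indexSum N c w) = if a ∈ multiIndices N w then
      c (size N a) * (∏ k ∈ Finset.Icc 1 (N - 1), ((a k).factorial : ℚ))⁻¹ else 0 := by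
  classical
  simp only [indexSum, MvPolynomial.coeff_sum, dividedMonomial, MvPolynomial.coeff_C_mul,
    MvPolynomial.coeff_monomial, mul_ite, mul_zero]
  rw [Finset.sum_ite_eq' (multiIndices N w) a]

lemma size_pos {N w : ℕ} (hw : w ≠ 0) {a : ℕ →₀ ℕ} (ha : a ∈ multiIndices N w) :
    size N a ≠ 0 := by
  intro h
  rw [size, Finset.sum_eq_zero_iff] at h
  apply hw
  rw [← (mem_multiIndices.mp ha).2]
  exact Finset.sum_eq_zero fun k hk => by rw [h k hk, mul_zero]

lemma add_single_mem_multiIndices {N w k : ℕ} (hk : k ∈ Finset.Icc 1 (N - 1)) (a : ℕ →₀ ℕ) :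
    a + Finsupp.single k 1 ∈ multiIndices N w ↔
      N - k ≤ w ∧ a ∈ multiIndices N (w - (N - k)) := by
  classical
  rw [mem_multiIndices, mem_multiIndices]
  have h1 : ∑ j ∈ Finset.Icc 1 (N - 1), (N - j) * (a + Finsupp.single k 1 : ℕ →₀ ℕ) j =
      ∑ j ∈ Finset.Icc 1 (N - 1), (N - j) * a j + (N - k) := by
    simp only [Finsupp.add_apply, mul_add, Finset.sum_add_distrib, Finsupp.single_apply]
    congr 1
    rw [Finset.sum_eq_single_of_mem k hk]
    · simp
    · intro j _ hj; simp [hj.symm]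
  have h2 : (a + Finsupp.single k 1).support ⊆ Finset.Icc 1 (N - 1) ↔
      a.support ⊆ Finset.Icc 1 (N - 1) := by
    constructor
    · intro h j hj
      exact h (by simp only [Finsupp.mem_support_iff, Finsupp.add_apply] at hj ⊢; omega)
    · intro h j hj
      by_cases hjk : k = j
      · rwa [← hjk]
      · exact h (by simpa [hjk] using hj)
  rw [h1, h2]
  constructor
  · rintro ⟨h, h'⟩
    exact ⟨by omega, h, by omega⟩
  · rintro ⟨h, h', h''⟩
    exact ⟨h', by omega⟩

lemma size_add_single {N k : ℕ} (hk : k ∈ Finset.Icc 1 (N - 1)) (a : ℕ →₀ ℕ) :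
    size N (a + Finsupp.single k 1) = size N a + 1 := by
  classical
  simp only [size, Finsupp.add_apply, Finset.sum_add_distrib, Finsupp.single_apply]
  rw [Finset.sum_ite_eq, if_pos hk]

lemma prod_factorial_add_single {N k : ℕ} (hk : k ∈ Finset.Icc 1 (N - 1)) (a : ℕ →₀ ℕ) :
    ∏ j ∈ Finset.Icc 1 (N - 1), (((a + Finsupp.single k 1 : ℕ →₀ ℕ) j).factorial : ℚ) =
      (a k + 1) * ∏ j ∈ Finset.Icc 1 (N - 1), ((a j).factorial : ℚ) := by
  classical
  rw [← Finset.mul_prod_erase _ _ hk, ← Finset.mul_prod_erase _ (fun j => ((a j).factorial : ℚ)) hk,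
    ← mul_assoc]
  congr 1
  · simp [Nat.factorial_succ]
  · refine Finset.prod_congr rfl fun j hj => ?_
    have : k ≠ j := fun h => by simp [h] at hj
    simp [this]

/-- Differentiating a divided monomial only lowers `a_k` by one. Thus `|a|` drops by one, which
shifts `c`, and the weight drops by `N - k`. -/
lemma pderiv_indexSum {N k : ℕ} (hk : k ∈ Finset.Icc 1 (N - 1)) (c : ℕ → ℚ) (w : ℕ) :
    MvPolynomial.pderiv k (indexSum N c w) =
      if N - k ≤ w then indexSum N (fun m => c (m + 1)) (w - (N - k)) else 0 := by
  ext a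
  rw [MvPolynomial.coeff_pderiv, coeff_indexSum, apply_ite (MvPolynomial.coeff a), coeff_indexSum]
  simp only [add_single_mem_multiIndices hk, MvPolynomial.coeff_zero, size_add_single hk,
    prod_factorial_add_single hk]
  by_cases h1 : N - k ≤ w
  · by_cases h2 : a ∈ multiIndices N (w - (N - k))
    · simp only [h1, h2, and_self, if_true, mul_inv]
      have : (a k + 1 : ℚ) ≠ 0 := by positivity
      field_simp
    · simp [h2]
  · simp [h1]

lemma pderiv_indexSum_of_notMem {N k : ℕ} (hk : k ∉ Finset.Icc 1 (N - 1)) (c : ℕ → ℚ) (w : ℕ) :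
    MvPolynomial.pderiv k (indexSum N c w) = 0 := by
  ext a
  rw [MvPolynomial.coeff_pderiv, coeff_indexSum, if_neg, zero_mul, MvPolynomial.coeff_zero]
  intro h
  exact hk ((mem_multiIndices.mp h).1 (by simp))

/-- `∑ v_k y ^ (N - k)`. -/
def vSeries (N : ℕ) : PowerSeries (MvPolynomial ℕ ℚ) :=
  ∑ k ∈ Finset.Icc 1 (N - 1), PowerSeries.C (MvPolynomial.X k) * PowerSeries.X ^ (N - k)

/-- The multinomial theorem: `m! / ∏ a_k!` times a monomial is `m!` times the divided monomial. -/
lemma coeff_vSeries_pow (N m w : ℕ) :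
    PowerSeries.coeff w (vSeries N ^ m) = indexSum N (fun j => if j = m then m.factorial else 0) w := by
  classical
  rw [vSeries, Finset.sum_pow_eq_sum_piAntidiag, map_sum]
  have hterm : ∀ a : ℕ → ℕ, PowerSeries.coeff w
      ((Nat.multinomial (Finset.Icc 1 (N - 1)) a : PowerSeries (MvPolynomial ℕ ℚ)) *
        ∏ k ∈ Finset.Icc 1 (N - 1),
          (PowerSeries.C (MvPolynomial.X k) * PowerSeries.X ^ (N - k)) ^ a k) =
      if ∑ k ∈ Finset.Icc 1 (N - 1), (N - k) * a k = w then
        (Nat.multinomial (Finset.Icc 1 (N - 1)) a : MvPolynomial ℕ ℚ) *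
          ∏ k ∈ Finset.Icc 1 (N - 1), MvPolynomial.X k ^ a k else 0 := by
    intro a
    have : (Nat.multinomial (Finset.Icc 1 (N - 1)) a : PowerSeries (MvPolynomial ℕ ℚ)) *
        ∏ k ∈ Finset.Icc 1 (N - 1),
          (PowerSeries.C (MvPolynomial.X k) * PowerSeries.X ^ (N - k)) ^ a k =
        PowerSeries.C ((Nat.multinomial (Finset.Icc 1 (N - 1)) a : MvPolynomial ℕ ℚ) *
          ∏ k ∈ Finset.Icc 1 (N - 1), MvPolynomial.X k ^ a k) *
          PowerSeries.X ^ (∑ k ∈ Finset.Icc 1 (N - 1), (N - k) * a k) := by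
      simp only [mul_pow, Finset.prod_mul_distrib, map_mul, map_prod, map_pow, map_natCast,
        ← pow_mul, Finset.prod_pow_eq_pow_sum, mul_assoc]
    rw [this, PowerSeries.coeff_C_mul, PowerSeries.coeff_X_pow, mul_ite, mul_one, mul_zero]
    simp only [eq_comm]
  simp only [hterm]
  rw [← Finset.sum_filter, indexSum, ← Finset.sum_filter_add_sum_filter_not (multiIndices N w)
    (fun a => size N a = m)]
  rw [Finset.sum_eq_zero (s := (multiIndices N w).filter fun a => ¬ size N a = m), add_zero]
  swap
  · intro a ha
    rw [if_neg (Finset.mem_filter.mp ha).2]; simp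
  refine Finset.sum_bij' (fun a ha => Finsupp.onFinset (Finset.Icc 1 (N - 1)) a
    (Finset.mem_piAntidiag.mp (Finset.mem_filter.mp ha).1).2) (fun a _ => ⇑a) ?_ ?_ ?_ ?_ ?_
  · intro a ha
    rw [Finset.mem_filter] at ha
    rw [Finset.mem_filter, mem_multiIndices, size]
    refine ⟨⟨Finsupp.support_onFinset_subset, ?_⟩, ?_⟩
    · simpa using ha.2
    · simpa using (Finset.mem_piAntidiag.mp ha.1).1
  · intro a ha
    rw [Finset.mem_filter, mem_multiIndices] at ha
    rw [Finset.mem_filter, Finset.mem_piAntidiag]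
    refine ⟨⟨ha.2, fun i hi => ha.1.1 (by simpa using hi)⟩, ha.1.2⟩
  · intro a ha; rfl
  · intro a ha; ext; rfl
  · intro a ha
    rw [Finset.mem_filter, Finset.mem_piAntidiag] at ha
    have hsize : size N (Finsupp.onFinset (Finset.Icc 1 (N - 1)) a ha.1.2) = m := by
      simpa [size] using ha.1.1
    rw [if_pos hsize, dividedMonomial, MvPolynomial.C_mul_monomial, MvPolynomial.monomial_eq,
      Finsupp.prod_of_support_subset _ Finsupp.support_onFinset_subset _ (by simp)]
    simp only [Finsupp.onFinset_apply]
    congr 1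
    rw [← map_natCast (MvPolynomial.C (R := ℚ) (σ := ℕ))]
    congr 1
    have := Nat.multinomial_spec (Finset.Icc 1 (N - 1)) a
    rw [ha.1.1] at this
    rw [← this]
    push_cast
    have : ∏ k ∈ Finset.Icc 1 (N - 1), ((a k).factorial : ℚ) ≠ 0 :=
      Finset.prod_ne_zero_iff.mpr fun k _ => by positivity
    field_simp

lemma coeff_subst_eq_sum {A : Type*} [CommRing A] [Algebra ℚ A] (V : PowerSeries A)
    (hV : PowerSeries.constantCoeff V = 0) (f : PowerSeries ℚ) {w n : ℕ} (hn : w < n) :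
    PowerSeries.coeff w (f.subst V) =
      ∑ d ∈ Finset.range n, PowerSeries.coeff d f • PowerSeries.coeff w (V ^ d) := by
  rw [PowerSeries.coeff_subst' (PowerSeries.HasSubst.of_constantCoeff_zero' hV)]
  refine finsum_eq_sum_of_support_subset _ fun d hd => ?_
  by_contra h
  apply hd
  simp only [Finset.coe_range, Set.mem_Iio, not_lt] at h
  obtain ⟨U, rfl⟩ := PowerSeries.X_dvd_iff.mpr hV
  change _ • PowerSeries.coeff w ((PowerSeries.X * U) ^ d) = 0
  rw [mul_pow, PowerSeries.coeff_X_pow_mul', if_neg (by omega), smul_zero]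

lemma constantCoeff_vSeries (N : ℕ) : PowerSeries.constantCoeff (vSeries N) = 0 := by
  rw [vSeries, map_sum]
  refine Finset.sum_eq_zero fun k hk => ?_
  rw [Finset.mem_Icc] at hk
  simp [show N - k ≠ 0 by omega]

lemma size_le {N w : ℕ} {a : ℕ →₀ ℕ} (ha : a ∈ multiIndices N w) : size N a ≤ w := by
  rw [← (mem_multiIndices.mp ha).2, size]
  refine Finset.sum_le_sum fun k hk => ?_
  rw [Finset.mem_Icc] at hk
  exact Nat.le_mul_of_pos_left _ (by omega)

/-- This generating function turns the explicit sums in `psi1` and `psi2` into coefficients of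
powers of `1 + h V`. -/
lemma coeff_subst_vSeries (N : ℕ) (f : PowerSeries ℚ) (w : ℕ) :
    PowerSeries.coeff w (f.subst (vSeries N)) =
      indexSum N (fun m => m.factorial * PowerSeries.coeff m f) w := by
  rw [coeff_subst_eq_sum _ (constantCoeff_vSeries N) f (Nat.lt_succ_self w)]
  simp only [coeff_vSeries_pow, indexSum, Finset.smul_sum]
  rw [Finset.sum_comm]
  refine Finset.sum_congr rfl fun a ha => ?_
  rw [Finset.sum_eq_single_of_mem (size N a)]
  · rw [if_pos rfl, ← smul_mul_assoc, MvPolynomial.smul_eq_C_mul, ← map_mul, mul_comm (_ : ℚ)]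
  · exact Finset.mem_range_succ_iff.mpr (size_le ha)
  · intro d _ hd
    rw [if_neg hd.symm]; simp

/-! ### The superpotential of `D_N` -/

/-- The Coxeter number `h = 2 (N - 1)`. -/
def cox (N : ℕ) : ℚ := 2 * ((N : ℚ) - 1)

/-- `∑ v_k y ^ (N - k) + v_N ^ 2 / 2 * y ^ N`; the superpotential is `p ^ h (1 + h V(p⁻²))`. -/
def superSeries (N : ℕ) : PowerSeries (MvPolynomial ℕ ℚ) :=
  vSeries N + PowerSeries.C (MvPolynomial.C (1 / 2) * MvPolynomial.X N ^ 2) * PowerSeries.X ^ N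

/-- The `h`-th root of the superpotential, divided by `p`, as a series in `y = p⁻²`. -/
def superRoot (N : ℕ) : PowerSeries (MvPolynomial ℕ ℚ) :=
  (powSeries (cox N) 1).subst (superSeries N)

/-- The inverse of `superRoot N`. -/
def superRootInv (N : ℕ) : PowerSeries (MvPolynomial ℕ ℚ) :=
  (powSeries (cox N) (-1)).subst (superSeries N)

section

variable {N : ℕ}

lemma cox_ne_zero (hN : 4 ≤ N) : cox N ≠ 0 := by
  have : (4 : ℚ) ≤ N := by exact_mod_cast hN
  rw [cox]; linarith

lemma constantCoeff_superSeries (hN : 4 ≤ N) :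
    PowerSeries.constantCoeff (superSeries N) = 0 := by
  rw [superSeries, map_add, constantCoeff_vSeries]
  simp [show N ≠ 0 by omega]

lemma hasSubst_superSeries (hN : 4 ≤ N) : PowerSeries.HasSubst (superSeries N) :=
  PowerSeries.HasSubst.of_constantCoeff_zero' (constantCoeff_superSeries hN)

lemma superRoot_pow (hN : 4 ≤ N) (n : ℕ) :
    superRoot N ^ n = (powSeries (cox N) n).subst (superSeries N) := by
  rw [superRoot, ← PowerSeries.subst_pow (hasSubst_superSeries hN),
    powSeries_pow (cox_ne_zero hN), mul_one]

lemma superRootInv_pow (hN : 4 ≤ N) (n : ℕ) :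
    superRootInv N ^ n = (powSeries (cox N) (-n)).subst (superSeries N) := by
  rw [superRootInv, ← PowerSeries.subst_pow (hasSubst_superSeries hN),
    powSeries_pow (cox_ne_zero hN), mul_neg_one]

lemma superRoot_mul_inv (hN : 4 ≤ N) : superRoot N * superRootInv N = 1 := by
  rw [superRoot, superRootInv, ← PowerSeries.subst_mul (hasSubst_superSeries hN),
    ← powSeries_add (cox_ne_zero hN), add_neg_cancel, powSeries_zero,
    ← PowerSeries.coe_substAlgHom (hasSubst_superSeries hN), map_one]

lemma constantCoeff_subst_superSeries (hN : 4 ≤ N) (e : ℚ) :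
    PowerSeries.coeff 0 ((powSeries (cox N) e).subst (superSeries N)) = 1 := by
  rw [coeff_subst_eq_sum _ (constantCoeff_superSeries hN) _ (Nat.zero_lt_one)]
  simp [constantCoeff_powSeries]

/-- The square of the summand `v_N² y^N / 2` starts at `y^(2N)`, so below that order the first-order
Taylor expansion in it is exact. -/
lemma coeff_subst_superSeries (hN : 4 ≤ N) (f : PowerSeries ℚ) {w : ℕ} (hw : w < 2 * N) :
    PowerSeries.coeff w (f.subst (superSeries N)) = PowerSeries.coeff w (f.subst (vSeries N)) +
      MvPolynomial.C (1 / 2) * MvPolynomial.X N ^ 2 *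
        (if N ≤ w then
          PowerSeries.coeff (w - N) ((PowerSeries.derivative ℚ f).subst (vSeries N)) else 0) := by
  rw [coeff_subst_eq_sum _ (constantCoeff_superSeries hN) _ (Nat.lt_succ_self w),
    coeff_subst_eq_sum _ (constantCoeff_vSeries N) _ (Nat.lt_succ_self w)]
  set u : MvPolynomial ℕ ℚ := MvPolynomial.C (1 / 2) * MvPolynomial.X N ^ 2 with hu
  have hpow : ∀ d : ℕ, PowerSeries.coeff w (superSeries N ^ d) = PowerSeries.coeff w (vSeries N ^ d) +
      u * ((d : MvPolynomial ℕ ℚ) *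
        (if N ≤ w then PowerSeries.coeff (w - N) (vSeries N ^ (d - 1)) else 0)) := by
    intro d
    obtain ⟨k, hk⟩ := Polynomial.powAddExpansion (vSeries N)
      (PowerSeries.C u * PowerSeries.X ^ N) d
    rw [superSeries, ← hu, hk, map_add, map_add]
    have h2 : PowerSeries.coeff w (k * (PowerSeries.C u * PowerSeries.X ^ N) ^ 2) = 0 := by
      rw [mul_pow, ← pow_mul, ← mul_assoc, mul_comm, PowerSeries.coeff_X_pow_mul',
        if_neg (by omega)]
    have h1 : PowerSeries.coeff w ((d : PowerSeries (MvPolynomial ℕ ℚ)) * vSeries N ^ (d - 1) *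
        (PowerSeries.C u * PowerSeries.X ^ N)) = u * ((d : MvPolynomial ℕ ℚ) *
        (if N ≤ w then PowerSeries.coeff (w - N) (vSeries N ^ (d - 1)) else 0)) := by
      rw [show (d : PowerSeries (MvPolynomial ℕ ℚ)) * vSeries N ^ (d - 1) *
        (PowerSeries.C u * PowerSeries.X ^ N) = PowerSeries.C u *
          (PowerSeries.C (d : MvPolynomial ℕ ℚ) * (PowerSeries.X ^ N * vSeries N ^ (d - 1))) by
          rw [map_natCast]; ring]
      rw [PowerSeries.coeff_C_mul, PowerSeries.coeff_C_mul, PowerSeries.coeff_X_pow_mul']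
    rw [h1, h2, add_zero]
  simp only [hpow, smul_add, Finset.sum_add_distrib]
  congr 1
  split_ifs with hNw
  · rw [coeff_subst_eq_sum _ (constantCoeff_vSeries N) _ (show w - N < w by omega),
      Finset.sum_range_succ', Finset.mul_sum]
    simp only [Nat.cast_zero, zero_mul, mul_zero, smul_zero, add_zero]
    refine Finset.sum_congr rfl fun d _ => ?_
    rw [PowerSeries.coeff_derivative, Nat.add_sub_cancel, MvPolynomial.smul_eq_C_mul,
      MvPolynomial.smul_eq_C_mul]
    simp only [map_mul, map_add, map_natCast, map_one, Nat.cast_add, Nat.cast_one]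
    ring
  · simp

lemma coeff_subst_superSeries_of_lt (hN : 4 ≤ N) (f : PowerSeries ℚ) {w : ℕ} (hw : w < N) :
    PowerSeries.coeff w (f.subst (superSeries N)) = PowerSeries.coeff w (f.subst (vSeries N)) := by
  rw [coeff_subst_superSeries hN f (by omega), if_neg (by omega), mul_zero, add_zero]

lemma derivative_powSeries (h e : ℚ) :
    PowerSeries.derivative ℚ (powSeries h e) = e • powSeries h (e - h) := by
  ext m
  rw [PowerSeries.coeff_derivative, PowerSeries.coeff_smul, powSeries, powSeries,
    PowerSeries.coeff_mk, PowerSeries.coeff_mk, Finset.prod_range_succ', Nat.factorial_succ]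
  have : ∏ i ∈ Finset.range m, (e - ((i + 1 : ℕ) : ℚ) * h) =
      ∏ i ∈ Finset.range m, (e - h - i * h) :=
    Finset.prod_congr rfl fun i _ => by push_cast; ring
  rw [this, smul_eq_mul]
  push_cast
  have h1 : (m.factorial : ℚ) ≠ 0 := by positivity
  have h2 : (m + 1 : ℚ) ≠ 0 := by positivity
  field_simp
  simp only [mul_zero, sub_zero, mul_comm]

/-- The numbers `c_{γ,m}` are falling products of step `h = 2(N-1)` starting at `-(2γ-1)`, hence
belong to `(1 + h X)^(-(2γ-1)/h)`. -/
lemma neg_one_pow_mul_oddProd (N γ m : ℕ) :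
    (-1) ^ m * oddProd N γ m = m.factorial *
      PowerSeries.coeff m (powSeries (cox N) (-(2 * (γ : ℚ) - 1))) := by
  rw [powSeries, PowerSeries.coeff_mk, oddProd, cox]
  have : (m.factorial : ℚ) ≠ 0 := by positivity
  rw [mul_div_cancel₀ _ this]
  nth_rewrite 1 [← Finset.card_range m]
  rw [← Finset.prod_const, ← Finset.prod_mul_distrib]
  exact Finset.prod_congr rfl fun i _ => by ring

lemma indexSum_oddProd (N γ w : ℕ) :
    indexSum N (fun m => (-1) ^ m * oddProd N γ m) w =
      PowerSeries.coeff w ((powSeries (cox N) (-(2 * (γ : ℚ) - 1))).subst (vSeries N)) := by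
  rw [coeff_subst_vSeries]
  simp only [neg_one_pow_mul_oddProd]

/-- The falling product from `2α - 1` consists of that factor and the falling product from `2α - 1 -
h = -(2(N-α) - 1)`. At `m = 0` the truncated `m - 1` leaves the factor `2α - 1` in excess, so
equality there needs `α = 1`. -/
lemma mul_neg_one_pow_mul_oddProd {α m : ℕ} (hα : α ≤ N) (h : m ≠ 0 ∨ α = 1) :
    (2 * (α : ℚ) - 1) * ((-1) ^ (m - 1) * oddProd N (N - α) (m - 1)) = m.factorial *
      PowerSeries.coeff m (powSeries (cox N) (2 * (α : ℚ) - 1)) := by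
  rcases m with _ | m
  · obtain rfl : α = 1 := by simpa using h
    simp [oddProd, constantCoeff_powSeries]; norm_num
  · rw [Nat.add_sub_cancel, neg_one_pow_mul_oddProd, powSeries, powSeries, PowerSeries.coeff_mk,
      PowerSeries.coeff_mk, Finset.prod_range_succ']
    have h1 : (m.factorial : ℚ) ≠ 0 := by positivity
    have h2 : ((m + 1).factorial : ℚ) ≠ 0 := by positivity
    rw [mul_div_cancel₀ _ h1, mul_div_cancel₀ _ h2, mul_comm]
    congr 1
    · refine Finset.prod_congr rfl fun i _ => ?_
      rw [cox, Nat.cast_sub hα]; push_cast; ring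
    · simp

lemma mul_indexSum_oddProd {α w : ℕ} (hα : α ≤ N) (h : w ≠ 0 ∨ α = 1) :
    MvPolynomial.C (2 * (α : ℚ) - 1) *
      indexSum N (fun m => (-1) ^ (m - 1) * oddProd N (N - α) (m - 1)) w =
      PowerSeries.coeff w ((powSeries (cox N) (2 * (α : ℚ) - 1)).subst (vSeries N)) := by
  rw [coeff_subst_vSeries, indexSum, Finset.mul_sum, indexSum]
  refine Finset.sum_congr rfl fun a ha => ?_
  rw [← mul_assoc, ← map_mul, mul_neg_one_pow_mul_oddProd hα]
  rcases h with h | h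
  · exact Or.inl (size_pos h ha)
  · exact Or.inr h

lemma cast_two_mul_sub_one {γ : ℕ} (hγ : 1 ≤ γ) : ((2 * γ - 1 : ℕ) : ℚ) = 2 * (γ : ℚ) - 1 := by
  rw [Nat.cast_sub (by omega)]; push_cast; ring

/-! ### Gradients of `psi1` and `psi2` as coefficients of powers of `ζ` -/

lemma psi1_of_ne {γ : ℕ} (h : γ ≠ N) : psi1 N γ =
    indexSum N (fun m => (-1) ^ (m - 1) * oddProd N γ (m - 1)) (N - γ) := by
  rw [psi1, if_neg h, indexSum]

lemma psi1_self : psi1 N N = MvPolynomial.X N := by rw [psi1, if_pos rfl]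

/-- The derivative raises `c_{γ,|a|-1}` to `c_{γ,|a|}`, so a power of `1 + h V` appears: the result
is the coefficient of `p^(1-2k)` in `ζ^(1-2γ)`. Its weight `k - γ` is below `N`, so `v_N` does not
enter. -/
lemma pderiv_psi1 (hN : 4 ≤ N) {k γ : ℕ} (hk : k ∈ Finset.Icc 1 (N - 1))
    (hγ : γ ∈ Finset.Icc 1 (N - 1)) :
    MvPolynomial.pderiv k (psi1 N γ) =
      if γ ≤ k then PowerSeries.coeff (k - γ) (superRootInv N ^ (2 * γ - 1)) else 0 := by
  rw [Finset.mem_Icc] at hγ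
  rw [psi1_of_ne (by omega), pderiv_indexSum hk]
  rw [Finset.mem_Icc] at hk
  by_cases h : γ ≤ k
  · rw [if_pos h, if_pos (by omega), show N - γ - (N - k) = k - γ by omega]
    simp only [Nat.add_sub_cancel]
    rw [indexSum_oddProd, superRootInv_pow hN, coeff_subst_superSeries_of_lt hN _ (by omega),
      cast_two_mul_sub_one hγ.1]
  · rw [if_neg h, if_neg (by omega)]

lemma pderiv_top_psi1 (hN : 4 ≤ N) {γ : ℕ} (hγ : γ ∈ Finset.Icc 1 (N - 1)) :
    MvPolynomial.pderiv N (psi1 N γ) = 0 := by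
  rw [Finset.mem_Icc] at hγ
  rw [psi1_of_ne (by omega), pderiv_indexSum_of_notMem (by simp; omega)]

/-- The flat coordinates are residues: the coefficient of `1/p` in `ζ^(2γ-1)`. -/
lemma mul_psi1 (hN : 4 ≤ N) {γ : ℕ} (hγ : γ ∈ Finset.Icc 1 (N - 1)) :
    MvPolynomial.C (2 * (γ : ℚ) - 1) * psi1 N (N - γ) =
      PowerSeries.coeff γ (superRoot N ^ (2 * γ - 1)) := by
  rw [Finset.mem_Icc] at hγ
  rw [psi1_of_ne (by omega), show N - (N - γ) = γ by omega,
    mul_indexSum_oddProd (by omega) (Or.inl (by omega)), superRoot_pow hN,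
    coeff_subst_superSeries_of_lt hN _ (by omega), cast_two_mul_sub_one hγ.1]

lemma psi2_of_ne {γ : ℕ} (h : γ ≠ N) : psi2 N γ =
    indexSum N (fun m => (-1) ^ (m - 2) * oddProd N γ (m - 2)) (2 * (N - 1) + 1 - γ) +
    indexSum N (fun m => (-1) ^ (m - 1) * oddProd N γ (m - 1)) (N - 1 - γ) *
      (MvPolynomial.C (1 / 2) * MvPolynomial.X N ^ 2) := by
  rw [psi2, if_neg h, indexSum, indexSum]

/-- The coefficient of `p^(1-2k)` in `ζ^(2α-1)`. Since `α + k - 1 < 2N`, it is of first order in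
`v_N² / 2`, and the two sums in `psi2` supply the orders zero and one. -/
lemma mul_pderiv_psi2 (hN : 4 ≤ N) {k α : ℕ} (hk : k ∈ Finset.Icc 1 (N - 1))
    (hα : α ∈ Finset.Icc 1 (N - 1)) :
    MvPolynomial.C (2 * (α : ℚ) - 1) * MvPolynomial.pderiv k (psi2 N (N - α)) =
      PowerSeries.coeff (α + k - 1) (superRoot N ^ (2 * α - 1)) := by
  rw [Finset.mem_Icc] at hα
  have hk' := Finset.mem_Icc.mp hk
  have hX : MvPolynomial.pderiv k (MvPolynomial.C (1 / 2) * MvPolynomial.X N ^ 2 :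
      MvPolynomial ℕ ℚ) = 0 := by
    rw [MvPolynomial.pderiv_C_mul, MvPolynomial.pderiv_pow,
      MvPolynomial.pderiv_X_of_ne (by omega)]; simp
  rw [psi2_of_ne (by omega), map_add, MvPolynomial.pderiv_mul, hX, mul_zero, add_zero,
    pderiv_indexSum hk, pderiv_indexSum hk, if_pos (by omega),
    show 2 * (N - 1) + 1 - (N - α) - (N - k) = α + k - 1 by omega, mul_add]
  simp only [Nat.add_sub_cancel, show ∀ m, m + 1 - 2 = m - 1 by intro m; omega]
  rw [mul_indexSum_oddProd (by omega) (Or.inl (by omega)), superRoot_pow hN,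
    coeff_subst_superSeries hN _ (by omega), cast_two_mul_sub_one hα.1]
  congr 1
  by_cases h : N ≤ α + k - 1
  · rw [if_pos (by omega), if_pos h, indexSum_oddProd, derivative_powSeries,
      PowerSeries.subst_smul (PowerSeries.HasSubst.of_constantCoeff_zero' (constantCoeff_vSeries N)),
      show N - 1 - (N - α) - (N - k) = α + k - 1 - N by omega,
      show -(2 * ((N - α : ℕ) : ℚ) - 1) = 2 * (α : ℚ) - 1 - cox N by
        rw [cox, Nat.cast_sub (by omega)]; ring]
    change _ = _ * PowerSeries.coeff _ (_ • (_ : PowerSeries (MvPolynomial ℕ ℚ)))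
    rw [PowerSeries.coeff_smul, MvPolynomial.smul_eq_C_mul]
    ring
  · rw [if_neg h]
    by_cases h2 : N - k ≤ N - 1 - (N - α)
    · omega
    · rw [if_neg h2]; ring

/-- The right-hand side contains the coefficient of `p` in `ζ^(2α-1)`. For `α = 1` the index `a = 0`
occurs, and the truncated `|a| - 1` gives it the right coefficient. -/
lemma mul_pderiv_top_psi2 (hN : 4 ≤ N) {α : ℕ} (hα : α ∈ Finset.Icc 1 (N - 1)) :
    MvPolynomial.C (2 * (α : ℚ) - 1) * MvPolynomial.pderiv N (psi2 N (N - α)) =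
      MvPolynomial.X N * PowerSeries.coeff (α - 1) (superRoot N ^ (2 * α - 1)) := by
  rw [Finset.mem_Icc] at hα
  have hnm : N ∉ Finset.Icc 1 (N - 1) := by simp; omega
  rw [psi2_of_ne (by omega), map_add, MvPolynomial.pderiv_mul, pderiv_indexSum_of_notMem hnm,
    pderiv_indexSum_of_notMem hnm, MvPolynomial.pderiv_C_mul, MvPolynomial.pderiv_pow,
    MvPolynomial.pderiv_X_self, superRoot_pow hN, coeff_subst_superSeries_of_lt hN _ (by omega),
    cast_two_mul_sub_one hα.1, ← mul_indexSum_oddProd (by omega) (by omega),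
    show N - 1 - (N - α) = α - 1 by omega]
  have : (2 : MvPolynomial ℕ ℚ) * MvPolynomial.C (1 / 2) = 1 := by
    rw [← map_ofNat (MvPolynomial.C (R := ℚ) (σ := ℕ)) 2, ← map_mul]; norm_num
  simp only [Nat.cast_ofNat, Nat.add_one_sub_one, pow_one, mul_one, zero_mul, zero_add]
  linear_combination (MvPolynomial.C (2 * (α : ℚ) - 1) * MvPolynomial.X N *
    indexSum N (fun m => (-1) ^ (m - 1) * oddProd N (N - α) (m - 1)) (α - 1)) * this

end

/-! ### The universal right-hand sides of the hierarchy -/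

section Universal

variable {A : Type*} [CommRing A]

/-- `1 - ∑_{γ ≥ 1} q_γ x ^ (2 γ)`. -/
def evenSeries (q : ℕ → A) : PowerSeries A :=
  PowerSeries.mk fun d => if d = 0 then 1 else if Even d then - q (d / 2) else 0

lemma constantCoeff_evenSeries (q : ℕ → A) : PowerSeries.constantCoeff (evenSeries q) = 1 := by
  rw [← PowerSeries.coeff_zero_eq_constantCoeff_apply, evenSeries, PowerSeries.coeff_mk, if_pos rfl]

lemma coeff_two_mul_evenSeries (q : ℕ → A) {γ : ℕ} (h : γ ≠ 0) :
    PowerSeries.coeff (2 * γ) (evenSeries q) = - q γ := by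
  rw [evenSeries, PowerSeries.coeff_mk, if_neg (by omega), if_pos (even_two_mul γ)]
  simp

lemma coeff_evenSeries_of_odd (q : ℕ → A) {d : ℕ} (h : Odd d) :
    PowerSeries.coeff d (evenSeries q) = 0 := by
  rw [evenSeries, PowerSeries.coeff_mk, if_neg (by rintro rfl; simp at h),
    if_neg (Nat.not_even_iff_odd.mpr h)]

lemma eq_evenSeries {D : PowerSeries A} (h1 : PowerSeries.constantCoeff D = 1)
    (hodd : ∀ d, Odd d → PowerSeries.coeff d D = 0) :
    D = evenSeries fun γ => - PowerSeries.coeff (2 * γ) D := by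
  ext d
  rw [evenSeries, PowerSeries.coeff_mk]
  split_ifs with h0 h
  · rw [h0]; simpa using h1
  · rw [neg_neg, Nat.two_mul_div_two_of_even h]
  · exact hodd d (Nat.not_even_iff_odd.mp h)

lemma map_evenSeries {B : Type*} [CommRing B] (φ : A →+* B) (q : ℕ → A) :
    PowerSeries.map φ (evenSeries q) = evenSeries fun γ => φ (q γ) := by
  ext d
  rw [PowerSeries.coeff_map, evenSeries, evenSeries, PowerSeries.coeff_mk, PowerSeries.coeff_mk]
  split_ifs <;> simp

/-- The polynomial in `q_γ = ∂_1 ∂_γ f` that expresses `∂_α ∂_β f`. -/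
def flowPolyA (α β : ℕ) : MvPolynomial ℕ ℚ :=
  MvPolynomial.C (1 / (2 * (α : ℚ) - 1)) *
    grunsky (evenSeries MvPolynomial.X) (2 * β - 1) (2 * α - 1)

/-- The polynomial in `q_γ = ∂_1 ∂_γ f` that expresses `∂_0 ∂_α f / ∂_0 ∂_1 f`. -/
def flowPolyB (α : ℕ) : MvPolynomial ℕ ℚ :=
  PowerSeries.coeff (2 * α - 2) (PowerSeries.invOfUnit (evenSeries MvPolynomial.X) 1)

lemma evenSeries_mul_inv (q : ℕ → A) :
    evenSeries q * PowerSeries.invOfUnit (evenSeries q) 1 = 1 :=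
  PowerSeries.mul_invOfUnit _ _ (by simp [constantCoeff_evenSeries])

lemma aeval_flowPolyA [Algebra ℚ A] (q : ℕ → A) (α β : ℕ) :
    MvPolynomial.aeval q (flowPolyA α β) = algebraMap ℚ A (1 / (2 * (α : ℚ) - 1)) *
      grunsky (evenSeries q) (2 * β - 1) (2 * α - 1) := by
  have := grunsky_map (MvPolynomial.aeval (R := ℚ) q).toRingHom (evenSeries MvPolynomial.X)
    (2 * β - 1) (2 * α - 1)
  rw [map_evenSeries] at this
  simp only [AlgHom.toRingHom_eq_coe, RingHom.coe_coe, MvPolynomial.aeval_X] at this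
  rw [flowPolyA, map_mul, MvPolynomial.aeval_C, this]

lemma aeval_flowPolyB [Algebra ℚ A] (q : ℕ → A) {Dinv : PowerSeries A}
    (h : evenSeries q * Dinv = 1) (α : ℕ) :
    MvPolynomial.aeval q (flowPolyB α) = PowerSeries.coeff (2 * α - 2) Dinv := by
  have h1 := congrArg (PowerSeries.map (MvPolynomial.aeval (R := ℚ) q).toRingHom)
    (evenSeries_mul_inv (MvPolynomial.X : ℕ → MvPolynomial ℕ ℚ))
  rw [map_mul, map_evenSeries, map_one] at h1
  simp only [AlgHom.toRingHom_eq_coe, RingHom.coe_coe, MvPolynomial.aeval_X] at h1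
  have h2 : Dinv = PowerSeries.map ((MvPolynomial.aeval (R := ℚ) q : _ →ₐ[ℚ] A) :
      MvPolynomial ℕ ℚ →+* A)
      (PowerSeries.invOfUnit (evenSeries MvPolynomial.X) 1) := by
    linear_combination PowerSeries.map ((MvPolynomial.aeval (R := ℚ) q : _ →ₐ[ℚ] A) :
      MvPolynomial ℕ ℚ →+* A) (PowerSeries.invOfUnit (evenSeries MvPolynomial.X) 1) * h - Dinv * h1
  rw [h2, PowerSeries.coeff_map, flowPolyB]
  rfl

lemma two_mul_sub_one_ne_zero (α : ℕ) : 2 * (α : ℚ) - 1 ≠ 0 := by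
  intro h
  have h' : (2 * α : ℚ) = 1 := by linarith
  have : 2 * α = 1 := by exact_mod_cast h'
  omega

/-- The factor `1 / (2α - 1)` turns the weighted symmetry `grunsky_symm` into plain symmetry. -/
lemma flowPolyA_symm {α β : ℕ} (hα : 1 ≤ α) (hβ : 1 ≤ β) : flowPolyA α β = flowPolyA β α := by
  have := grunsky_symm (evenSeries (MvPolynomial.X : ℕ → MvPolynomial ℕ ℚ)) (2 * β - 1) (2 * α - 1)
  rw [← map_natCast (MvPolynomial.C (R := ℚ) (σ := ℕ)),
    ← map_natCast (MvPolynomial.C (R := ℚ) (σ := ℕ)), cast_two_mul_sub_one hα,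
    cast_two_mul_sub_one hβ] at this
  have ha := two_mul_sub_one_ne_zero α
  have hb := two_mul_sub_one_ne_zero β
  have h1 : MvPolynomial.C (1 / (2 * (α : ℚ) - 1)) = MvPolynomial.C (R := ℚ) (σ := ℕ)
      (1 / (2 * (α : ℚ) - 1) / (2 * (β : ℚ) - 1)) * MvPolynomial.C (2 * (β : ℚ) - 1) := by
    rw [← map_mul]; congr 1; field_simp
  have h2 : MvPolynomial.C (1 / (2 * (β : ℚ) - 1)) = MvPolynomial.C (R := ℚ) (σ := ℕ)
      (1 / (2 * (α : ℚ) - 1) / (2 * (β : ℚ) - 1)) * MvPolynomial.C (2 * (α : ℚ) - 1) := by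
    rw [← map_mul]; congr 1; field_simp
  rw [flowPolyA, flowPolyA, h1, h2, mul_assoc, mul_assoc, this]

/-- The polynomials in the variables `X γ`, `1 ≤ γ`, `2 γ ≤ d`. -/
def lowVars (d : ℕ) : Subalgebra ℚ (MvPolynomial ℕ ℚ) :=
  MvPolynomial.supported ℚ {γ | 1 ≤ γ ∧ 2 * γ ≤ d}

lemma lowVars_mono {d d' : ℕ} (h : d ≤ d') : lowVars d ≤ lowVars d' :=
  MvPolynomial.supported_mono fun γ (hγ : 1 ≤ γ ∧ 2 * γ ≤ d) => ⟨hγ.1, by omega⟩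

lemma coeff_evenSeries_mem_lowVars (d : ℕ) :
    PowerSeries.coeff d (evenSeries (MvPolynomial.X : ℕ → MvPolynomial ℕ ℚ)) ∈ lowVars d := by
  rw [evenSeries, PowerSeries.coeff_mk]
  split_ifs with h1 h2
  · exact one_mem _
  · refine neg_mem ?_
    rw [lowVars, MvPolynomial.X_mem_supported, Set.mem_ofPred_eq]
    have := Nat.two_mul_div_two_of_even h2
    omega
  · exact zero_mem _

/-- With `X γ` of weight `2γ`, a Grunsky coefficient has weight equal to the sum of its two indices.
So only `γ ≤ α + β - 1` occurs, which is the origin of the stable range. -/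
lemma flowPolyA_mem {α β : ℕ} (hα : 1 ≤ α) (hβ : 1 ≤ β) :
    flowPolyA α β ∈ lowVars (2 * (α + β) - 2) := by
  have := grunsky_mem (S := fun d => (lowVars d : Set (MvPolynomial ℕ ℚ)))
    (fun d => zero_mem _) (fun d x y hx hy => sub_mem hx hy)
    (fun d d' x y hx hy => mul_mem (lowVars_mono (Nat.le_add_right _ _) hx)
      (lowVars_mono (Nat.le_add_left _ _) hy))
    (evenSeries MvPolynomial.X) (fun d _ => coeff_evenSeries_mem_lowVars d)
    (2 * β - 1) (2 * α - 1)
  rw [flowPolyA]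
  refine mul_mem (Subalgebra.algebraMap_mem _ _) ?_
  rw [show 2 * (α + β) - 2 = 2 * α - 1 + (2 * β - 1) by omega]
  exact this

lemma coeff_inv_evenSeries_mem (n : ℕ) :
    PowerSeries.coeff n (PowerSeries.invOfUnit
      (evenSeries (MvPolynomial.X : ℕ → MvPolynomial ℕ ℚ)) 1) ∈ lowVars n := by
  induction n using Nat.strong_induction_on with
  | _ n ih =>
    rcases n with _ | n
    · simp [one_mem]
    · have := congrArg (PowerSeries.coeff (n + 1))
        (evenSeries_mul_inv (MvPolynomial.X : ℕ → MvPolynomial ℕ ℚ))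
      rw [PowerSeries.coeff_mul, Finset.Nat.antidiagonal_succ, Finset.sum_cons,
        PowerSeries.coeff_zero_eq_constantCoeff_apply, constantCoeff_evenSeries, one_mul,
        PowerSeries.coeff_one, if_neg (by omega)] at this
      rw [eq_neg_of_add_eq_zero_left this]
      refine neg_mem (sum_mem fun i hi => ?_)
      obtain ⟨⟨j, k⟩, hjk, rfl⟩ := Finset.mem_map.mp hi
      rw [mem_antidiagonal] at hjk
      simp only at hjk
      simp only [Function.Embedding.prodMap, Function.Embedding.coeFn_mk, Prod.map]
      refine mul_mem (lowVars_mono ?_ (coeff_evenSeries_mem_lowVars _))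
        (lowVars_mono ?_ (ih _ ?_))
      · simp; omega
      · simp; omega
      · simp; omega

lemma flowPolyB_mem (α : ℕ) : flowPolyB α ∈ lowVars (2 * α - 2) :=
  coeff_inv_evenSeries_mem _

end Universal

/-! ### The second derivatives of the potential -/

section Jacobian

variable {N : ℕ}

lemma sum_odd_eq {A : Type*} [AddCommMonoid A] (k : ℕ) (f : ℕ → A) (hf : ∀ b, Even b → f b = 0) :
    ∑ b ∈ Finset.range (2 * k), f b = ∑ β ∈ Finset.Icc 1 k, f (2 * β - 1) := by
  rw [← Finset.sum_image (g := fun β => 2 * β - 1) (f := f)]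
  · symm
    refine Finset.sum_subset ?_ ?_
    · intro b hb
      obtain ⟨β, hβ, rfl⟩ := Finset.mem_image.mp hb
      rw [Finset.mem_Icc] at hβ
      rw [Finset.mem_range]; omega
    · intro b hb hnot
      rw [Finset.mem_range] at hb
      apply hf
      by_contra hodd
      obtain ⟨c, rfl⟩ := Nat.not_even_iff_odd.mp hodd
      exact hnot (Finset.mem_image.mpr ⟨c + 1, by rw [Finset.mem_Icc]; omega, by omega⟩)
  · intro β hβ β' hβ' h
    simp only [Finset.coe_Icc, Set.mem_Icc] at hβ hβ' h
    omega

lemma coeff_even_subst_pow {A : Type*} [CommRing A] (M : PowerSeries A) (n w : ℕ) :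
    PowerSeries.coeff (2 * w) (M.subst (PowerSeries.X ^ 2 : PowerSeries A) ^ n : PowerSeries A) =
      PowerSeries.coeff w (M ^ n) := by
  rw [← PowerSeries.subst_pow (PowerSeries.HasSubst.X_pow two_ne_zero),
    PowerSeries.coeff_subst_X_pow two_ne_zero, if_pos (dvd_mul_right 2 w)]
  simp

lemma coeff_odd_subst_pow {A : Type*} [CommRing A] (M : PowerSeries A) (n : ℕ) {d : ℕ}
    (hd : Odd d) :
    PowerSeries.coeff d (M.subst (PowerSeries.X ^ 2 : PowerSeries A) ^ n : PowerSeries A) = 0 := by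
  rw [← PowerSeries.subst_pow (PowerSeries.HasSubst.X_pow two_ne_zero),
    PowerSeries.coeff_subst_X_pow two_ne_zero, if_neg]
  rwa [← even_iff_two_dvd, Nat.not_even_iff_odd]

/-- The expansion of `1 / ζ ^ b`-combinations in odd powers of `1 / p`. -/
lemma sum_range_odd {A : Type*} [CommRing A] (Minv : PowerSeries A) (c : ℕ → A) {k : ℕ}
    (hk : 1 ≤ k) :
    ∑ b ∈ Finset.range (2 * k - 1 + 1), c b * PowerSeries.coeff (2 * k - 1 - b)
      (Minv.subst (PowerSeries.X ^ 2 : PowerSeries A) ^ b : PowerSeries A) =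
    ∑ β ∈ Finset.Icc 1 k, c (2 * β - 1) * PowerSeries.coeff (k - β) (Minv ^ (2 * β - 1)) := by
  rw [show 2 * k - 1 + 1 = 2 * k by omega, Finset.sum_range, ← Finset.sum_range (fun b => c b *
    PowerSeries.coeff (2 * k - 1 - b)
      (Minv.subst (PowerSeries.X ^ 2 : PowerSeries A) ^ b : PowerSeries A))]
  rw [Finset.sum_congr rfl (g := fun b => if Even b then 0 else c b *
    PowerSeries.coeff (2 * k - 1 - b)
      (Minv.subst (PowerSeries.X ^ 2 : PowerSeries A) ^ b : PowerSeries A)), sum_odd_eq]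
  · refine Finset.sum_congr rfl fun β hβ => ?_
    rw [Finset.mem_Icc] at hβ
    rw [if_neg, show 2 * k - 1 - (2 * β - 1) = 2 * (k - β) by omega, coeff_even_subst_pow]
    rw [Nat.even_iff]; omega
  · intro b hb; rw [if_pos hb]
  · intro b hb
    rw [Finset.mem_range] at hb
    split_ifs with h
    · rw [coeff_odd_subst_pow, mul_zero]
      rw [Nat.odd_iff]; rw [Nat.even_iff] at h; omega
    · rfl

lemma constantCoeff_superRoot (hN : 4 ≤ N) : PowerSeries.constantCoeff (superRoot N) = 1 := by
  rw [← PowerSeries.coeff_zero_eq_constantCoeff_apply]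
  exact constantCoeff_subst_superSeries hN 1

lemma constantCoeff_superRootInv (hN : 4 ≤ N) :
    PowerSeries.constantCoeff (superRootInv N) = 1 := by
  rw [← PowerSeries.coeff_zero_eq_constantCoeff_apply]
  exact constantCoeff_subst_superSeries hN (-1)

/-- The structure of the gradients of `psi1` and `psi2`: there are `q_γ`, with `q_γ = t_{N-γ}` for
`γ < N`, such that the derivatives of `psi2` in the flat coordinates are the universal
polynomials in the `q_γ`. -/
theorem exists_flat_expansion (hN : 4 ≤ N) : ∃ q : ℕ → MvPolynomial ℕ ℚ,
    (∀ γ ∈ Finset.Icc 1 (N - 1), q γ = psi1 N (N - γ)) ∧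
    (∀ α ∈ Finset.Icc 1 (N - 1), ∀ k ∈ Finset.Icc 1 (N - 1),
      MvPolynomial.pderiv k (psi2 N (N - α)) = ∑ β ∈ Finset.Icc 1 (N - 1),
        MvPolynomial.pderiv k (psi1 N β) * MvPolynomial.aeval q (flowPolyA α β)) ∧
    (∀ k ∈ Finset.Icc 1 (N - 1), ∑ β ∈ Finset.Icc 1 (N - 1),
        MvPolynomial.pderiv k (psi1 N β) * MvPolynomial.aeval q (flowPolyB β) =
      if k = 1 then 1 else 0) ∧
    (∀ α ∈ Finset.Icc 1 (N - 1), MvPolynomial.pderiv N (psi2 N (N - α)) =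
      MvPolynomial.X N * MvPolynomial.aeval q (flowPolyB α)) := by
  obtain ⟨D, Dinv, hodd, hp⟩ := exists_inversePair (superRoot N) (superRootInv N)
    (superRoot_mul_inv hN) (constantCoeff_superRoot hN)
  set q : ℕ → MvPolynomial ℕ ℚ := fun γ => - PowerSeries.coeff (2 * γ) D with hq
  have hDq : D = evenSeries q := eq_evenSeries hp.constD hodd
  have hB : ∀ β, MvPolynomial.aeval q (flowPolyB β) = PowerSeries.coeff (2 * β - 2) Dinv :=
    aeval_flowPolyB q (by rw [← hDq, hp.mul_Dinv])
  have hC : ∀ (α : ℕ) {x y : MvPolynomial ℕ ℚ}, MvPolynomial.C (2 * (α : ℚ) - 1) * x =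
      MvPolynomial.C (2 * (α : ℚ) - 1) * y → x = y := fun α x y h =>
    mul_left_cancel₀ (by rw [Ne, MvPolynomial.C_eq_zero]; exact two_mul_sub_one_ne_zero α) h
  -- a sum against the Jacobian of `psi1` only runs over `β ≤ k`
  have hJ : ∀ k ∈ Finset.Icc 1 (N - 1), ∀ c : ℕ → MvPolynomial ℕ ℚ,
      ∑ β ∈ Finset.Icc 1 (N - 1), MvPolynomial.pderiv k (psi1 N β) * c β =
      ∑ β ∈ Finset.Icc 1 k, c β * PowerSeries.coeff (k - β) (superRootInv N ^ (2 * β - 1)) := by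
    intro k hk c
    have hk' := Finset.mem_Icc.mp hk
    symm
    rw [← Finset.sum_subset (Finset.Icc_subset_Icc_right hk'.2)]
    · refine Finset.sum_congr rfl fun β hβ => ?_
      rw [Finset.mem_Icc] at hβ
      rw [pderiv_psi1 hN hk (Finset.mem_Icc.mpr ⟨hβ.1, by omega⟩), if_pos hβ.2, mul_comm]
    · intro β hβ hnot
      rw [pderiv_psi1 hN hk hβ, if_neg, zero_mul]
      rw [Finset.mem_Icc] at hβ hnot
      omega
  refine ⟨q, fun γ hγ => ?_, fun α hα k hk => ?_, fun k hk => ?_, fun α hα => ?_⟩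
  · apply hC γ
    rw [mul_psi1 hN hγ]
    rw [Finset.mem_Icc] at hγ
    -- The residue of `ζ^(2γ-1)`: only `ζ⁻¹` contributes, with Grunsky coefficient `-(2γ-1) D_{2γ}`.
    -- Hence the `q_γ` are flat coordinates.
    have := hp.coeff_pow_add (2 * γ - 1) 1 one_ne_zero
    rw [show 2 * γ - 1 + 1 = 2 * γ by omega, coeff_even_subst_pow] at this
    rw [this, Finset.sum_range_succ, Finset.sum_range_one, grunsky_zero_left, zero_mul, zero_add,
      grunsky_one_left D hp.constD, show 2 * γ - 1 + 1 = 2 * γ by omega, Nat.sub_self,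
      ← mul_zero 2, coeff_even_subst_pow, PowerSeries.coeff_zero_eq_constantCoeff_apply, pow_one,
      constantCoeff_superRootInv hN, ← map_natCast (MvPolynomial.C (R := ℚ) (σ := ℕ)),
      cast_two_mul_sub_one hγ.1]
    simp only [hq]; ring
  · apply hC α
    rw [mul_pderiv_psi2 hN hk hα, Finset.mul_sum]
    have hk' := Finset.mem_Icc.mp hk
    have hα' := Finset.mem_Icc.mp hα
    -- The coefficient of `p^(1-2k)` in `ζ^(2α-1)`. Even powers of `1/ζ` do not contribute by
    -- parity, and the same coefficient of `ζ^(1-2β)` is the Jacobian entry of `psi1`.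
    have := hp.coeff_pow_add (2 * α - 1) (2 * k - 1) (by omega)
    rw [show 2 * α - 1 + (2 * k - 1) = 2 * (α + k - 1) by omega, coeff_even_subst_pow,
      sum_range_odd _ (fun b => grunsky D b (2 * α - 1)) hk'.1] at this
    rw [this, ← hJ k hk (fun β => grunsky D (2 * β - 1) (2 * α - 1))]
    refine Finset.sum_congr rfl fun β _ => ?_
    rw [aeval_flowPolyA, ← hDq, MvPolynomial.algebraMap_eq, mul_left_comm,
      ← mul_assoc (MvPolynomial.C (2 * (α : ℚ) - 1)), ← map_mul,
      mul_one_div_cancel (two_mul_sub_one_ne_zero α), map_one, one_mul]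
  · have hk' := Finset.mem_Icc.mp hk
    -- Comparison of the coefficients of `p^(1-2k)` in the expansion of `1/p` in powers of `1/ζ`.
    have := congrArg (PowerSeries.coeff (2 * k - 1)) hp.subst_X_mul_Dinv
    rw [coeff_subst_X_mul, sum_range_odd _ (fun b => PowerSeries.coeff b (PowerSeries.X * Dinv))
      hk'.1, ← hJ k hk (fun β => PowerSeries.coeff (2 * β - 1) (PowerSeries.X * Dinv)),
      PowerSeries.coeff_X] at this
    have hk1 : 2 * k - 1 = 1 ↔ k = 1 := by omega
    simp only [hk1] at this
    rw [← this]
    refine Finset.sum_congr rfl fun β hβ => ?_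
    rw [Finset.mem_Icc] at hβ
    rw [hB, show 2 * β - 1 = 2 * β - 2 + 1 by omega, PowerSeries.coeff_succ_X_mul]
  · apply hC α
    have hα' := Finset.mem_Icc.mp hα
    rw [mul_pderiv_top_psi2 hN hα, hB, mul_left_comm]
    congr 1
    -- The coefficient of `p` in `ζ^(2α-1)` is given by Lagrange inversion.
    have := hp.coeff_pow_pred (2 * α - 2)
    rw [show 2 * α - 2 = 2 * (α - 1) by omega, coeff_even_subst_pow,
      show 2 * (α - 1) + 1 = 2 * α - 1 by omega] at this
    rw [this, show 2 * (α - 1) = 2 * α - 2 by omega, ← cast_two_mul_sub_one hα'.1, map_natCast]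
    congr 1
    rw [show 2 * α - 1 = 2 * α - 2 + 1 by omega]
    push_cast; ring

end Jacobian

/-! ### Polynomials with restricted variables -/

section Supported

variable {s : Set ℕ}

lemma mem_supported_of_pderiv {p : MvPolynomial ℕ ℚ}
    (h : ∀ i, i ∉ s → MvPolynomial.pderiv i p = 0) : p ∈ MvPolynomial.supported ℚ s := by
  rw [MvPolynomial.mem_supported]
  intro i hi
  by_contra his
  obtain ⟨a, ha, hia⟩ := (MvPolynomial.mem_vars_iff_mem_support i).mp hi
  have h1 := congrArg (MvPolynomial.coeff (a - Finsupp.single i 1)) (h i his)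
  have hi0 : a i ≠ 0 := by simpa using hia
  have hle : Finsupp.single i 1 ≤ a := by
    rw [Finsupp.single_le_iff]; omega
  rw [MvPolynomial.coeff_pderiv, tsub_add_cancel_of_le hle, MvPolynomial.coeff_zero,
    mul_eq_zero] at h1
  rcases h1 with h1 | h1
  · exact (MvPolynomial.mem_support_iff.mp ha) h1
  · have : (0 : ℚ) < ((a - Finsupp.single i 1 : ℕ →₀ ℕ) i : ℚ) + 1 := by positivity
    exact this.ne' h1

lemma pderiv_eq_zero_of_mem_supported {p : MvPolynomial ℕ ℚ}
    (hp : p ∈ MvPolynomial.supported ℚ s) {i : ℕ} (hi : i ∉ s) : MvPolynomial.pderiv i p = 0 :=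
  MvPolynomial.pderiv_eq_zero_of_notMem_vars fun h => hi (MvPolynomial.mem_supported.mp hp h)

lemma pderiv_comm (i j : ℕ) (p : MvPolynomial ℕ ℚ) :
    MvPolynomial.pderiv i (MvPolynomial.pderiv j p) =
      MvPolynomial.pderiv j (MvPolynomial.pderiv i p) := by
  ext a
  rcases eq_or_ne i j with rfl | h
  · rfl
  · simp only [MvPolynomial.coeff_pderiv, Finsupp.add_apply, Finsupp.single_apply, if_neg h,
      if_neg h.symm, add_zero, add_right_comm a]
    ring

lemma pderiv_mem_supported {p : MvPolynomial ℕ ℚ} (hp : p ∈ MvPolynomial.supported ℚ s) (i : ℕ) :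
    MvPolynomial.pderiv i p ∈ MvPolynomial.supported ℚ s :=
  mem_supported_of_pderiv fun j hj => by
    rw [pderiv_comm, pderiv_eq_zero_of_mem_supported hp hj, map_zero]

lemma aeval_congr_of_mem_supported {A : Type*} [CommRing A] [Algebra ℚ A] {x y : ℕ → A}
    (h : ∀ i ∈ s, x i = y i) {p : MvPolynomial ℕ ℚ} (hp : p ∈ MvPolynomial.supported ℚ s) :
    MvPolynomial.aeval x p = MvPolynomial.aeval y p := by
  have hle : MvPolynomial.supported ℚ s ≤
      AlgHom.equalizer (MvPolynomial.aeval x : MvPolynomial ℕ ℚ →ₐ[ℚ] A)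
        (MvPolynomial.aeval y) := by
    rw [MvPolynomial.supported_eq_adjoin_X]
    refine Algebra.adjoin_le ?_
    rintro _ ⟨i, hi, rfl⟩
    change MvPolynomial.aeval x (MvPolynomial.X i) = MvPolynomial.aeval y (MvPolynomial.X i)
    rw [MvPolynomial.aeval_X, MvPolynomial.aeval_X, h i hi]
  exact hle hp

lemma pderiv_aeval (s : Finset ℕ) (x : ℕ → MvPolynomial ℕ ℚ) (k : ℕ) {p : MvPolynomial ℕ ℚ}
    (hp : p ∈ MvPolynomial.supported ℚ (s : Set ℕ)) :
    MvPolynomial.pderiv k (MvPolynomial.aeval x p) =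
      ∑ i ∈ s, MvPolynomial.pderiv k (x i) *
        MvPolynomial.aeval x (MvPolynomial.pderiv i p) := by
  rw [MvPolynomial.supported_eq_adjoin_X] at hp
  induction hp using Algebra.adjoin_induction with
  | mem p hp =>
    obtain ⟨i, hi, rfl⟩ := hp
    rw [MvPolynomial.aeval_X, Finset.sum_eq_single_of_mem i hi]
    · simp
    · intro j _ hj
      rw [MvPolynomial.pderiv_X_of_ne hj.symm, map_zero, mul_zero]
  | algebraMap r => simp [MvPolynomial.algebraMap_eq]
  | add p q _ _ ihp ihq => simp only [map_add, ihp, ihq, mul_add, Finset.sum_add_distrib]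
  | mul p q _ _ ihp ihq =>
    simp only [map_mul, MvPolynomial.pderiv_mul, map_add, ihp, ihq, mul_add, Finset.sum_add_distrib,
      Finset.sum_mul, Finset.mul_sum]
    congr 1
    · exact Finset.sum_congr rfl fun i _ => by ring
    · exact Finset.sum_congr rfl fun i _ => by ring

/-- A closed polynomial one-form is exact. -/
theorem exists_potential (S : Finset ℕ) (g : ℕ → MvPolynomial ℕ ℚ)
    (hg : ∀ α ∈ S, g α ∈ MvPolynomial.supported ℚ (S : Set ℕ))
    (hclosed : ∀ α ∈ S, ∀ β ∈ S, MvPolynomial.pderiv β (g α) = MvPolynomial.pderiv α (g β)) :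
    ∃ F ∈ MvPolynomial.supported ℚ (S : Set ℕ), ∀ α ∈ S, MvPolynomial.pderiv α F = g α := by
  classical
  -- `L p` is `∫₀¹ p(s x) ds` for polynomials in the variables of `S`: a monomial of degree `d` is
  -- divided by `d + 1`. The potential is then `∑ x_α L(g_α)`, as in the Poincaré lemma.
  set L : MvPolynomial ℕ ℚ → MvPolynomial ℕ ℚ := fun p => ∑ a ∈ p.support,
    MvPolynomial.monomial a (MvPolynomial.coeff a p / (∑ k ∈ S, (a k : ℚ) + 1)) with hL
  have hcoeff : ∀ p a, MvPolynomial.coeff a (L p) =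
      MvPolynomial.coeff a p / (∑ k ∈ S, (a k : ℚ) + 1) := by
    intro p a
    simp only [hL, MvPolynomial.coeff_sum, MvPolynomial.coeff_monomial]
    rw [Finset.sum_ite_eq' p.support a]
    split_ifs with h
    · rfl
    · rw [MvPolynomial.notMem_support_iff.mp h, zero_div]
  have hLmem : ∀ α ∈ S, L (g α) ∈ MvPolynomial.supported ℚ (S : Set ℕ) := by
    intro α hα
    refine mem_supported_of_pderiv fun i hi => ?_
    ext a
    have h0 := congrArg (MvPolynomial.coeff a) (pderiv_eq_zero_of_mem_supported (hg α hα) hi)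
    rw [MvPolynomial.coeff_pderiv, MvPolynomial.coeff_zero] at h0
    rw [MvPolynomial.coeff_pderiv, hcoeff, MvPolynomial.coeff_zero, div_mul_eq_mul_div, h0,
      zero_div]
  refine ⟨∑ α ∈ S, MvPolynomial.X α * L (g α), sum_mem fun α hα =>
    mul_mem (MvPolynomial.X_mem_supported.mpr hα) (hLmem α hα), fun β hβ => ?_⟩
  ext a
  set b := a + Finsupp.single β 1 with hb
  have hbβ : b β = a β + 1 := by simp [hb]
  have hbpos : (0 : ℚ) < ∑ k ∈ S, (b k : ℚ) := by
    refine lt_of_lt_of_le ?_ (Finset.single_le_sum (f := fun k => (b k : ℚ))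
      (fun _ _ => by positivity) hβ)
    simp only [hbβ]
    positivity
  -- By closedness the summand `α` contributes the fraction `b_α / ∑ b_k` of the wanted coefficient,
  -- and these fractions add up to one.
  have hterm : ∀ α ∈ S, MvPolynomial.coeff b (MvPolynomial.X α * L (g α)) * (a β + 1 : ℚ) =
      (b α : ℚ) * (MvPolynomial.coeff a (g β) / ∑ k ∈ S, (b k : ℚ)) := by
    intro α hα
    rw [MvPolynomial.coeff_X_mul']
    split_ifs with hα0
    · have hα1 : b α ≠ 0 := by simpa using hα0
      have hle : Finsupp.single α 1 ≤ b := by rw [Finsupp.single_le_iff]; omega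
      set d := b - Finsupp.single α 1 with hd
      have hbd : b = d + Finsupp.single α 1 := (tsub_add_cancel_of_le hle).symm
      have hsum : ∑ k ∈ S, (b k : ℚ) = ∑ k ∈ S, (d k : ℚ) + 1 := by
        rw [hbd]
        simp [Finset.sum_add_distrib, Finsupp.single_apply, hα]
      have hkey : MvPolynomial.coeff d (g α) * (a β + 1 : ℚ) =
          b α * MvPolynomial.coeff a (g β) := by
        rcases eq_or_ne α β with rfl | hne
        · have : d = a := by rw [hd, hb, add_tsub_cancel_right]
          rw [this, hbβ]; push_cast; ring
        · have hle2 : Finsupp.single α 1 ≤ a := by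
            rw [Finsupp.single_le_iff]
            have : b α = a α := by simp [hb, hne.symm]
            omega
          set c := a - Finsupp.single α 1 with hc
          have hac : a = c + Finsupp.single α 1 := (tsub_add_cancel_of_le hle2).symm
          have hdc : d = c + Finsupp.single β 1 := by
            apply add_right_cancel (b := Finsupp.single α 1)
            rw [← hbd, hb, hac, add_right_comm]
          have := congrArg (MvPolynomial.coeff c) (hclosed α hα β hβ)
          rw [MvPolynomial.coeff_pderiv, MvPolynomial.coeff_pderiv, ← hac, ← hdc] at this
          have h1 : (c β : ℚ) = a β := by rw [hac]; simp [hne]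
          have h2 : (c α : ℚ) + 1 = b α := by rw [hb, hac]; simp [hne.symm]
          rw [h1, h2] at this
          rw [this, mul_comm]
      rw [hcoeff, ← hsum, div_mul_eq_mul_div, hkey, mul_div_assoc]
    · have : b α = 0 := by simpa using hα0
      simp [this]
  rw [MvPolynomial.coeff_pderiv, MvPolynomial.coeff_sum, Finset.sum_mul,
    Finset.sum_congr rfl hterm, ← Finset.sum_mul, mul_div_cancel₀ _ hbpos.ne']

end Supported

/-! ### The flat coordinates as coordinates -/

section Flat

variable {N : ℕ}

/-- The polynomials in the variables with numbers `1, …, N`. -/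
abbrev inVars (N : ℕ) : Subalgebra ℚ (MvPolynomial ℕ ℚ) :=
  MvPolynomial.supported ℚ ((Finset.Icc 1 N : Finset ℕ) : Set ℕ)

/-- Substituting the flat coordinates. -/
abbrev flat (N : ℕ) : MvPolynomial ℕ ℚ →ₐ[ℚ] MvPolynomial ℕ ℚ := MvPolynomial.aeval (psi1 N)

lemma Icc_eq_insert (hN : 4 ≤ N) : Finset.Icc 1 N = insert N (Finset.Icc 1 (N - 1)) := by
  ext i; simp only [Finset.mem_Icc, Finset.mem_insert]; omega

lemma pderiv_flat (hN : 4 ≤ N) {k : ℕ} (hk : k ∈ Finset.Icc 1 (N - 1)) {g : MvPolynomial ℕ ℚ}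
    (hg : g ∈ inVars N) :
    MvPolynomial.pderiv k (flat N g) = ∑ β ∈ Finset.Icc 1 (N - 1),
      MvPolynomial.pderiv k (psi1 N β) * flat N (MvPolynomial.pderiv β g) := by
  rw [pderiv_aeval _ _ k hg, Icc_eq_insert hN, Finset.sum_insert (by simp; omega), psi1_self,
    MvPolynomial.pderiv_X_of_ne, zero_mul, zero_add]
  rw [Finset.mem_Icc] at hk; omega

lemma pderiv_top_flat (hN : 4 ≤ N) {g : MvPolynomial ℕ ℚ} (hg : g ∈ inVars N) :
    MvPolynomial.pderiv N (flat N g) = flat N (MvPolynomial.pderiv N g) := by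
  rw [pderiv_aeval _ _ N hg, Icc_eq_insert hN, Finset.sum_insert (by simp; omega), psi1_self,
    MvPolynomial.pderiv_X_self, one_mul, Finset.sum_eq_zero, add_zero]
  intro β hβ
  rw [pderiv_top_psi1 hN hβ, zero_mul]

lemma pderiv_psi1_self (hN : 4 ≤ N) {k : ℕ} (hk : k ∈ Finset.Icc 1 (N - 1)) :
    MvPolynomial.pderiv k (psi1 N k) = 1 := by
  rw [pderiv_psi1 hN hk hk, if_pos le_rfl, Nat.sub_self, superRootInv_pow hN,
    constantCoeff_subst_superSeries hN]

/-- The Jacobian of the flat coordinates is unitriangular. -/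
lemma eq_of_jacobian_eq (hN : 4 ≤ N) {x y : ℕ → MvPolynomial ℕ ℚ}
    (h : ∀ k ∈ Finset.Icc 1 (N - 1),
      ∑ β ∈ Finset.Icc 1 (N - 1), MvPolynomial.pderiv k (psi1 N β) * x β =
      ∑ β ∈ Finset.Icc 1 (N - 1), MvPolynomial.pderiv k (psi1 N β) * y β) :
    ∀ β ∈ Finset.Icc 1 (N - 1), x β = y β := by
  intro β
  induction β using Nat.strong_induction_on with
  | _ β ih =>
    intro hβ
    have := h β hβ
    rw [← Finset.add_sum_erase _ _ hβ, ← Finset.add_sum_erase _ _ hβ, pderiv_psi1_self hN hβ,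
      one_mul, one_mul] at this
    rw [Finset.sum_congr rfl (g := fun γ => MvPolynomial.pderiv β (psi1 N γ) * y γ)] at this
    · exact add_right_cancel this
    · intro γ hγ
      rw [Finset.mem_erase] at hγ
      rcases Nat.lt_or_ge γ β with hlt | hge
      · rw [ih γ hlt hγ.2]
      · rw [pderiv_psi1 hN hβ hγ.2, if_neg (by omega), zero_mul, zero_mul]

lemma constantCoeff_psi1 {i : ℕ} (hi : i ∈ Finset.Icc 1 N) :
    MvPolynomial.constantCoeff (psi1 N i) = 0 := by
  rw [Finset.mem_Icc] at hi
  rcases eq_or_ne i N with rfl | h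
  · rw [psi1_self, MvPolynomial.constantCoeff_X]
  · rw [psi1_of_ne h, MvPolynomial.constantCoeff_eq, coeff_indexSum, if_neg]
    rw [mem_multiIndices]
    simp; omega

lemma constantCoeff_flat {g : MvPolynomial ℕ ℚ} (hg : g ∈ inVars N) :
    MvPolynomial.constantCoeff (flat N g) = MvPolynomial.constantCoeff g := by
  rw [inVars, MvPolynomial.supported_eq_adjoin_X] at hg
  induction hg using Algebra.adjoin_induction with
  | mem p hp =>
    obtain ⟨i, hi, rfl⟩ := hp
    rw [MvPolynomial.aeval_X, constantCoeff_psi1 hi, MvPolynomial.constantCoeff_X]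
  | algebraMap r => rw [AlgHom.commutes]
  | add p q _ _ ihp ihq => rw [map_add, map_add, map_add, ihp, ihq]
  | mul p q _ _ ihp ihq => rw [map_mul, map_mul, map_mul, ihp, ihq]

/-- The kernel of `flat` on `inVars N` is stable under all partial derivatives because the Jacobian
is unitriangular, and its elements have constant term zero. Hence all their Taylor coefficients
vanish. -/
lemma eq_zero_of_flat_eq_zero (hN : 4 ≤ N) {g : MvPolynomial ℕ ℚ} (hg : g ∈ inVars N)
    (h : flat N g = 0) : g = 0 := by
  suffices H : ∀ (n : ℕ) (a : ℕ →₀ ℕ), a.degree = n → ∀ g ∈ inVars N, flat N g = 0 →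
      MvPolynomial.coeff a g = 0 by
    ext a; exact H _ a rfl g hg h
  intro n
  induction n with
  | zero =>
    intro a ha g hg h
    obtain rfl : a = 0 := (Finsupp.degree_eq_zero_iff a).mp ha
    rw [← MvPolynomial.constantCoeff_eq, ← constantCoeff_flat hg, h, map_zero]
  | succ n ih =>
    intro a ha g hg h
    have ha0 : a ≠ 0 := by rintro rfl; simp at ha
    obtain ⟨i, hi⟩ := Finsupp.ne_iff.mp ha0
    have hle : Finsupp.single i 1 ≤ a := by
      rw [Finsupp.single_le_iff]; simp at hi; omega
    set c := a - Finsupp.single i 1 with hc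
    have hac : a = c + Finsupp.single i 1 := (tsub_add_cancel_of_le hle).symm
    have hcoeff : MvPolynomial.coeff c (MvPolynomial.pderiv i g) = 0 := by
      by_cases hiN : i ∈ Finset.Icc 1 N
      · refine ih c ?_ _ (pderiv_mem_supported hg i) ?_
        · have := congrArg Finsupp.degree hac
          rw [ha, map_add, Finsupp.degree_single] at this
          omega
        · rw [Icc_eq_insert hN, Finset.mem_insert] at hiN
          rcases hiN with rfl | hiN
          · rw [← pderiv_top_flat hN hg, h, map_zero]
          · refine eq_of_jacobian_eq hN (x := fun β => flat N (MvPolynomial.pderiv β g))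
              (y := fun _ => 0) (fun k hk => ?_) i hiN
            rw [← pderiv_flat hN hk hg, h]
            simp
      · rw [pderiv_eq_zero_of_mem_supported hg (by simpa using hiN), MvPolynomial.coeff_zero]
    rw [MvPolynomial.coeff_pderiv, ← hac, mul_eq_zero] at hcoeff
    rcases hcoeff with h0 | h0
    · exact h0
    · have : (0 : ℚ) < (c i : ℚ) + 1 := by positivity
      exact absurd h0 this.ne'

lemma eq_of_flat_eq (hN : 4 ≤ N) {g g' : MvPolynomial ℕ ℚ} (hg : g ∈ inVars N)
    (hg' : g' ∈ inVars N) (h : flat N g = flat N g') : g = g' :=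
  sub_eq_zero.mp (eq_zero_of_flat_eq_zero hN (sub_mem hg hg') (by rw [map_sub, h, sub_self]))

/-- For `k < N`, `psi1 N k - X k` only involves variables `X i` with `k < i < N`, so the coordinates
are recovered from `X N` downwards. -/
lemma X_mem_map_flat (hN : 4 ≤ N) {k : ℕ} (hk : k ∈ Finset.Icc 1 N) :
    MvPolynomial.X k ∈ (inVars N).map (flat N) := by
  obtain ⟨j, hj⟩ : ∃ j, j = N - k := ⟨_, rfl⟩
  induction j using Nat.strong_induction_on generalizing k with
  | _ j ih =>
    have hmem : psi1 N k ∈ (inVars N).map (flat N) :=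
      ⟨MvPolynomial.X k, MvPolynomial.X_mem_supported.mpr hk, MvPolynomial.aeval_X _ _⟩
    rw [Icc_eq_insert hN, Finset.mem_insert] at hk
    rcases hk with rfl | hk
    · rwa [psi1_self] at hmem
    · have hk' := Finset.mem_Icc.mp hk
      have hr : psi1 N k - MvPolynomial.X k ∈
          MvPolynomial.supported ℚ {i | k < i ∧ i ≤ N - 1} := by
        refine mem_supported_of_pderiv fun i hi => ?_
        rw [map_sub]
        rcases eq_or_ne i k with rfl | hik
        · rw [pderiv_psi1_self hN hk, MvPolynomial.pderiv_X_self, sub_self]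
        · rw [MvPolynomial.pderiv_X_of_ne hik.symm, sub_zero]
          by_cases hi2 : i ∈ Finset.Icc 1 (N - 1)
          · rw [pderiv_psi1 hN hi2 hk, if_neg]
            rw [Finset.mem_Icc] at hi2
            simp only [Set.mem_ofPred_eq] at hi
            omega
          · rw [psi1_of_ne (by omega), pderiv_indexSum_of_notMem hi2]
      have hr' : psi1 N k - MvPolynomial.X k ∈ (inVars N).map (flat N) := by
        refine (?_ : MvPolynomial.supported ℚ {i | k < i ∧ i ≤ N - 1} ≤ _) hr
        rw [MvPolynomial.supported_eq_adjoin_X]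
        refine Algebra.adjoin_le ?_
        rintro _ ⟨i, hi, rfl⟩
        simp only [Set.mem_ofPred_eq] at hi
        exact ih (N - i) (by omega) (Finset.mem_Icc.mpr ⟨by omega, by omega⟩) rfl
      have := sub_mem hmem hr'
      rwa [sub_sub_cancel] at this

lemma exists_flat_eq (hN : 4 ≤ N) {p : MvPolynomial ℕ ℚ} (hp : p ∈ inVars N) :
    ∃ g ∈ inVars N, flat N g = p := by
  have hle : inVars N ≤ (inVars N).map (flat N) := by
    conv_lhs => rw [inVars, MvPolynomial.supported_eq_adjoin_X]
    refine Algebra.adjoin_le ?_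
    rintro _ ⟨i, hi, rfl⟩
    exact X_mem_map_flat hN hi
  exact hle hp

lemma psi2_mem_inVars (hN : 4 ≤ N) {α : ℕ} (hα : α ∈ Finset.Icc 1 N) :
    psi2 N (bar N α) ∈ inVars N := by
  rw [Finset.mem_Icc] at hα
  refine mem_supported_of_pderiv fun i hi => ?_
  simp only [Finset.coe_Icc, Set.mem_Icc, not_and, not_le] at hi
  have hiN : N ≠ i := by rintro rfl; omega
  have hi1 : i ∉ Finset.Icc 1 (N - 1) := by rw [Finset.mem_Icc]; omega
  rcases eq_or_ne α N with rfl | h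
  · rw [bar, if_pos rfl, psi2, if_pos rfl, MvPolynomial.pderiv_mul,
      MvPolynomial.pderiv_X_of_ne hiN, MvPolynomial.pderiv_X_of_ne (by rintro rfl; omega)]
    simp
  · rw [bar, if_neg h, psi2_of_ne (by omega), map_add, MvPolynomial.pderiv_mul,
      pderiv_indexSum_of_notMem hi1, pderiv_indexSum_of_notMem hi1, MvPolynomial.pderiv_C_mul,
      MvPolynomial.pderiv_pow, MvPolynomial.pderiv_X_of_ne hiN]
    simp

/-! ### The Hessian and the existence of the potential -/

/-- The second derivatives of a potential in the flat coordinates. -/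
structure FlatHessian (N : ℕ) (q : ℕ → MvPolynomial ℕ ℚ) : Prop where
  q_eq : ∀ γ ∈ Finset.Icc 1 (N - 1), q γ = psi1 N (N - γ)
  hess : ∀ α ∈ Finset.Icc 1 (N - 1), ∀ β ∈ Finset.Icc 1 (N - 1), ∀ g ∈ inVars N,
    flat N g = psi2 N (N - α) →
      flat N (MvPolynomial.pderiv β g) = MvPolynomial.aeval q (flowPolyA α β)
  hess_right : ∀ α ∈ Finset.Icc 1 (N - 1), ∀ g ∈ inVars N, flat N g = psi2 N (N - α) →
      flat N (MvPolynomial.pderiv N g) = MvPolynomial.X N * MvPolynomial.aeval q (flowPolyB α)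
  hess_left : ∀ β ∈ Finset.Icc 1 (N - 1), ∀ g ∈ inVars N, flat N g = psi2 N N →
      flat N (MvPolynomial.pderiv β g) = MvPolynomial.X N * MvPolynomial.aeval q (flowPolyB β)
  third : ∀ β ∈ Finset.Icc 1 (N - 1), ∀ g ∈ inVars N, flat N g = psi2 N N →
      flat N (MvPolynomial.pderiv β (MvPolynomial.pderiv N g)) = MvPolynomial.aeval q (flowPolyB β)

theorem exists_flatHessian (hN : 4 ≤ N) : ∃ q, FlatHessian N q := by
  obtain ⟨q, hq, hA, hB, hT⟩ := exists_flat_expansion hN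
  refine ⟨q, hq, fun α hα β hβ g hg h => ?_, fun α hα g hg h => ?_, fun β hβ g hg h => ?_,
    fun β hβ g hg h => ?_⟩
  · refine eq_of_jacobian_eq hN (x := fun β => flat N (MvPolynomial.pderiv β g))
      (y := fun β => MvPolynomial.aeval q (flowPolyA α β)) (fun k hk => ?_) β hβ
    rw [← pderiv_flat hN hk hg, h, hA α hα k hk]
  · rw [← pderiv_top_flat hN hg, h, hT α hα]
  · refine eq_of_jacobian_eq hN (x := fun β => flat N (MvPolynomial.pderiv β g))
      (y := fun β => MvPolynomial.X N * MvPolynomial.aeval q (flowPolyB β)) (fun k hk => ?_) β hβ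
    simp only [mul_left_comm _ (MvPolynomial.X N)]
    rw [← pderiv_flat hN hk hg, h, ← Finset.mul_sum, hB k hk, psi2, if_pos rfl,
      MvPolynomial.pderiv_mul, MvPolynomial.pderiv_X_of_ne (i := k) (j := N)
        (by rw [Finset.mem_Icc] at hk; omega)]
    rcases eq_or_ne k 1 with rfl | hk1
    · simp
    · rw [MvPolynomial.pderiv_X_of_ne hk1.symm, if_neg hk1]; simp
  · have hg' := pderiv_mem_supported hg N
    refine eq_of_jacobian_eq hN
      (x := fun β => flat N (MvPolynomial.pderiv β (MvPolynomial.pderiv N g)))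
      (y := fun β => MvPolynomial.aeval q (flowPolyB β)) (fun k hk => ?_) β hβ
    rw [← pderiv_flat hN hk hg', ← pderiv_top_flat hN hg, h, hB k hk, psi2, if_pos rfl,
      MvPolynomial.pderiv_mul, MvPolynomial.pderiv_X_self,
      MvPolynomial.pderiv_X_of_ne (i := N) (j := 1) (by omega), zero_mul, zero_add, mul_one]
    rcases eq_or_ne k 1 with rfl | hk1
    · simp
    · rw [MvPolynomial.pderiv_X_of_ne hk1.symm, if_neg hk1]

/-- The potential of the `D_N` Frobenius manifold exists. -/
theorem exists_isDPotential (hN : 4 ≤ N) : ∃ F : MvPolynomial ℕ ℚ, IsDPotential N F := by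
  obtain ⟨q, hq⟩ := exists_flatHessian hN
  have hex : ∀ α, ∃ g, α ∈ Finset.Icc 1 N → g ∈ inVars N ∧ flat N g = psi2 N (bar N α) := by
    intro α
    by_cases hα : α ∈ Finset.Icc 1 N
    · obtain ⟨g, hg, h⟩ := exists_flat_eq hN (psi2_mem_inVars hN hα)
      exact ⟨g, fun _ => ⟨hg, h⟩⟩
    · exact ⟨0, fun h => absurd h hα⟩
  choose g hg using hex
  have hlow : ∀ α ∈ Finset.Icc 1 (N - 1), g α ∈ inVars N ∧ flat N (g α) = psi2 N (N - α) := by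
    intro α hα
    have hα' := Finset.mem_Icc.mp hα
    have := hg α (Finset.mem_Icc.mpr ⟨hα'.1, by omega⟩)
    rwa [bar, if_neg (by omega)] at this
  have htop : g N ∈ inVars N ∧ flat N (g N) = psi2 N N := by
    have := hg N (Finset.mem_Icc.mpr ⟨by omega, le_rfl⟩)
    rwa [bar, if_pos rfl] at this
  -- Closedness may be tested after `flat`, which is injective. For `α, β < N` it is the symmetry of
  -- the Grunsky coefficients; when one index is `N` both sides are `v_N` times the same
  -- `flowPolyB`.
  obtain ⟨F, hF, hFg⟩ := exists_potential (Finset.Icc 1 N) g (fun α hα => (hg α hα).1) (by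
    intro α hα β hβ
    refine eq_of_flat_eq hN (pderiv_mem_supported (hg α hα).1 _)
      (pderiv_mem_supported (hg β hβ).1 _) ?_
    rw [Icc_eq_insert hN, Finset.mem_insert] at hα hβ
    rcases hα with rfl | hα <;> rcases hβ with rfl | hβ
    · rfl
    · rw [hq.hess_left β hβ _ htop.1 htop.2, hq.hess_right β hβ _ (hlow β hβ).1 (hlow β hβ).2]
    · rw [hq.hess_left α hα _ htop.1 htop.2, hq.hess_right α hα _ (hlow α hα).1 (hlow α hα).2]
    · rw [hq.hess α hα β hβ _ (hlow α hα).1 (hlow α hα).2,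
        hq.hess β hβ α hα _ (hlow β hβ).1 (hlow β hβ).2,
        flowPolyA_symm (Finset.mem_Icc.mp hα).1 (Finset.mem_Icc.mp hβ).1])
  refine ⟨F, Finset.coe_subset.mp (MvPolynomial.mem_supported.mp hF), fun α hα => ?_⟩
  rw [hFg α hα]
  exact (hg α hα).2

end Flat

/-! ### Taylor expansion over lists of indices -/

section Taylor

/-- The iterated derivative in the variables listed in `l`. -/
abbrev dList (l : List ℕ) (p : MvPolynomial ℕ ℚ) : MvPolynomial ℕ ℚ :=
  l.foldr (fun i q => MvPolynomial.pderiv i q) p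

lemma dList_add (l : List ℕ) (p q : MvPolynomial ℕ ℚ) :
    dList l (p + q) = dList l p + dList l q := by
  induction l with
  | nil => rfl
  | cons c l ih => simp only [dList, List.foldr_cons] at ih ⊢; rw [ih, map_add]

lemma dList_zero (l : List ℕ) : dList l 0 = 0 := by
  induction l with
  | nil => rfl
  | cons c l ih => simp only [dList, List.foldr_cons] at ih ⊢; rw [ih, map_zero]

lemma dList_sum (l : List ℕ) {ι : Type*} (s : Finset ι) (p : ι → MvPolynomial ℕ ℚ) :
    dList l (∑ i ∈ s, p i) = ∑ i ∈ s, dList l (p i) := by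
  classical
  induction s using Finset.induction_on with
  | empty => simp [dList_zero]
  | insert a s ha ih => rw [Finset.sum_insert ha, Finset.sum_insert ha, dList_add, ih]

lemma dList_mem_supported {s : Set ℕ} (l : List ℕ) {p : MvPolynomial ℕ ℚ}
    (hp : p ∈ MvPolynomial.supported ℚ s) : dList l p ∈ MvPolynomial.supported ℚ s := by
  induction l with
  | nil => exact hp
  | cons c l ih => exact pderiv_mem_supported ih c

lemma dList_eq_zero {s : Set ℕ} {l : List ℕ} {p : MvPolynomial ℕ ℚ}
    (hp : p ∈ MvPolynomial.supported ℚ s) {c : ℕ} (hc : c ∈ l) (hcs : c ∉ s) :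
    dList l p = 0 := by
  induction l with
  | nil => simp at hc
  | cons d l ih =>
    change MvPolynomial.pderiv d (dList l p) = 0
    rcases List.mem_cons.mp hc with rfl | h
    · exact pderiv_eq_zero_of_mem_supported (dList_mem_supported l hp) hcs
    · rw [ih h, map_zero]

lemma derivAtZero_eq_zero {s : Set ℕ} {l : List ℕ} {p : MvPolynomial ℕ ℚ}
    (hp : p ∈ MvPolynomial.supported ℚ s) {c : ℕ} (hc : c ∈ l) (hcs : c ∉ s) :
    derivAtZero l p = 0 := by
  rw [derivAtZero, ← dList, dList_eq_zero hp hc hcs, map_zero]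

lemma eq_C_of_isHomogeneous_zero {p : MvPolynomial ℕ ℚ} (hp : p.IsHomogeneous 0) :
    p = MvPolynomial.C (MvPolynomial.coeff 0 p) := by
  rwa [← MvPolynomial.totalDegree_zero_iff_isHomogeneous,
    MvPolynomial.totalDegree_eq_zero_iff_eq_C] at hp

lemma pderiv_eq_zero_of_isHomogeneous_zero {p : MvPolynomial ℕ ℚ} (hp : p.IsHomogeneous 0) (c : ℕ) :
    MvPolynomial.pderiv c p = 0 := by
  rw [eq_C_of_isHomogeneous_zero hp]
  exact MvPolynomial.pderiv_C

lemma dList_isHomogeneous (l : List ℕ) {p : MvPolynomial ℕ ℚ} {n : ℕ} (hp : p.IsHomogeneous n)  :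
    (dList l p).IsHomogeneous (n - l.length) := by
  induction l with
  | nil => exact hp
  | cons c l ih =>
    rw [List.length_cons, ← Nat.sub_sub]
    exact ih.pderiv

lemma dList_eq_zero_of_lt {l : List ℕ} {p : MvPolynomial ℕ ℚ} {n : ℕ} (hp : p.IsHomogeneous n)
    (h : n < l.length) : dList l p = 0 := by
  induction l with
  | nil => simp at h
  | cons c l ih =>
    change MvPolynomial.pderiv c (dList l p) = 0
    rw [List.length_cons] at h
    have := dList_isHomogeneous l hp
    rw [show n - l.length = 0 by omega] at this
    exact pderiv_eq_zero_of_isHomogeneous_zero this c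

/-- The lists of length `m` with entries in `s`. -/
def listsOn (s : Finset ℕ) : ℕ → Finset (List ℕ)
  | 0 => {[]}
  | m + 1 => (s ×ˢ listsOn s m).image fun x => x.1 :: x.2

lemma mem_listsOn {s : Finset ℕ} {m : ℕ} {l : List ℕ} :
    l ∈ listsOn s m ↔ l.length = m ∧ ∀ c ∈ l, c ∈ s := by
  induction m generalizing l with
  | zero =>
    rw [listsOn, Finset.mem_singleton, List.length_eq_zero_iff]
    constructor
    · rintro rfl; simp
    · exact fun h => h.1
  | succ m ih =>
    rw [listsOn, Finset.mem_image]
    constructor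
    · rintro ⟨⟨c, l'⟩, h, rfl⟩
      rw [Finset.mem_product, ih] at h
      simp only [List.length_cons, List.mem_cons, forall_eq_or_imp]
      exact ⟨by simpa using h.2.1, h.1, h.2.2⟩
    · rintro ⟨hl, hc⟩
      rcases l with _ | ⟨c, l⟩
      · simp at hl
      · refine ⟨(c, l), ?_, rfl⟩
        rw [Finset.mem_product, ih]
        simp only [List.length_cons, List.mem_cons, forall_eq_or_imp] at hl hc
        exact ⟨hc.1, by simpa using hl, hc.2⟩

lemma sum_listsOn_succ {M : Type*} [AddCommMonoid M] (s : Finset ℕ) (m : ℕ) (f : List ℕ → M) :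
    ∑ l ∈ listsOn s (m + 1), f l = ∑ l ∈ listsOn s m, ∑ c ∈ s, f (c :: l) := by
  rw [listsOn, Finset.sum_image, Finset.sum_product_right]
  rintro ⟨c, l⟩ _ ⟨c', l'⟩ _ h
  simpa using h

/-- Euler's identity for homogeneous polynomials. -/
lemma sum_X_mul_pderiv (s : Finset ℕ) {p : MvPolynomial ℕ ℚ} {n : ℕ} (hp : p.IsHomogeneous n)
    (hs : p ∈ MvPolynomial.supported ℚ (s : Set ℕ)) :
    ∑ c ∈ s, MvPolynomial.X c * MvPolynomial.pderiv c p = (n : MvPolynomial ℕ ℚ) * p := by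
  rw [← p.support_sum_monomial_coeff]
  simp only [map_sum, Finset.mul_sum, MvPolynomial.X_mul_pderiv_monomial]
  rw [Finset.sum_comm]
  refine Finset.sum_congr rfl fun a ha => ?_
  rw [← Finset.sum_smul, ← nsmul_eq_mul]
  congr 1
  have h1 : a.degree = n := by
    rw [Finsupp.degree_eq_weight_one]
    exact hp (MvPolynomial.mem_support_iff.mp ha)
  rw [← h1, Finsupp.degree_apply]
  symm
  refine Finset.sum_subset (fun i hi => ?_) fun i _ hi => Finsupp.notMem_support_iff.mp hi
  exact MvPolynomial.mem_supported.mp hs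
    ((MvPolynomial.mem_vars_iff_mem_support i).mpr ⟨a, ha, hi⟩)

/-- Euler's identity iterated: each further derivative acts on a form of degree one less, which
produces the descending factorial. -/
lemma sum_listsOn_mul_dList (s : Finset ℕ) {p : MvPolynomial ℕ ℚ} {n : ℕ} (hp : p.IsHomogeneous n)
    (hs : p ∈ MvPolynomial.supported ℚ (s : Set ℕ)) (m : ℕ) :
    ∑ l ∈ listsOn s m, (l.map MvPolynomial.X).prod * dList l p =
      (n.descFactorial m : MvPolynomial ℕ ℚ) * p := by
  induction m with
  | zero => simp [listsOn]
  | succ m ih =>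
    rw [sum_listsOn_succ, Nat.descFactorial_succ, Nat.cast_mul, mul_assoc, ← ih, Finset.mul_sum]
    refine Finset.sum_congr rfl fun l hl => ?_
    have h1 := sum_X_mul_pderiv s (dList_isHomogeneous l hp) (dList_mem_supported l hs)
    rw [(mem_listsOn.mp hl).1] at h1
    rw [mul_left_comm, ← h1, Finset.mul_sum]
    refine Finset.sum_congr rfl fun c _ => ?_
    rw [List.map_cons, List.prod_cons]
    change MvPolynomial.X c * (l.map MvPolynomial.X).prod * MvPolynomial.pderiv c (dList l p) = _
    ring

variable {A : Type*} [CommRing A] [Algebra ℚ A]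

/-- After `n` derivatives a form of degree `n` is constant. Since the sum is over ordered lists, the
single factor `1 / n!` accounts for all multiplicities. -/
lemma sum_listsOn_derivAtZero (s : Finset ℕ) {p : MvPolynomial ℕ ℚ} {n : ℕ}
    (hp : p.IsHomogeneous n) (hs : p ∈ MvPolynomial.supported ℚ (s : Set ℕ)) (x : ℕ → A) :
    ∑ l ∈ listsOn s n, (derivAtZero l p / l.length.factorial) • (l.map x).prod =
      MvPolynomial.aeval x p := by
  have h := congrArg (MvPolynomial.aeval x) (sum_listsOn_mul_dList s hp hs n)
  rw [Nat.descFactorial_self, map_mul, map_natCast, map_sum] at h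
  have hfac : ((n.factorial : ℚ)⁻¹) * n.factorial = 1 := inv_mul_cancel₀ (by positivity)
  have h2 : MvPolynomial.aeval x p = (n.factorial : ℚ)⁻¹ • ((n.factorial : A) *
      MvPolynomial.aeval x p) := by
    rw [Algebra.smul_def, ← mul_assoc, ← map_natCast (algebraMap ℚ A), ← map_mul, hfac, map_one,
      one_mul]
  rw [h2, ← h, Finset.smul_sum]
  refine Finset.sum_congr rfl fun l hl => ?_
  have hl' := (mem_listsOn.mp hl).1
  have hhom := dList_isHomogeneous l hp
  rw [hl', Nat.sub_self] at hhom
  rw [map_mul, eq_C_of_isHomogeneous_zero hhom, MvPolynomial.aeval_C, map_list_prod,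
    List.map_map, hl', derivAtZero, MvPolynomial.constantCoeff_eq, div_eq_inv_mul, mul_smul,
    Algebra.smul_def (MvPolynomial.coeff _ _), mul_comm]
  simp [Function.comp_def]

lemma homogeneousComponent_mem_supported {s : Set ℕ} {p : MvPolynomial ℕ ℚ}
    (hp : p ∈ MvPolynomial.supported ℚ s) (n : ℕ) :
    MvPolynomial.homogeneousComponent n p ∈ MvPolynomial.supported ℚ s := by
  rw [MvPolynomial.mem_supported] at hp ⊢
  intro i hi
  obtain ⟨a, ha, hia⟩ := (MvPolynomial.mem_vars_iff_mem_support i).mp hi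
  refine hp ((MvPolynomial.mem_vars_iff_mem_support i).mpr ⟨a, ?_, hia⟩)
  rw [MvPolynomial.mem_support_iff, MvPolynomial.coeff_homogeneousComponent] at ha
  rw [MvPolynomial.mem_support_iff]
  intro h; rw [h] at ha; simp at ha

lemma derivAtZero_eq_component (l : List ℕ) (p : MvPolynomial ℕ ℚ) :
    derivAtZero l p = derivAtZero l (MvPolynomial.homogeneousComponent l.length p) := by
  conv_lhs => rw [← MvPolynomial.sum_homogeneousComponent p]
  rw [derivAtZero, ← dList, dList_sum, map_sum]
  have hzero : ∀ i, i ≠ l.length →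
      MvPolynomial.constantCoeff (dList l (MvPolynomial.homogeneousComponent i p)) = 0 := by
    intro i hi
    have hh := MvPolynomial.homogeneousComponent_isHomogeneous i p
    rcases Nat.lt_or_ge i l.length with h | h
    · rw [dList_eq_zero_of_lt hh h, map_zero]
    · rw [MvPolynomial.constantCoeff_eq]
      refine (dList_isHomogeneous l hh).coeff_eq_zero ?_
      rw [map_zero]; omega
  by_cases hl : l.length ∈ Finset.range (p.totalDegree + 1)
  · rw [Finset.sum_eq_single_of_mem _ hl fun i _ hi => hzero i hi]
    rfl
  · rw [Finset.sum_eq_zero fun i hi => hzero i (by rintro rfl; exact hl hi),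
      MvPolynomial.homogeneousComponent_eq_zero _ _ (by simpa using hl), derivAtZero, ← dList,
      dList_zero, map_zero]

/-- The Taylor expansion of a polynomial at the origin, as a sum over lists of indices. -/
theorem finsum_derivAtZero {p : MvPolynomial ℕ ℚ} (h0 : MvPolynomial.constantCoeff p = 0)
    (x : ℕ → A) :
    ∑ᶠ (l : List ℕ) (_ : l ≠ []), (derivAtZero l p / l.length.factorial) • (l.map x).prod =
      MvPolynomial.aeval x p := by
  classical
  have hs := MvPolynomial.mem_supported_vars p
  rw [finsum_eq_sum_of_support_subset (s := (Finset.Icc 1 p.totalDegree).biUnion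
    (listsOn p.vars))]
  · rw [Finset.sum_biUnion]
    · have hm : ∀ m ∈ Finset.Icc 1 p.totalDegree, ∑ l ∈ listsOn p.vars m, ∑ᶠ (_ : l ≠ []),
          (derivAtZero l p / l.length.factorial) • (l.map x).prod =
          MvPolynomial.aeval x (MvPolynomial.homogeneousComponent m p) := by
        intro m hm
        rw [Finset.mem_Icc] at hm
        rw [← sum_listsOn_derivAtZero p.vars
          (MvPolynomial.homogeneousComponent_isHomogeneous m p)
          (homogeneousComponent_mem_supported hs m) x]
        refine Finset.sum_congr rfl fun l hl => ?_
        have hl' := (mem_listsOn.mp hl).1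
        have hne : l ≠ [] := by rintro rfl; simp at hl'; omega
        rw [finsum_eq_if, if_pos hne, derivAtZero_eq_component, hl']
      rw [Finset.sum_congr rfl hm, ← map_sum]
      congr 1
      conv_rhs => rw [← MvPolynomial.sum_homogeneousComponent p]
      rw [Finset.range_eq_Ico, Finset.sum_eq_sum_Ico_succ_bot (by omega),
        MvPolynomial.homogeneousComponent_zero, ← MvPolynomial.constantCoeff_eq, h0, map_zero,
        zero_add]
      rfl
    · intro m _ m' _ hne
      rw [Function.onFun, Finset.disjoint_left]
      intro l hl hl'
      exact hne ((mem_listsOn.mp hl).1.symm.trans (mem_listsOn.mp hl').1)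
  · intro l hl
    rw [Function.mem_support] at hl
    have hne : l ≠ [] := by
      rintro rfl; apply hl; rw [finsum_eq_if, if_neg (by simp)]
    rw [finsum_eq_if, if_pos hne] at hl
    have hd : derivAtZero l p ≠ 0 := by
      intro h; apply hl; rw [h, zero_div, zero_smul]
    have hlen : l.length ≤ p.totalDegree := by
      by_contra h
      apply hd
      rw [derivAtZero_eq_component, MvPolynomial.homogeneousComponent_eq_zero _ _ (by omega),
        derivAtZero, ← dList, dList_zero, map_zero]
    rw [Finset.mem_coe, Finset.mem_biUnion]
    refine ⟨l.length, Finset.mem_Icc.mpr ⟨List.length_pos_iff.mpr hne, hlen⟩,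
      mem_listsOn.mpr ⟨rfl, fun c hc => ?_⟩⟩
    by_contra hcs
    exact hd (derivAtZero_eq_zero hs hc hcs)

end Taylor

/-! ### The coefficients of the hierarchy -/

section Coefficients

variable {N : ℕ}

/-- The involution `c ↦ N - c` of `{1, …, N - 1}`, extended by the identity. -/
def flip (N : ℕ) : Equiv.Perm ℕ :=
  Function.Involutive.toPerm (fun c => if 1 ≤ c ∧ c < N then N - c else c) fun c => by
    by_cases h : 1 ≤ c ∧ c < N
    · simp only [h, and_self, if_true]
      rw [if_pos (by omega)]; omega
    · simp only [h, if_false]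

lemma flip_apply {c : ℕ} (h : 1 ≤ c ∧ c < N) : flip N c = N - c := by
  change (if 1 ≤ c ∧ c < N then N - c else c) = _
  rw [if_pos h]

lemma dList_map_bar {l : List ℕ} (h : ∀ c ∈ l, 1 ≤ c ∧ c < N) (p : MvPolynomial ℕ ℚ) :
    dList (l.map (bar N)) (MvPolynomial.rename (flip N) p) =
      MvPolynomial.rename (flip N) (dList l p) := by
  induction l with
  | nil => rfl
  | cons c l ih =>
    have hc := h c (by simp)
    change MvPolynomial.pderiv (bar N c) (dList (l.map (bar N)) (MvPolynomial.rename (flip N) p)) =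
      MvPolynomial.rename (flip N) (MvPolynomial.pderiv c (dList l p))
    rw [ih fun d hd => h d (List.mem_cons_of_mem _ hd), bar, if_neg (by omega), ← flip_apply hc,
      MvPolynomial.pderiv_rename (flip N).injective]

/-- The convention that out-of-range indices give `0` agrees with the derivatives of `p`, because
`p` contains no such variable. -/
lemma derivAtZero_map_bar {s : Set ℕ} (hs : ∀ c ∈ s, 1 ≤ c ∧ c < N) {p G : MvPolynomial ℕ ℚ}
    (hp : p ∈ MvPolynomial.supported ℚ s) (hG : G = MvPolynomial.rename (flip N) p) (l : List ℕ) :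
    (if ∀ c ∈ l, 1 ≤ c ∧ c < N then
      MvPolynomial.constantCoeff (dList (l.map (bar N)) G) / (l.length.factorial : ℚ) else 0) =
      derivAtZero l p / l.length.factorial := by
  split_ifs with h
  · rw [hG, dList_map_bar h, MvPolynomial.constantCoeff_rename, derivAtZero]
  · push Not at h
    obtain ⟨c, hc, hcN⟩ := h
    rw [derivAtZero_eq_zero hp hc, zero_div]
    intro hcs
    have := hs c hcs
    have := hcN this.1
    omega

/-- On the variables of `p` one has `q_γ = psi1 N (N - γ)`, so `p(q)` is the image of the renamed
polynomial, and `flat` is injective. -/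
lemma eq_rename_flip (hN : 4 ≤ N) {q : ℕ → MvPolynomial ℕ ℚ} (hq : FlatHessian N q) {s : Set ℕ}
    (hs : ∀ c ∈ s, 1 ≤ c ∧ c < N) {p G : MvPolynomial ℕ ℚ}
    (hp : p ∈ MvPolynomial.supported ℚ s) (hG : G ∈ inVars N)
    (h : flat N G = MvPolynomial.aeval q p) : G = MvPolynomial.rename (flip N) p := by
  refine eq_of_flat_eq hN hG ?_ ?_
  · rw [MvPolynomial.mem_supported]
    intro i hi
    obtain ⟨c, hc, rfl⟩ := MvPolynomial.mem_vars_rename _ _ hi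
    have := hs c (MvPolynomial.mem_supported.mp hp hc)
    rw [flip_apply this, Finset.coe_Icc, Set.mem_Icc]
    omega
  · rw [h, MvPolynomial.aeval_rename]
    refine aeval_congr_of_mem_supported (fun c hc => ?_) hp
    have := hs c hc
    rw [Function.comp_apply, flip_apply this, hq.q_eq c (Finset.mem_Icc.mpr ⟨this.1, by omega⟩)]

lemma IsDPotential.mem_inVars {F : MvPolynomial ℕ ℚ} (hF : IsDPotential N F) : F ∈ inVars N :=
  MvPolynomial.mem_supported.mpr (Finset.coe_subset.mpr hF.1)

/-- The bound `α + β ≤ N` keeps all variables of `flowPolyA α β` in the range where `q_γ` is a flat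
coordinate. The resulting value does not mention `N`, which is the stabilization. -/
theorem coeffA_eq (hN : 4 ≤ N) {F : MvPolynomial ℕ ℚ} (hF : IsDPotential N F) {α β : ℕ}
    (hα : 1 ≤ α) (hβ : 1 ≤ β) (hαβ : α + β ≤ N) (l : List ℕ) :
    coeffA N F α β l = derivAtZero l (flowPolyA α β) / l.length.factorial := by
  obtain ⟨q, hq⟩ := exists_flatHessian hN
  have hs : ∀ c ∈ {γ | 1 ≤ γ ∧ 2 * γ ≤ 2 * (α + β) - 2}, 1 ≤ c ∧ c < N := by
    intro c hc
    simp only [Set.mem_ofPred_eq] at hc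
    omega
  have hG := eq_rename_flip hN hq hs (flowPolyA_mem hα hβ)
    (G := MvPolynomial.pderiv α (MvPolynomial.pderiv β F))
    (pderiv_mem_supported (pderiv_mem_supported hF.mem_inVars _) _) (by
      rw [flowPolyA_symm hα hβ]
      refine hq.hess β (Finset.mem_Icc.mpr ⟨hβ, by omega⟩) α (Finset.mem_Icc.mpr ⟨hα, by omega⟩) _
        (pderiv_mem_supported hF.mem_inVars _) ?_
      have := hF.2 β (Finset.mem_Icc.mpr ⟨hβ, by omega⟩)
      rwa [bar, if_neg (by omega)] at this)
  rw [← derivAtZero_map_bar hs (flowPolyA_mem hα hβ) hG l, coeffA, derivAtZero, List.foldr_append]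
  rfl

theorem coeffB_eq (hN : 4 ≤ N) {F : MvPolynomial ℕ ℚ} (hF : IsDPotential N F) {α : ℕ}
    (hα : 1 ≤ α) (hαN : α + 1 ≤ N) (l : List ℕ) :
    coeffB N F α l = derivAtZero l (flowPolyB α) / l.length.factorial := by
  obtain ⟨q, hq⟩ := exists_flatHessian hN
  have hs : ∀ c ∈ {γ | 1 ≤ γ ∧ 2 * γ ≤ 2 * α - 2}, 1 ≤ c ∧ c < N := by
    intro c hc
    simp only [Set.mem_ofPred_eq] at hc
    omega
  have hG := eq_rename_flip hN hq hs (flowPolyB_mem α)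
    (G := MvPolynomial.pderiv α (MvPolynomial.pderiv N (MvPolynomial.pderiv N F)))
    (pderiv_mem_supported (pderiv_mem_supported (pderiv_mem_supported hF.mem_inVars _) _) _) (by
      refine hq.third α (Finset.mem_Icc.mpr ⟨hα, by omega⟩) _
        (pderiv_mem_supported hF.mem_inVars _) ?_
      have := hF.2 N (Finset.mem_Icc.mpr ⟨by omega, le_rfl⟩)
      rwa [bar, if_pos rfl] at this)
  rw [← derivAtZero_map_bar hs (flowPolyB_mem α) hG l, coeffB, derivAtZero, List.foldr_append]
  rfl

variable {P : ℕ → MvPolynomial ℕ ℚ}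

lemma stableA_eq (hP : ∀ N : ℕ, 4 ≤ N → IsDPotential N (P N)) {α β : ℕ} (hα : 1 ≤ α) (hβ : 1 ≤ β)
    (l : List ℕ) : stableA P α β l = derivAtZero l (flowPolyA α β) / l.length.factorial :=
  coeffA_eq (le_max_left _ _) (hP _ (le_max_left _ _)) hα hβ (le_max_right _ _) l

lemma stableB_eq (hP : ∀ N : ℕ, 4 ≤ N → IsDPotential N (P N)) {α : ℕ} (hα : 1 ≤ α)
    (l : List ℕ) : stableB P α l = derivAtZero l (flowPolyB α) / l.length.factorial :=
  coeffB_eq (le_max_left _ _) (hP _ (le_max_left _ _)) hα (le_max_right _ _) l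

end Coefficients

/-! ### Exponentials of series in two variables -/

section Exponential

variable {A : Type*} [CommRing A] [Algebra ℚ A] {σ : Type*}

lemma coeff_subst_exp {W : MvPowerSeries σ A} (hW : MvPowerSeries.constantCoeff W = 0)
    {e : σ →₀ ℕ} {n : ℕ} (hn : Finsupp.degree e < n) :
    MvPowerSeries.coeff e ((PowerSeries.exp ℚ).subst W) =
      ∑ d ∈ Finset.range n, (1 / (d.factorial : ℚ)) • MvPowerSeries.coeff e (W ^ d) := by
  rw [PowerSeries.coeff_subst (PowerSeries.HasSubst.of_constantCoeff_zero hW)]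
  rw [finsum_eq_sum_of_support_subset (s := Finset.range n)]
  · simp
  · intro d hd
    by_contra h
    apply hd
    simp only [Finset.coe_range, Set.mem_Iio, not_lt] at h
    change _ • MvPowerSeries.coeff e (W ^ d) = 0
    rw [MvPowerSeries.coeff_eq_zero_of_constantCoeff_nilpotent (m := 1) (by simpa using hW)
      (by omega), smul_zero]

lemma coeff_subst_exp_eq {W : MvPowerSeries σ A} (hW : MvPowerSeries.constantCoeff W = 0)
    {e : σ →₀ ℕ} {n : ℕ} (hn : Finsupp.degree e < n) :
    MvPowerSeries.coeff e ((PowerSeries.exp ℚ).subst W) =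
      MvPowerSeries.coeff e (∑ d ∈ Finset.range n,
        MvPowerSeries.C (algebraMap ℚ A (1 / (d.factorial : ℚ))) * W ^ d) := by
  rw [coeff_subst_exp hW hn, map_sum]
  refine Finset.sum_congr rfl fun d _ => ?_
  rw [MvPowerSeries.coeff_C_mul, Algebra.smul_def]

/-- Each coefficient only sees a truncated exponential, for which `exp' = exp` is the shift of the
summation index. -/
lemma pderiv_subst_exp {W : MvPowerSeries σ A} (hW : MvPowerSeries.constantCoeff W = 0) (i : σ) :
    MvPowerSeries.pderiv A i ((PowerSeries.exp ℚ).subst W) =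
      (PowerSeries.exp ℚ).subst W * MvPowerSeries.pderiv A i W := by
  classical
  ext e
  set n := Finsupp.degree e + 1 with hn
  have hdeg : Finsupp.degree (e + Finsupp.single i 1) < n + 1 := by
    rw [map_add, Finsupp.degree_single]; omega
  have h2 : MvPowerSeries.coeff e ((PowerSeries.exp ℚ).subst W * MvPowerSeries.pderiv A i W) =
      MvPowerSeries.coeff e ((∑ d ∈ Finset.range n,
        MvPowerSeries.C (algebraMap ℚ A (1 / (d.factorial : ℚ))) * W ^ d) *
        MvPowerSeries.pderiv A i W) := by
    rw [MvPowerSeries.coeff_mul, MvPowerSeries.coeff_mul]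
    refine Finset.sum_congr rfl fun p hp => ?_
    rw [coeff_subst_exp_eq hW]
    rw [mem_antidiagonal] at hp
    rw [hn, ← hp, map_add]
    omega
  rw [MvPowerSeries.coeff_pderiv, coeff_subst_exp_eq hW hdeg, ← MvPowerSeries.coeff_pderiv, h2]
  congr 1
  rw [map_sum, Finset.sum_range_succ', Finset.sum_mul]
  have h0 : MvPowerSeries.pderiv A i
      (MvPowerSeries.C (algebraMap ℚ A (1 / ((0 : ℕ).factorial : ℚ))) * W ^ 0) = 0 := by
    simp
  rw [h0, add_zero]
  refine Finset.sum_congr rfl fun d _ => ?_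
  rw [Derivation.leibniz, MvPowerSeries.pderiv_C, smul_zero, add_zero, smul_eq_mul,
    MvPowerSeries.pderiv_pow, Nat.add_sub_cancel, ← mul_assoc, ← mul_assoc]
  congr 2
  rw [← map_natCast (MvPowerSeries.C (σ := σ) (R := A)), ← map_mul, ← map_natCast (algebraMap ℚ A),
    ← map_mul]
  congr 2
  rw [Nat.factorial_succ]
  push_cast
  field_simp

/-- Here `h` plays the role of `1/2`. The second-order term must be explicit because a factor `z_i`
in the Fay identities lowers the order of the remainder by one. -/
lemma exists_subst_exp_eq {W : MvPowerSeries σ A} (hW : MvPowerSeries.constantCoeff W = 0) :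
    ∃ h g, 2 * h = 1 ∧ (PowerSeries.exp ℚ).subst W = 1 + W + h * W ^ 2 + W ^ 3 * g := by
  have hs := PowerSeries.HasSubst.of_constantCoeff_zero hW
  have h : PowerSeries.exp ℚ = 1 + PowerSeries.X + PowerSeries.C (1 / 2) * PowerSeries.X ^ 2 +
      PowerSeries.X ^ 3 *
        PowerSeries.mk fun n => PowerSeries.coeff (n + 3) (PowerSeries.exp ℚ) := by
    ext n
    rcases n with _ | _ | _ | n
    · simp
    · simp [PowerSeries.coeff_X_pow_mul', PowerSeries.coeff_one, PowerSeries.coeff_X_pow]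
    · simp [PowerSeries.coeff_X_pow_mul', PowerSeries.coeff_one, PowerSeries.coeff_X]
    · simp [PowerSeries.coeff_X_pow_mul', PowerSeries.coeff_one, PowerSeries.coeff_X,
        PowerSeries.coeff_X_pow]
  refine ⟨(PowerSeries.C (1 / 2 : ℚ)).subst W,
    (PowerSeries.mk fun n => PowerSeries.coeff (n + 3) (PowerSeries.exp ℚ)).subst W, ?_, ?_⟩
  · rw [← PowerSeries.coe_substAlgHom hs, ← map_ofNat (PowerSeries.substAlgHom (R := ℚ) hs),
      ← map_mul, ← map_ofNat (PowerSeries.C (R := ℚ)), ← map_mul]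
    norm_num
  · conv_lhs => rw [h]
    simp only [← PowerSeries.coe_substAlgHom hs, map_add, map_mul, map_pow, map_one,
      PowerSeries.substAlgHom_X]

end Exponential

/-! ### The logarithmic form of the first Fay identity -/

section Fay

variable {A : Type*} [CommRing A]

/-- The substitution `x₁ ↦ -x₁`. -/
def negX1 : MvPowerSeries (Fin 2) A →+* MvPowerSeries (Fin 2) A :=
  MvPowerSeries.rescale ![1, -1]

lemma coeff_pt_negX1 (F : MvPowerSeries (Fin 2) A) (n b : ℕ) :
    MvPowerSeries.coeff (pt n b) (negX1 F) = (-1) ^ b * MvPowerSeries.coeff (pt n b) F := by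
  rw [negX1, MvPowerSeries.coeff_rescale, Finsupp.prod_fintype _ _ (by simp), Fin.prod_univ_two]
  simp

lemma negX1_X0_mul_pderiv (F : MvPowerSeries (Fin 2) A) :
    negX1 (MvPowerSeries.X 0 * MvPowerSeries.pderiv A 0 F) =
      MvPowerSeries.X 0 * MvPowerSeries.pderiv A 0 (negX1 F) := by
  refine ext_pt fun n b => ?_
  rw [coeff_pt_negX1, coeff_pt_X0_mul_pderiv, coeff_pt_X0_mul_pderiv, coeff_pt_negX1]
  ring

lemma negX1_X0 : negX1 (MvPowerSeries.X 0 : MvPowerSeries (Fin 2) A) = MvPowerSeries.X 0 := by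
  refine ext_pt fun n b => ?_
  rw [coeff_pt_negX1, ← inX_X, coeff_pt_inX_zero]
  by_cases hb : b = 0 <;> simp [hb]

lemma negX1_X1 : negX1 (MvPowerSeries.X 1 : MvPowerSeries (Fin 2) A) = - MvPowerSeries.X 1 := by
  refine ext_pt fun n b => ?_
  rw [coeff_pt_negX1, ← inX_X, map_neg, coeff_pt_inX_one, PowerSeries.coeff_X]
  by_cases hn : n = 0 <;> by_cases hb : b = 1 <;> simp [hb, hn]

lemma negX1_inX_zero (D : PowerSeries A) : negX1 (inX 0 D) = inX 0 D := by
  refine ext_pt fun n b => ?_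
  rw [coeff_pt_negX1, coeff_pt_inX_zero]
  by_cases hb : b = 0 <;> simp [hb]

lemma negX1_inX_one {D : PowerSeries A} (hD : ∀ d, Odd d → PowerSeries.coeff d D = 0) :
    negX1 (inX 1 D) = inX 1 D := by
  refine ext_pt fun n b => ?_
  rw [coeff_pt_negX1, coeff_pt_inX_one]
  rcases Nat.even_or_odd b with hb | hb
  · rw [hb.neg_one_pow, one_mul]
  · rw [hD b hb]; simp

/-- For even `D` the function `p` is odd, so `z₁ ↦ -z₁` gives `(p(z₀) + p(z₁)) / (z₀ + z₁)`, the
factor on the left of the first Fay identity. -/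
lemma add_mul_negX1_diffQuot {D : PowerSeries A} (hD : PowerSeries.constantCoeff D = 1)
    (hodd : ∀ d, Odd d → PowerSeries.coeff d D = 0) :
    (MvPowerSeries.X 0 + MvPowerSeries.X 1) * negX1 (diffQuot D) =
      MvPowerSeries.X 1 * inX 0 D + MvPowerSeries.X 0 * inX 1 D := by
  have := congrArg negX1 (sub_mul_diffQuot D hD)
  simp only [map_mul, map_sub, negX1_X0, negX1_X1, negX1_inX_zero, negX1_inX_one hodd] at this
  linear_combination -this

lemma negX1_diffQuot_mul_grunskySeries (D : PowerSeries A) :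
    negX1 (diffQuot D) * negX1 (grunskySeries D) =
      MvPowerSeries.X 0 * MvPowerSeries.pderiv A 0 (negX1 (diffQuot D)) := by
  rw [← map_mul, diffQuot_mul_grunskySeries, negX1_X0_mul_pderiv]

variable [Algebra ℚ A]

lemma eq_zero_of_natCast_mul {n : ℕ} (hn : n ≠ 0) {x : A} (h : (n : A) * x = 0) : x = 0 := by
  have : algebraMap ℚ A (n : ℚ)⁻¹ * ((n : A) * x) = x := by
    rw [← mul_assoc, ← map_natCast (algebraMap ℚ A), ← map_mul,
      inv_mul_cancel₀ (by exact_mod_cast hn), map_one, one_mul]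
  rw [← this, h, mul_zero]

/-- Uniqueness for a linear differential equation: `grunskySeries D` has no term of degree zero in
`x₀`, so `n` times the `n`-th coefficient of `Δ` is expressed by lower ones. -/
lemma eq_zero_of_X0_mul_pderiv (D : PowerSeries A) {Δ : MvPowerSeries (Fin 2) A}
    (h : MvPowerSeries.X 0 * MvPowerSeries.pderiv A 0 Δ = grunskySeries D * Δ)
    (h0 : ∀ b, MvPowerSeries.coeff (pt 0 b) Δ = 0) : Δ = 0 := by
  have key : ∀ n b, MvPowerSeries.coeff (pt n b) Δ = 0 := by
    intro n
    induction n using Nat.strong_induction_on with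
    | _ n ih =>
      intro b
      rcases Nat.eq_zero_or_pos n with rfl | hn
      · exact h0 b
      · refine eq_zero_of_natCast_mul hn.ne' ?_
        rw [← coeff_pt_X0_mul_pderiv, h, coeff_pt_mul]
        refine Finset.sum_eq_zero fun i hi => Finset.sum_eq_zero fun j _ => ?_
        rw [mem_antidiagonal] at hi
        rcases Nat.eq_zero_or_pos i.1 with h1 | h1
        · have := grunsky_zero_right D j.1
          rw [grunsky] at this
          rw [h1, this, zero_mul]
        · rw [ih i.2 (by omega), mul_zero]
  exact ext_pt fun n b => by rw [key, map_zero]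

/-- The right-hand side is the logarithmic derivative in `x₀` of the left one. Conversely the
equation is recovered from it because both sides are `1` at `x₀ = 0`. -/
theorem negX1_diffQuot_mul_exp_eq_iff (D : PowerSeries A) {W : MvPowerSeries (Fin 2) A}
    (hW : ∀ b, MvPowerSeries.coeff (pt 0 b) W = 0) :
    negX1 (diffQuot D) * (PowerSeries.exp ℚ).subst W = diffQuot D ↔
      MvPowerSeries.X 0 * MvPowerSeries.pderiv A 0 W =
        grunskySeries D - negX1 (grunskySeries D) := by
  have hW0 : MvPowerSeries.constantCoeff W = 0 := by simpa using hW 0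
  have hR := diffQuot_mul_grunskySeries D
  have hR' := negX1_diffQuot_mul_grunskySeries D
  have hE := pderiv_subst_exp hW0 0
  set E := (PowerSeries.exp ℚ).subst W with hEdef
  constructor
  · intro h
    have hd := congrArg (fun F => MvPowerSeries.X 0 * MvPowerSeries.pderiv A 0 F) h
    simp only [Derivation.leibniz, smul_eq_mul, hE] at hd
    refine eq_of_diffQuot_mul_eq D ?_
    linear_combination hd - hR + E * hR' -
      (MvPowerSeries.X 0 * MvPowerSeries.pderiv A 0 W + negX1 (grunskySeries D)) * h
  · intro h
    refine sub_eq_zero.mp (eq_zero_of_X0_mul_pderiv D ?_ ?_)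
    · simp only [map_sub, Derivation.leibniz, smul_eq_mul, hE]
      linear_combination -hR' * E + hR + negX1 (diffQuot D) * E * h
    · intro b
      have hX : MvPowerSeries.X 0 ∣ W := by
        rw [MvPowerSeries.X_dvd_iff]
        intro e he
        rw [eq_pt e, he, hW]
      have hE0 : ∀ b, MvPowerSeries.coeff (pt 0 b) E = if b = 0 then 1 else 0 := by
        intro b
        rw [hEdef, coeff_subst_exp hW0 (Nat.lt_succ_self _), Finset.sum_range_succ',
          Finset.sum_eq_zero]
        · have : pt 0 b = 0 ↔ b = 0 := by rw [← pt_zero_zero, pt_inj]; simp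
          rw [zero_add, pow_zero, MvPowerSeries.coeff_one]
          simp [this]
        · intro d _
          obtain ⟨W', rfl⟩ := hX
          rw [mul_pow, pow_succ', mul_assoc, coeff_pt_zero_X0_mul, smul_zero]
      rw [map_sub, coeff_pt_mul]
      simp only [Finset.HasAntidiagonal.antidiagonal_zero, Finset.sum_singleton, hE0,
        coeff_pt_negX1, coeff_diffQuot]
      rw [Finset.sum_eq_single (0, b)]
      · by_cases hb : b = 0 <;> simp [hb]
      · rintro ⟨j, k⟩ hj hne
        rw [mem_antidiagonal] at hj
        have : j ≠ 0 := by rintro rfl; exact hne (by simpa using hj)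
        simp [this]
      · intro h; exact absurd (by simp [mem_antidiagonal]) h

/-- Subtracting the image under `x₁ ↦ -x₁` doubles the coefficients with odd `b` and removes the
others; for odd `b` and even `n` parity of `D` gives zero. -/
theorem negX1_diffQuot_mul_exp_eq_iff_coeff {D : PowerSeries A}
    (hodd : ∀ d, Odd d → PowerSeries.coeff d D = 0) {W : MvPowerSeries (Fin 2) A}
    (hW : ∀ n b, ¬ (Odd n ∧ Odd b) → MvPowerSeries.coeff (pt n b) W = 0) :
    negX1 (diffQuot D) * (PowerSeries.exp ℚ).subst W = diffQuot D ↔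
      ∀ n b : ℕ, Odd n → Odd b → (n : A) * MvPowerSeries.coeff (pt n b) W = 2 * grunsky D b n := by
  rw [negX1_diffQuot_mul_exp_eq_iff D fun b => hW 0 b (by simp)]
  have hco : ∀ n b, MvPowerSeries.coeff (pt n b) (grunskySeries D - negX1 (grunskySeries D)) =
      (1 - (-1) ^ b) * grunsky D b n := by
    intro n b
    rw [map_sub, coeff_pt_negX1, grunsky]; ring
  constructor
  · intro h n b hn hb
    rw [← coeff_pt_X0_mul_pderiv, h, hco, hb.neg_one_pow]; ring
  · intro h
    refine ext_pt fun n b => ?_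
    rw [hco, coeff_pt_X0_mul_pderiv]
    rcases Nat.even_or_odd b with hb | hb
    · rw [hb.neg_one_pow, hW n b fun h => Nat.not_even_iff_odd.mpr h.2 hb]; ring
    · rcases Nat.even_or_odd n with hn | hn
      · rw [hW n b fun h => Nat.not_even_iff_odd.mpr h.1 hn,
          grunsky_eq_zero_of_odd D hodd b n (hn.add_odd hb)]; ring
      · rw [h n b hn hb, hb.neg_one_pow]; ring

end Fay

/-! ### Coefficients of the operators of the hierarchy -/

section Operators

lemma pderiv_pderiv_comm {σ R : Type*} [CommRing R] (i j : σ) (F : MvPowerSeries σ R) :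
    MvPowerSeries.pderiv R i (MvPowerSeries.pderiv R j F) =
      MvPowerSeries.pderiv R j (MvPowerSeries.pderiv R i F) := by
  classical
  ext e
  simp only [MvPowerSeries.coeff_pderiv, Finsupp.add_apply, add_right_comm e]
  by_cases h : i = j
  · rw [h]
  · simp only [Finsupp.single_apply, if_neg h, if_neg (Ne.symm h), add_zero]; ring

lemma dT_comm (a b : ℕ) (F : BKPSeries) : dT a (dT b F) = dT b (dT a F) :=
  pderiv_pderiv_comm _ _ _

lemma dT_dTbar_comm (a b : ℕ) (F : BKPSeries) : dT a (dTbar b F) = dTbar b (dT a F) :=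
  pderiv_pderiv_comm _ _ _

lemma dT_zero (a : ℕ) : dT a 0 = 0 := map_zero _

lemma dT_add (a : ℕ) (F G : BKPSeries) : dT a (F + G) = dT a F + dT a G := map_add _ _ _

lemma dT_smul (a : ℕ) (c : ℂ) (F : BKPSeries) : dT a (c • F) = c • dT a F :=
  (MvPowerSeries.pderiv ℂ (Sum.inl a)).map_smul c F

lemma dTbar_zero (a : ℕ) : dTbar a 0 = 0 := map_zero _

lemma dTbar_add (a : ℕ) (F G : BKPSeries) : dTbar a (F + G) = dTbar a F + dTbar a G :=
  map_add _ _ _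

lemma dTbar_smul (a : ℕ) (c : ℂ) (F : BKPSeries) : dTbar a (c • F) = c • dTbar a F :=
  (MvPowerSeries.pderiv ℂ (Sum.inr a)).map_smul c F

lemma dT_two_mul (a : ℕ) (F : BKPSeries) : dT a (2 * F) = 2 * dT a F := by
  rw [two_mul, dT_add, two_mul]

lemma dTbar_two_mul (a : ℕ) (F : BKPSeries) : dTbar a (2 * F) = 2 * dTbar a F := by
  rw [two_mul, dTbar_add, two_mul]

lemma coeff_two_mul (e : Fin 2 →₀ ℕ) (G : ZSeries) :
    MvPowerSeries.coeff e (2 * G) = 2 * MvPowerSeries.coeff e G := by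
  rw [two_mul, map_add, two_mul]

lemma coeff_onCoeffs (d : BKPSeries → BKPSeries) (G : ZSeries) (e : Fin 2 →₀ ℕ) :
    MvPowerSeries.coeff e (onCoeffs d G) = d (MvPowerSeries.coeff e G) := rfl

lemma coeff_const (e : Fin 2 →₀ ℕ) (F : BKPSeries) :
    MvPowerSeries.coeff e (const F) = if e = 0 then F else 0 := by
  classical
  rw [const, MvPowerSeries.coeff_C]

/-- As `G` is free of `x_i`, only the summand with `2 n + 1 = e i` survives, and then `n` is the
truncated quotient `e i / 2`. -/
lemma coeff_oddOp {d : ℕ → BKPSeries → BKPSeries} (hd : ∀ k, d k 0 = 0) {i : Fin 2} {G : ZSeries}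
    (hG : ∀ e, e i ≠ 0 → MvPowerSeries.coeff e G = 0) (e : Fin 2 →₀ ℕ) :
    MvPowerSeries.coeff e (oddOp d i G) =
      if Odd (e i) then
        (1 / (e i : ℂ)) • d (e i / 2) (MvPowerSeries.coeff (e - Finsupp.single i (e i)) G) else 0 := by
  change ∑ n ∈ (Finset.range (e i)).filter (fun n => 2 * n + 1 ≤ e i),
    (1 / (2 * (n : ℂ) + 1)) • d n (MvPowerSeries.coeff (e - Finsupp.single i (2 * n + 1)) G) = _
  have hz : ∀ n ∈ (Finset.range (e i)).filter (fun n => 2 * n + 1 ≤ e i), 2 * n + 1 ≠ e i →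
      (1 / (2 * (n : ℂ) + 1)) •
        d n (MvPowerSeries.coeff (e - Finsupp.single i (2 * n + 1)) G) = 0 := by
    intro n hn hne
    rw [Finset.mem_filter] at hn
    rw [hG, hd, smul_zero]
    simp only [Finsupp.tsub_apply, Finsupp.single_eq_same]
    omega
  split_ifs with h
  · obtain ⟨k, hk⟩ := h
    rw [Finset.sum_eq_single_of_mem k]
    · rw [hk, show (2 * k + 1) / 2 = k by omega]
      push_cast
      rfl
    · rw [Finset.mem_filter, Finset.mem_range]; omega
    · intro n hn hne
      exact hz n hn (by omega)
  · refine Finset.sum_eq_zero fun n hn => hz n hn fun h' => h ?_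
    exact ⟨n, h'.symm⟩

lemma coeff_oddOp_const {d : ℕ → BKPSeries → BKPSeries} (hd : ∀ k, d k 0 = 0) (i : Fin 2)
    (F : BKPSeries) (e : Fin 2 →₀ ℕ) :
    MvPowerSeries.coeff e (oddOp d i (const F)) =
      if Odd (e i) ∧ e = Finsupp.single i (e i) then (1 / (e i : ℂ)) • d (e i / 2) F else 0 := by
  rw [coeff_oddOp hd]
  · have : e - Finsupp.single i (e i) = 0 ↔ e = Finsupp.single i (e i) := by
      rw [tsub_eq_zero_iff_le]
      constructor
      · intro h
        refine le_antisymm h ?_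
        rw [Finsupp.single_le_iff]
      · intro h; exact h.le
    by_cases ho : Odd (e i)
    · rw [if_pos ho, coeff_const]
      by_cases he : e - Finsupp.single i (e i) = 0
      · rw [if_pos he, if_pos ⟨ho, this.mp he⟩]
      · rw [if_neg he, if_neg fun h => he (this.mpr h.2), hd, smul_zero]
    · rw [if_neg ho, if_neg fun h => ho h.1]
  · intro e he
    rw [coeff_const, if_neg]
    rintro rfl
    simp at he

lemma pt_eq_single_zero {n b : ℕ} : pt n b = Finsupp.single 0 n ↔ b = 0 := by
  rw [show Finsupp.single (0 : Fin 2) n = pt n 0 by simp [pt], pt_inj]; simp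

lemma pt_eq_single_one {n b : ℕ} : pt n b = Finsupp.single 1 b ↔ n = 0 := by
  rw [show Finsupp.single (1 : Fin 2) b = pt 0 b by simp [pt], pt_inj]; simp

lemma coeff_pt_oddOp_const_zero {d : ℕ → BKPSeries → BKPSeries} (hd : ∀ k, d k 0 = 0)
    (F : BKPSeries) (n b : ℕ) :
    MvPowerSeries.coeff (pt n b) (oddOp d 0 (const F)) =
      if Odd n ∧ b = 0 then (1 / (n : ℂ)) • d (n / 2) F else 0 := by
  rw [coeff_oddOp_const hd]
  simp only [pt_zero_apply, pt_eq_single_zero]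

lemma coeff_pt_oddOp_const_one {d : ℕ → BKPSeries → BKPSeries} (hd : ∀ k, d k 0 = 0)
    (F : BKPSeries) (n b : ℕ) :
    MvPowerSeries.coeff (pt n b) (oddOp d 1 (const F)) =
      if Odd b ∧ n = 0 then (1 / (b : ℂ)) • d (b / 2) F else 0 := by
  rw [coeff_oddOp_const hd]
  simp only [pt_one_apply, pt_eq_single_one]

lemma coeff_pt_oddOp_oddOp {d d' : ℕ → BKPSeries → BKPSeries} (hd : ∀ k, d k 0 = 0)
    (hd' : ∀ k, d' k 0 = 0) (h2 : ∀ k F, d k (2 * F) = 2 * d k F)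
    (hs : ∀ k (c : ℂ) F, d k (c • F) = c • d k F) (F : BKPSeries) (n b : ℕ) :
    MvPowerSeries.coeff (pt n b) (2 * oddOp d 0 (2 * oddOp d' 1 (const F))) =
      if Odd n ∧ Odd b then (4 / ((n : ℂ) * b)) • d (n / 2) (d' (b / 2) F) else 0 := by
  rw [coeff_two_mul, coeff_oddOp hd]
  · have he : pt n b - Finsupp.single 0 (pt n b 0) = pt 0 b := by
      ext i; fin_cases i <;> simp [pt]
    rw [he, coeff_two_mul, coeff_pt_oddOp_const_one hd']
    simp only [pt_zero_apply, and_true, h2]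
    by_cases hn : Odd n <;> by_cases hb : Odd b <;> simp only [hn, hb, if_true, if_false, and_true,
      and_false, hs, mul_zero, smul_zero, hd]
    rw [← map_ofNat (algebraMap ℂ BKPSeries), ← Algebra.smul_def, ← Algebra.smul_def]
    simp only [smul_smul]
    congr 1
    ring
  · intro e he
    rw [coeff_two_mul, eq_pt e, coeff_pt_oddOp_const_one hd', if_neg fun h => he h.2, mul_zero]

end Operators

/-! ### The first Fay identity -/

section FirstFay

/-- `q_γ = ∂_1 ∂_{2γ-1} 2 F / (2γ - 1)`. -/
def qBKP (F : BKPSeries) (γ : ℕ) : BKPSeries :=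
  (2 / (2 * (γ : ℂ) - 1)) • dT 0 (dT (γ - 1) F)

lemma coeff_evenSeries_qBKP (F : BKPSeries) {n : ℕ} (hn : Odd n) :
    PowerSeries.coeff (n + 1) (evenSeries (qBKP F)) =
      - ((2 / (n : ℂ)) • dT 0 (dT (n / 2) F)) := by
  obtain ⟨k, rfl⟩ := hn
  rw [show 2 * k + 1 + 1 = 2 * (k + 1) by ring, coeff_two_mul_evenSeries _ (by omega), qBKP,
    show (2 * k + 1) / 2 = k by omega, Nat.add_sub_cancel]
  congr 3
  push_cast; ring

lemma dT_two_mul_smul (k : ℕ) (c : ℂ) (G : BKPSeries) :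
    dT k (2 * c • G) = (2 * c) • dT k G := by
  rw [dT_two_mul, dT_smul, ← map_ofNat (algebraMap ℂ BKPSeries), ← Algebra.smul_def, smul_smul]

/-- In other words `evenSeries (qBKP F)` is `p(z) / z` for `p(z) = z - ∂_1 2D(z) F`. -/
lemma X0_mul_onCoeffs_DB (F : BKPSeries) :
    MvPowerSeries.X 0 * onCoeffs (dT 0) (2 * DB 0 (const F)) = 1 - inX 0 (evenSeries (qBKP F)) := by
  refine ext_pt fun n b => ?_
  rw [map_sub, ← map_one (inX 0), coeff_pt_inX_zero, coeff_pt_inX_zero]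
  rcases n with _ | n
  · rw [coeff_pt_zero_X0_mul]
    simp [constantCoeff_evenSeries]
  · rw [coeff_pt_X0_mul, coeff_onCoeffs, coeff_two_mul, DB, coeff_pt_oddOp_const_zero dT_zero,
      PowerSeries.coeff_one, if_neg (Nat.succ_ne_zero n)]
    by_cases hb : b = 0
    · simp only [hb, and_true, if_true]
      rcases Nat.even_or_odd n with hn | hn
      · rw [if_neg (Nat.not_odd_iff_even.mpr hn), coeff_evenSeries_of_odd _ hn.add_one, mul_zero,
          dT_zero, sub_zero]
      · rw [if_pos hn, coeff_evenSeries_qBKP F hn, dT_two_mul_smul, mul_one_div]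
        ring
    · simp [hb, dT_zero]

lemma X1_mul_onCoeffs_DB (F : BKPSeries) :
    MvPowerSeries.X 1 * onCoeffs (dT 0) (2 * DB 1 (const F)) = 1 - inX 1 (evenSeries (qBKP F)) := by
  refine ext_pt fun b n => ?_
  rw [map_sub, ← map_one (inX 1), coeff_pt_inX_one, coeff_pt_inX_one]
  rcases n with _ | n
  · rw [coeff_pt_zero_X1_mul]
    simp [constantCoeff_evenSeries]
  · rw [coeff_pt_X1_mul, coeff_onCoeffs, coeff_two_mul, DB, coeff_pt_oddOp_const_one dT_zero,
      PowerSeries.coeff_one, if_neg (Nat.succ_ne_zero n)]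
    by_cases hb : b = 0
    · simp only [hb, and_true, if_true]
      rcases Nat.even_or_odd n with hn | hn
      · rw [if_neg (Nat.not_odd_iff_even.mpr hn), coeff_evenSeries_of_odd _ hn.add_one, mul_zero,
          dT_zero, sub_zero]
      · rw [if_pos hn, coeff_evenSeries_qBKP F hn, dT_two_mul_smul, mul_one_div]
        ring
    · simp [hb, dT_zero]

lemma onCoeffs_dT_add (k : ℕ) (G H : ZSeries) :
    onCoeffs (dT k) (G + H) = onCoeffs (dT k) G + onCoeffs (dT k) H := by
  ext1 e
  simp only [map_add, coeff_onCoeffs, dT_add]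

lemma onCoeffs_dT_sub (k : ℕ) (G H : ZSeries) :
    onCoeffs (dT k) (G - H) = onCoeffs (dT k) G - onCoeffs (dT k) H := by
  rw [eq_sub_iff_add_eq, ← onCoeffs_dT_add, sub_add_cancel]

lemma incl_injective : Function.Injective incl := IsFractionRing.injective ZSeries ZField

lemma incl_X_ne_zero (i : Fin 2) : incl (MvPowerSeries.X i) ≠ 0 := by
  intro h
  have h1 : (MvPowerSeries.X i : ZSeries) = 0 := incl_injective (by rw [h, incl, map_zero])
  have h2 := congrArg (MvPowerSeries.coeff (Finsupp.single i 1)) h1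
  rw [MvPowerSeries.coeff_index_single_self_X, map_zero] at h2
  exact one_ne_zero h2

lemma coeff_single_X0_add (c : BKPSeries) :
    MvPowerSeries.coeff (pt 1 0) (MvPowerSeries.X 0 + MvPowerSeries.C c * MvPowerSeries.X 1 :
      ZSeries) = 1 := by
  rw [map_add, MvPowerSeries.coeff_C_mul, ← inX_X, ← inX_X, coeff_pt_inX_zero, coeff_pt_inX_one]
  simp

lemma incl_X0_add_X1_ne_zero : incl (MvPowerSeries.X 0) + incl (MvPowerSeries.X 1) ≠ 0 := by
  intro h
  have h1 : (MvPowerSeries.X 0 + MvPowerSeries.C 1 * MvPowerSeries.X 1 : ZSeries) = 0 :=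
    incl_injective (by simpa [incl] using h)
  have h2 := coeff_single_X0_add 1
  rw [h1, map_zero] at h2
  exact one_ne_zero h2.symm

lemma incl_X1_sub_X0_ne_zero : incl (MvPowerSeries.X 1) - incl (MvPowerSeries.X 0) ≠ 0 := by
  intro h
  have h1 : (MvPowerSeries.X 0 + MvPowerSeries.C (-1) * MvPowerSeries.X 1 : ZSeries) = 0 := by
    refine incl_injective ?_
    simp only [incl, map_add, map_mul, map_neg, map_one, map_zero] at h ⊢
    linear_combination -h
  have h2 := coeff_single_X0_add (-1)
  rw [h1, map_zero] at h2
  exact one_ne_zero h2.symm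

lemma one_sub_div_inv_add_inv {K : Type*} [Field K] {x y q q' d d' r : K} (hx : x ≠ 0) (hy : y ≠ 0)
    (hxy : x + y ≠ 0) (h0 : x * q = 1 - d) (h1 : y * q' = 1 - d')
    (h : (x + y) * r = y * d + x * d') : 1 - (q + q') / (x⁻¹ + y⁻¹) = r := by
  rw [inv_add_inv hx hy]
  apply mul_left_cancel₀ hxy
  rw [h]
  field_simp
  linear_combination -y * h0 - x * h1

lemma one_sub_div_inv_sub_inv {K : Type*} [Field K] {x y q q' d d' r : K} (hx : x ≠ 0) (hy : y ≠ 0)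
    (hxy : y - x ≠ 0) (h0 : x * q = 1 - d) (h1 : y * q' = 1 - d')
    (h : (y - x) * r = y * d - x * d') : 1 - (q - q') / (x⁻¹ - y⁻¹) = r := by
  rw [inv_sub_inv hx hy]
  apply mul_left_cancel₀ hxy
  rw [h]
  field_simp
  linear_combination -y * h0 + x * h1

lemma fay1L_eq (F : BKPSeries) :
    fay1L F = incl (negX1 (diffQuot (evenSeries (qBKP F))) *
      fexp (2 * DB 0 (2 * DB 1 (const F)))) := by
  rw [fay1L, onCoeffs_dT_add]
  have h0 := congrArg incl (X0_mul_onCoeffs_DB F)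
  have h1 := congrArg incl (X1_mul_onCoeffs_DB F)
  have h := congrArg incl (add_mul_negX1_diffQuot (constantCoeff_evenSeries (qBKP F))
    fun d hd => coeff_evenSeries_of_odd (qBKP F) hd)
  have hx0 := incl_X_ne_zero 0
  have hx1 := incl_X_ne_zero 1
  have hx := incl_X0_add_X1_ne_zero
  simp only [incl, z, map_mul, map_add, map_sub, map_one] at h h0 h1 hx0 hx1 hx ⊢
  rw [one_sub_div_inv_add_inv hx0 hx1 hx h0 h1 h]

lemma fay1R_eq (F : BKPSeries) : fay1R F = incl (diffQuot (evenSeries (qBKP F))) := by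
  rw [fay1R, onCoeffs_dT_sub]
  have h0 := congrArg incl (X0_mul_onCoeffs_DB F)
  have h1 := congrArg incl (X1_mul_onCoeffs_DB F)
  have h := congrArg incl (sub_mul_diffQuot _ (constantCoeff_evenSeries (qBKP F)))
  have hx0 := incl_X_ne_zero 0
  have hx1 := incl_X_ne_zero 1
  have hx := incl_X1_sub_X0_ne_zero
  simp only [incl, z, map_mul, map_sub, map_one] at h h0 h1 hx0 hx1 hx ⊢
  rw [one_sub_div_inv_sub_inv hx0 hx1 hx h0 h1 h]

lemma algebraMap_rat_mul (r : ℚ) (G : BKPSeries) : algebraMap ℚ BKPSeries r * G = (r : ℂ) • G := by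
  rw [← Algebra.smul_def, Rat.cast_smul_eq_qsmul]

lemma two_mul_add_one_ne_zero (a : ℕ) : 2 * (a : ℂ) + 1 ≠ 0 := by
  exact_mod_cast Nat.succ_ne_zero (2 * a)

theorem fay1_iff (F : BKPSeries) :
    fay1L F = fay1R F ↔ ∀ a b : ℕ,
      (2 / ((2 * (a : ℂ) + 1) * (2 * b + 1))) • dT a (dT b F) =
        MvPolynomial.aeval (qBKP F) (flowPolyA (a + 1) (b + 1)) := by
  rw [fay1L_eq, fay1R_eq, incl_injective.eq_iff, fexp,
    negX1_diffQuot_mul_exp_eq_iff_coeff fun d hd => coeff_evenSeries_of_odd (qBKP F) hd]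
  · have key : ∀ a b : ℕ, (((2 * a + 1 : ℕ) : BKPSeries) *
        MvPowerSeries.coeff (pt (2 * a + 1) (2 * b + 1)) (2 * DB 0 (2 * DB 1 (const F))) =
          2 * grunsky (evenSeries (qBKP F)) (2 * b + 1) (2 * a + 1)) ↔
        (2 / ((2 * (a : ℂ) + 1) * (2 * b + 1))) • dT a (dT b F) =
          MvPolynomial.aeval (qBKP F) (flowPolyA (a + 1) (b + 1)) := by
      intro a b
      have ha := two_mul_add_one_ne_zero a
      have hb := two_mul_add_one_ne_zero b
      rw [DB, DB, coeff_pt_oddOp_oddOp dT_zero dT_zero dT_two_mul dT_smul,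
        if_pos ⟨odd_two_mul_add_one a, odd_two_mul_add_one b⟩, aeval_flowPolyA, algebraMap_rat_mul,
        show (2 * a + 1) / 2 = a by omega, show (2 * b + 1) / 2 = b by omega,
        show 2 * (b + 1) - 1 = 2 * b + 1 by omega, show 2 * (a + 1) - 1 = 2 * a + 1 by omega,
        ← map_natCast (algebraMap ℂ BKPSeries), ← map_ofNat (algebraMap ℂ BKPSeries),
        ← Algebra.smul_def, ← Algebra.smul_def, smul_smul]
      have e1 : ((2 * a + 1 : ℕ) : ℂ) * (4 / (((2 * a + 1 : ℕ) : ℂ) * ((2 * b + 1 : ℕ) : ℂ))) =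
          (2 * (2 * a + 1)) * (2 / ((2 * (a : ℂ) + 1) * (2 * b + 1))) := by
        push_cast
        field_simp
        norm_num
      have e2 : ∀ G : BKPSeries, (OfNat.ofNat 2 : ℂ) • G = (2 * (2 * (a : ℂ) + 1)) •
          ((1 / (2 * ((a + 1 : ℕ) : ℚ) - 1) : ℚ) : ℂ) • G := by
        intro G
        rw [smul_smul]
        congr 1
        have : 2 * ((a : ℂ) + 1) - 1 = 2 * a + 1 := by ring
        push_cast
        rw [this]
        field_simp
      rw [e1, e2, mul_smul (2 * (2 * (a : ℂ) + 1))]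
      exact (smul_right_injective BKPSeries (mul_ne_zero two_ne_zero ha)).eq_iff
    constructor
    · intro h a b
      exact (key a b).mp (h _ _ (odd_two_mul_add_one a) (odd_two_mul_add_one b))
    · rintro h _ _ ⟨a, rfl⟩ ⟨b, rfl⟩
      exact (key a b).mpr (h a b)
  · intro n b h
    rw [DB, DB, coeff_pt_oddOp_oddOp dT_zero dT_zero dT_two_mul dT_smul, if_neg h]

/-- The Grunsky coefficients with one index `1` are the coefficients of `D` up to sign, so these
equations hold identically. This is why the system may be restricted to `α, β ≥ 2`. -/
lemma flowA_one_left (F : BKPSeries) (b : ℕ) :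
    (2 / ((2 * ((0 : ℕ) : ℂ) + 1) * (2 * b + 1))) • dT 0 (dT b F) =
      MvPolynomial.aeval (qBKP F) (flowPolyA (0 + 1) (b + 1)) := by
  rw [aeval_flowPolyA, show 2 * (0 + 1) - 1 = 1 by rfl,
    grunsky_one_right _ (constantCoeff_evenSeries _) _ (by omega),
    show 2 * (b + 1) - 1 + 1 = 2 * (b + 1) by omega, coeff_two_mul_evenSeries _ (by omega), neg_neg,
    algebraMap_rat_mul, qBKP, Nat.add_sub_cancel, smul_smul]
  congr 1
  push_cast
  rw [show 2 * ((b : ℂ) + 1) - 1 = 2 * b + 1 by ring]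
  norm_num

theorem fay1_iff_flowA (F : BKPSeries) :
    fay1L F = fay1R F ↔ ∀ a b : ℕ, 1 ≤ a → 1 ≤ b →
      (2 / ((2 * (a : ℂ) + 1) * (2 * b + 1))) • dT a (dT b F) =
        MvPolynomial.aeval (qBKP F) (flowPolyA (a + 1) (b + 1)) := by
  rw [fay1_iff]
  refine ⟨fun h a b _ _ => h a b, fun h a b => ?_⟩
  rcases Nat.eq_zero_or_pos a with rfl | ha
  · exact flowA_one_left F b
  · rcases Nat.eq_zero_or_pos b with rfl | hb
    · rw [flowPolyA_symm (by omega) (by omega), ← flowA_one_left, dT_comm, mul_comm (_ + _) (_ + _)]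
    · exact h a b ha hb

end FirstFay

/-! ### The reduction of the hierarchy -/

section Reduction

lemma barReduced_iff (F : BKPSeries) : BarReduced F ↔ ∀ n, 1 ≤ n → dTbar n F = 0 := by
  have hL : ∀ n b, MvPowerSeries.coeff (pt n b) (DBbar 0 (const F)) =
      if Odd n ∧ b = 0 then (1 / (n : ℂ)) • dTbar (n / 2) F else 0 :=
    coeff_pt_oddOp_const_zero dTbar_zero F
  have hR : ∀ n b, MvPowerSeries.coeff (pt n b)
      (MvPowerSeries.X 0 * onCoeffs (dTbar 0) (const F)) =
      if n = 1 ∧ b = 0 then dTbar 0 F else 0 := by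
    intro n b
    rcases n with _ | n
    · rw [coeff_pt_zero_X0_mul]; simp
    · have : pt n b = 0 ↔ n = 0 ∧ b = 0 := by rw [← pt_zero_zero, pt_inj]
      rw [coeff_pt_X0_mul, coeff_onCoeffs, coeff_const]
      by_cases hn : n = 0 ∧ b = 0
      · simp [hn]
      · rw [if_neg (by rwa [this]), if_neg (by simpa using hn), dTbar_zero]
  constructor
  · intro h n hn
    have h1 := congrArg (MvPowerSeries.coeff (pt (2 * n + 1) 0)) h
    rw [hL, hR, if_pos ⟨odd_two_mul_add_one n, rfl⟩, if_neg (by omega),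
      show (2 * n + 1) / 2 = n by omega, smul_eq_zero] at h1
    refine h1.resolve_left ?_
    have := two_mul_add_one_ne_zero n
    push_cast
    exact one_div_ne_zero this
  · intro h
    refine ext_pt fun n b => ?_
    rw [hL, hR]
    by_cases hn : n = 1
    · subst hn
      by_cases hb : b = 0 <;> simp [hb]
    · rw [if_neg (c := n = 1 ∧ b = 0) fun h => hn h.1]
      split_ifs with ho
      · obtain ⟨⟨k, hk⟩, _⟩ := ho
        rw [h (n / 2) (by omega), smul_zero]
      · rfl

lemma inX_C (i : Fin 2) (a : BKPSeries) : inX i (PowerSeries.C a) = const a :=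
  (inX (A := BKPSeries) i).commutes a

/-- `D(z₀) ∂̄_1 2 F` is `x₀` times this series in `x₀`. -/
def crossSeries (F : BKPSeries) : PowerSeries BKPSeries :=
  PowerSeries.mk fun n =>
    if Even n then (1 / ((n : ℂ) + 1)) • dT (n / 2) (dTbar 0 (2 * F)) else 0

lemma DB_const_dTbar (F : BKPSeries) :
    DB 0 (const (dTbar 0 (2 * F))) = MvPowerSeries.X 0 * inX 0 (crossSeries F) := by
  refine ext_pt fun n b => ?_
  rw [DB, coeff_pt_oddOp_const_zero dT_zero]
  rcases n with _ | n
  · simp [coeff_pt_zero_X0_mul]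
  · rw [coeff_pt_X0_mul, coeff_pt_inX_zero, crossSeries, PowerSeries.coeff_mk]
    by_cases hb : b = 0
    · simp only [hb, and_true, if_true]
      rcases Nat.even_or_odd n with hn | hn
      · rw [if_pos hn, if_pos hn.add_one]
        obtain ⟨k, rfl⟩ := hn
        rw [show (k + k + 1) / 2 = k by omega, show (k + k) / 2 = k by omega]
        push_cast
        rfl
      · rw [if_neg (Nat.not_even_iff_odd.mpr hn),
          if_neg (Nat.not_odd_iff_even.mpr hn.add_one)]
    · simp [hb]

/-- `∂_1 D(z₀) 2 F` as a series in `x₀`. -/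
def shiftSeries (F : BKPSeries) : PowerSeries BKPSeries :=
  PowerSeries.mk fun n => - PowerSeries.coeff (n + 1) (evenSeries (qBKP F))

lemma X_mul_shiftSeries (F : BKPSeries) :
    PowerSeries.X * shiftSeries F = 1 - evenSeries (qBKP F) := by
  ext n
  rcases n with _ | n
  · simp [constantCoeff_evenSeries]
  · rw [PowerSeries.coeff_succ_X_mul, shiftSeries, PowerSeries.coeff_mk, map_sub,
      PowerSeries.coeff_one, if_neg (Nat.succ_ne_zero n), zero_sub]

lemma X_ne_zero (i : Fin 2) : (MvPowerSeries.X i : ZSeries) ≠ 0 := by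
  intro h
  apply incl_X_ne_zero i
  rw [h, incl, map_zero]

lemma onCoeffs_DB (F : BKPSeries) :
    onCoeffs (dT 0) (2 * DB 0 (const F)) = inX 0 (shiftSeries F) := by
  refine mul_left_cancel₀ (X_ne_zero 0) ?_
  rw [X0_mul_onCoeffs_DB, ← inX_X, ← map_mul, X_mul_shiftSeries, map_sub, map_one]

lemma DB_const_two_mul (F : BKPSeries) : DB 0 (const (2 * F)) = 2 * DB 0 (const F) := by
  refine ext_pt fun n b => ?_
  rw [coeff_two_mul, DB, DB, coeff_pt_oddOp_const_zero dT_zero, coeff_pt_oddOp_const_zero dT_zero]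
  split_ifs with h
  · rw [dT_two_mul, mul_smul_comm]
  · rw [mul_zero]

/-- `∂_1 ∂̄_1 2 F`. -/
def mixedSecond (F : BKPSeries) : BKPSeries := dTbar 0 (dT 0 (2 * F))

/-- A geometric series with sum `a x₀ / (1 - x₀ y)`; the tail after `e 0` terms is divisible by
`x₀^(e 0 + 1)` and is invisible in the coefficient at `e`. -/
lemma coeff_geom_sum (a : BKPSeries) {y t : ZSeries} (h : (1 - MvPowerSeries.X 0 * y) * t = 1)
    (e : Fin 2 →₀ ℕ) :
    ∑ m ∈ Finset.Icc 1 (e 0), MvPowerSeries.coeff e (const a * MvPowerSeries.X 0 ^ m * y ^ (m - 1)) =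
      MvPowerSeries.coeff e (const a * (MvPowerSeries.X 0 * t)) := by
  have hsum : ∀ n, ∑ m ∈ Finset.Icc 1 n, const a * MvPowerSeries.X 0 ^ m * y ^ (m - 1) =
      const a * (MvPowerSeries.X 0 * t) -
        MvPowerSeries.X 0 ^ (n + 1) * (const a * y ^ n * t) := by
    intro n
    induction n with
    | zero => simp; ring
    | succ n ih =>
      rw [Finset.sum_Icc_succ_top (by omega), ih,
        Nat.add_sub_cancel]
      linear_combination (- const a * MvPowerSeries.X 0 ^ (n + 1) * y ^ n) * h
  rw [← map_sum, hsum, map_sub, sub_eq_self, MvPowerSeries.X_pow_dvd_iff.mp (dvd_mul_right _ _) _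
    (Nat.lt_succ_self _)]

/-- The denominator `1 - x₀ ∂_1 D(z₀) 2F` of the geometric series is `evenSeries (qBKP F)`. -/
lemma reducedFay3_iff_mul_crossSeries (F : BKPSeries) :
    ReducedFay3 F ↔
      evenSeries (qBKP F) * crossSeries F = PowerSeries.C (mixedSecond F) := by
  set D := evenSeries (qBKP F) with hD
  set Dinv := PowerSeries.invOfUnit D 1
  have hinv : D * Dinv = 1 := evenSeries_mul_inv _
  have hinX : Function.Injective (inX (A := BKPSeries) 0) := by
    intro f g h
    ext1 n
    have := congrArg (MvPowerSeries.coeff (pt n 0)) h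
    simpa [coeff_pt_inX_zero] using this
  have h1 : (1 - MvPowerSeries.X 0 * onCoeffs (dT 0) (DB 0 (const (2 * F)))) * inX 0 Dinv = 1 := by
    rw [DB_const_two_mul, X0_mul_onCoeffs_DB, sub_sub_cancel, ← map_mul, hinv, map_one]
  have h2 : ReducedFay3 F ↔ crossSeries F = PowerSeries.C (mixedSecond F) * Dinv := by
    rw [← hinX.eq_iff, map_mul, inX_C, ← (mul_right_injective₀ (X_ne_zero 0)).eq_iff,
      ← DB_const_dTbar, MvPowerSeries.ext_iff, mul_left_comm]
    refine forall_congr' fun e => ?_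
    rw [coeff_geom_sum _ h1]
    rfl
  rw [h2]
  constructor
  · intro h
    rw [h, mul_left_comm, hinv, mul_one]
  · intro h
    linear_combination Dinv * h - crossSeries F * hinv

lemma coeff_inv_of_odd {A : Type*} [CommRing A] [Algebra ℚ A] {D Dinv : PowerSeries A}
    (h : D * Dinv = 1) (hodd : ∀ d, Odd d → PowerSeries.coeff d D = 0) {n : ℕ} (hn : Odd n) :
    PowerSeries.coeff n Dinv = 0 := by
  have hD : PowerSeries.rescale (-1) D = D := by
    ext d
    rw [PowerSeries.coeff_rescale]
    rcases Nat.even_or_odd d with hd | hd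
    · rw [hd.neg_one_pow, one_mul]
    · rw [hodd d hd, mul_zero]
  have h' := congrArg (PowerSeries.rescale (-1)) h
  rw [map_mul, hD, map_one] at h'
  have heq : PowerSeries.rescale (-1) Dinv = Dinv := by
    linear_combination Dinv * h' - PowerSeries.rescale (-1) Dinv * h
  have hc := congrArg (PowerSeries.coeff n) heq
  rw [PowerSeries.coeff_rescale, hn.neg_one_pow] at hc
  refine eq_zero_of_natCast_mul two_ne_zero ?_
  push_cast
  linear_combination -hc

theorem reducedFay3_iff_flowB (F : BKPSeries) :
    ReducedFay3 F ↔ ∀ a : ℕ, 1 ≤ a →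
      (1 / (2 * (a : ℂ) + 1)) • dT a (dTbar 0 (2 * F)) =
        mixedSecond F * MvPolynomial.aeval (qBKP F) (flowPolyB (a + 1)) := by
  have hinv := evenSeries_mul_inv (qBKP F)
  set Dinv := PowerSeries.invOfUnit (evenSeries (qBKP F)) 1
  have h1 : ReducedFay3 F ↔ crossSeries F = PowerSeries.C (mixedSecond F) * Dinv := by
    rw [reducedFay3_iff_mul_crossSeries]
    constructor
    · intro h
      linear_combination Dinv * h - crossSeries F * hinv
    · intro h
      rw [h, mul_left_comm, hinv, mul_one]
  have hcross : ∀ a : ℕ, PowerSeries.coeff (2 * a) (crossSeries F) =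
      (1 / (2 * (a : ℂ) + 1)) • dT a (dTbar 0 (2 * F)) := by
    intro a
    rw [crossSeries, PowerSeries.coeff_mk, if_pos (even_two_mul a), show 2 * a / 2 = a by omega]
    push_cast
    rfl
  have hB : ∀ a : ℕ, MvPolynomial.aeval (qBKP F) (flowPolyB (a + 1)) =
      PowerSeries.coeff (2 * a) Dinv := by
    intro a
    rw [aeval_flowPolyB (qBKP F) hinv, show 2 * (a + 1) - 2 = 2 * a by omega]
  rw [h1]
  constructor
  · intro h a _
    rw [← hcross, h, PowerSeries.coeff_C_mul, hB]
  · intro h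
    ext1 n
    rcases Nat.even_or_odd n with ⟨a, ha⟩ | hn
    · rw [show n = 2 * a by omega, PowerSeries.coeff_C_mul, hcross, ← hB]
      -- The equation for `a = 0` only says that `∂_1` and `∂̄_1` commute.
      rcases Nat.eq_zero_or_pos a with rfl | ha
      · rw [hB]
        simp [Dinv, mixedSecond, dT_dTbar_comm]
      · exact h a ha
    · rw [PowerSeries.coeff_C_mul, coeff_inv_of_odd hinv
        (fun d hd => coeff_evenSeries_of_odd _ hd) hn, mul_zero, crossSeries, PowerSeries.coeff_mk,
        if_neg (Nat.not_even_iff_odd.mpr hn)]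

end Reduction

/-! ### The second, third and fourth Fay identities under the reduction -/

section ReducedIdentities

variable {F : BKPSeries}

lemma pt_eq_zero {n b : ℕ} : pt n b = 0 ↔ n = 0 ∧ b = 0 := by
  rw [← pt_zero_zero, pt_inj]

lemma coeff_pt_X0_mul_const (G : BKPSeries) (n b : ℕ) :
    MvPowerSeries.coeff (pt n b) (MvPowerSeries.X 0 * const G) =
      if n = 1 ∧ b = 0 then G else 0 := by
  rcases n with _ | n
  · rw [coeff_pt_zero_X0_mul]; simp
  · rw [coeff_pt_X0_mul, coeff_const]
    simp [pt_eq_zero]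

lemma coeff_pt_X1_mul_const (G : BKPSeries) (n b : ℕ) :
    MvPowerSeries.coeff (pt n b) (MvPowerSeries.X 1 * const G) =
      if b = 1 ∧ n = 0 then G else 0 := by
  rcases b with _ | b
  · rw [coeff_pt_zero_X1_mul]; simp
  · rw [coeff_pt_X1_mul, coeff_const]
    simp [pt_eq_zero, and_comm]

lemma DBbar_zero_const (hF : BarReduced F) :
    DBbar 0 (const F) = MvPowerSeries.X 0 * const (dTbar 0 F) := by
  rw [hF]
  congr 1
  ext1 e
  rw [coeff_onCoeffs, coeff_const, coeff_const]
  split_ifs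
  · rfl
  · exact dTbar_zero 0

lemma DBbar_one_const (hF : BarReduced F) :
    DBbar 1 (const F) = MvPowerSeries.X 1 * const (dTbar 0 F) := by
  refine ext_pt fun n b => ?_
  have h := congrArg (MvPowerSeries.coeff (pt b n)) (DBbar_zero_const hF)
  rw [DBbar, coeff_pt_oddOp_const_zero dTbar_zero, coeff_pt_X0_mul_const] at h
  rw [DBbar, coeff_pt_oddOp_const_one dTbar_zero, h, coeff_pt_X1_mul_const]

lemma two_mul_oddOp_DBbar (hF : BarReduced F) {d : ℕ → BKPSeries → BKPSeries} (hd : ∀ k, d k 0 = 0)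
    (h2 : ∀ k F, d k (2 * F) = 2 * d k F) (hs : ∀ k (c : ℂ) F, d k (c • F) = c • d k F) :
    2 * oddOp d 0 (2 * DBbar 1 (const F)) =
      MvPowerSeries.X 1 * (2 * oddOp d 0 (const (dTbar 0 (2 * F)))) := by
  refine ext_pt fun n b => ?_
  rw [DBbar, coeff_pt_oddOp_oddOp hd dTbar_zero h2 hs]
  rcases b with _ | b
  · rw [coeff_pt_zero_X1_mul]; simp
  · rw [coeff_pt_X1_mul, coeff_two_mul, coeff_pt_oddOp_const_zero hd]
    by_cases hb : b = 0
    · subst hb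
      simp only [zero_add, odd_one, and_true]
      split_ifs with hn
      · rw [show 1 / 2 = 0 by rfl, dTbar_two_mul, h2, mul_smul_comm, ← mul_assoc,
          ← map_ofNat (algebraMap ℂ BKPSeries), ← map_mul, ← Algebra.smul_def, smul_smul]
        congr 1
        push_cast
        ring
      · rw [mul_zero]
    · rw [if_neg (c := Odd n ∧ b = 0) fun h => hb h.2, mul_zero]
      split_ifs with h
      · rw [(barReduced_iff F).mp hF _ (by obtain ⟨_, k, hk⟩ := h; omega), hd, smul_zero]
      · rfl

lemma onCoeffs_two_mul_X_mul_const {d : BKPSeries → BKPSeries} (hd : d 0 = 0)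
    (h2 : ∀ F, d (2 * F) = 2 * d F) (i : Fin 2) (G : BKPSeries) :
    onCoeffs d (2 * (MvPowerSeries.X i * const G)) = MvPowerSeries.X i * const (d (2 * G)) := by
  refine ext_pt fun n b => ?_
  rw [coeff_onCoeffs, coeff_two_mul, h2, h2]
  fin_cases i
  · change 2 * d (MvPowerSeries.coeff (pt n b) (MvPowerSeries.X 0 * const G)) =
      MvPowerSeries.coeff (pt n b) (MvPowerSeries.X 0 * const (2 * d G))
    rw [coeff_pt_X0_mul_const, coeff_pt_X0_mul_const]
    split_ifs <;> simp [hd]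
  · change 2 * d (MvPowerSeries.coeff (pt n b) (MvPowerSeries.X 1 * const G)) =
      MvPowerSeries.coeff (pt n b) (MvPowerSeries.X 1 * const (2 * d G))
    rw [coeff_pt_X1_mul_const, coeff_pt_X1_mul_const]
    split_ifs <;> simp [hd]

lemma onCoeffs_dTbar_add (k : ℕ) (G H : ZSeries) :
    onCoeffs (dTbar k) (G + H) = onCoeffs (dTbar k) G + onCoeffs (dTbar k) H := by
  ext1 e
  simp only [map_add, coeff_onCoeffs, dTbar_add]

lemma onCoeffs_dTbar_sub (k : ℕ) (G H : ZSeries) :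
    onCoeffs (dTbar k) (G - H) = onCoeffs (dTbar k) G - onCoeffs (dTbar k) H := by
  rw [eq_sub_iff_add_eq, ← onCoeffs_dTbar_add, sub_add_cancel]

lemma onCoeffs_dTbar_DB (F : BKPSeries) :
    onCoeffs (dTbar 0) (2 * DB 0 (const F)) = MvPowerSeries.X 0 * inX 0 (crossSeries F) := by
  rw [← DB_const_dTbar]
  refine ext_pt fun n b => ?_
  rw [coeff_onCoeffs, coeff_two_mul, DB, DB, coeff_pt_oddOp_const_zero dT_zero,
    coeff_pt_oddOp_const_zero dT_zero, dTbar_two_mul, dTbar_two_mul]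
  split_ifs
  · rw [dTbar_smul, dT_two_mul, dT_dTbar_comm, mul_smul_comm]
  · rw [dTbar_zero, mul_zero]

lemma constantCoeff_X_mul (i : Fin 2) (G : ZSeries) :
    MvPowerSeries.constantCoeff (MvPowerSeries.X i * G) = 0 := by
  rw [map_mul, MvPowerSeries.constantCoeff_X, zero_mul]

lemma z_mul_incl_X (i : Fin 2) : z i * algebraMap ZSeries ZField (MvPowerSeries.X i) = 1 :=
  inv_mul_cancel₀ (incl_X_ne_zero i)

/-- With `s = x₀ x₁ ∂̄_1² 2F` the identity reads `(1 - s) e^(2s) = 1 + s`, which holds modulo `s²`.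
-/
lemma fay2_of_barReduced (hF : BarReduced F) : EqFirstOrderBoth (fay2L F) (fay2R F) := by
  have hW : 2 * DBbar 0 (2 * DBbar 1 (const F)) =
      MvPowerSeries.X 1 * (2 * (MvPowerSeries.X 0 * const (dTbar 0 (dTbar 0 (2 * F))))) := by
    rw [DBbar, two_mul_oddOp_DBbar hF dTbar_zero dTbar_two_mul dTbar_smul]
    congr 2
    refine DBbar_zero_const ((barReduced_iff _).mpr fun n hn => ?_)
    have : dTbar n (dTbar 0 (2 * F)) = dTbar 0 (dTbar n (2 * F)) := pderiv_pderiv_comm _ _ _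
    rw [this, dTbar_two_mul, (barReduced_iff F).mp hF n hn, mul_zero, dTbar_zero]
  obtain ⟨h, g, hh, hE⟩ := exists_subst_exp_eq (W := MvPowerSeries.X 1 * (2 * (MvPowerSeries.X 0 *
    const (dTbar 0 (dTbar 0 (2 * F)))))) (constantCoeff_X_mul _ _)
  have hx0 := incl_X_ne_zero 0
  have hx1 := incl_X_ne_zero 1
  have hL : fay2L F = incl ((1 - MvPowerSeries.X 0 * MvPowerSeries.X 1 *
      const (dTbar 0 (dTbar 0 (2 * F)))) * fexp (2 * DBbar 0 (2 * DBbar 1 (const F)))) := by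
    have hx := incl_X0_add_X1_ne_zero
    rw [fay2L, DBbar_zero_const hF, DBbar_one_const hF, onCoeffs_dTbar_add,
      onCoeffs_two_mul_X_mul_const (dTbar_zero 0) (dTbar_two_mul 0),
      onCoeffs_two_mul_X_mul_const (dTbar_zero 0) (dTbar_two_mul 0), ← dTbar_two_mul 0 F]
    simp only [incl, z, map_mul, map_add, map_sub, map_one] at hx0 hx1 hx ⊢
    congr 1
    rw [inv_add_inv hx0 hx1]
    field_simp
  have hR : fay2R F = incl (1 + MvPowerSeries.X 0 * MvPowerSeries.X 1 *
      const (dTbar 0 (dTbar 0 (2 * F)))) := by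
    have hx := incl_X1_sub_X0_ne_zero
    rw [fay2R, DBbar_zero_const hF, DBbar_one_const hF, onCoeffs_dTbar_sub,
      onCoeffs_two_mul_X_mul_const (dTbar_zero 0) (dTbar_two_mul 0),
      onCoeffs_two_mul_X_mul_const (dTbar_zero 0) (dTbar_two_mul 0), ← dTbar_two_mul 0 F]
    simp only [incl, z, map_mul, map_add, map_sub, map_one] at hx0 hx1 hx ⊢
    rw [inv_sub_inv hx0 hx1]
    field_simp
    ring
  set x : ZSeries := MvPowerSeries.X 0
  set y : ZSeries := MvPowerSeries.X 1
  set B := const (dTbar 0 (dTbar 0 (2 * F)))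
  refine ⟨y ^ 2 * (-2 * B ^ 2 + (1 - x * y * B) * (4 * h * B ^ 2 + 8 * x * y * B ^ 3 * g)), 0, ?_⟩
  rw [hL, hR, hW, fexp, hE]
  simp only [incl, ← map_sub]
  congr 1
  ring

lemma onCoeffs_dT_X1 (F : BKPSeries) :
    onCoeffs (dT 0) (2 * (MvPowerSeries.X 1 * const (dTbar 0 F))) =
      MvPowerSeries.X 1 * const (mixedSecond F) := by
  rw [onCoeffs_two_mul_X_mul_const (dT_zero 0) (dT_two_mul 0), mixedSecond, ← dTbar_two_mul,
    dT_dTbar_comm]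

lemma two_mul_DB_DBbar (hF : BarReduced F) : 2 * DB 0 (2 * DBbar 1 (const F)) =
    MvPowerSeries.X 1 * (2 * (MvPowerSeries.X 0 * inX 0 (crossSeries F))) := by
  rw [DB, two_mul_oddOp_DBbar hF dT_zero dT_two_mul dT_smul, ← DB, DB_const_dTbar]

/-- With `U = ∂̄_1 2D(z₀) F` and `y = 1 / z₁` one has `(z₁ - U) e^(2yU) = z₁ + U + O(y²)`: the terms
`2 y U²` from the linear and the quadratic part of the exponential cancel. The remaining `∂̄_1²`
term agrees on both sides to first order. -/
lemma fay4_of_barReduced (hF : BarReduced F) : EqFirstOrder (fay4L F) (fay4R F) := by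
  obtain ⟨h, g, hh, hE⟩ := exists_subst_exp_eq (W := MvPowerSeries.X 1 * (2 * (MvPowerSeries.X 0 *
    inX 0 (crossSeries F)))) (constantCoeff_X_mul _ _)
  rw [EqFirstOrder, fay4L, fay4R, two_mul_DB_DBbar hF, fexp, hE, onCoeffs_dTbar_add, onCoeffs_dTbar_sub,
    onCoeffs_dTbar_DB, DBbar_one_const hF,
    onCoeffs_two_mul_X_mul_const (dTbar_zero 0) (dTbar_two_mul 0)]
  have hz := z_mul_incl_X 1
  set x : ZSeries := MvPowerSeries.X 0
  set y : ZSeries := MvPowerSeries.X 1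
  set U := x * inX 0 (crossSeries F)
  set B := const (dTbar 0 (2 * dTbar 0 F))
  have hh' := congrArg (algebraMap ZSeries ZField) hh
  refine ⟨8 * U ^ 3 * g - (U + y * B) * (4 * U ^ 2 * h + 8 * y * U ^ 3 * g) - 2 * B * U, ?_⟩
  simp only [incl, map_mul, map_add, map_sub, map_one, map_pow, map_ofNat] at hh' ⊢
  linear_combination (2 * algebraMap ZSeries ZField U + 4 * algebraMap ZSeries ZField y *
      algebraMap ZSeries ZField U ^ 2 * algebraMap ZSeries ZField h + 8 *
      algebraMap ZSeries ZField y ^ 2 * algebraMap ZSeries ZField U ^ 3 *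
      algebraMap ZSeries ZField g) * hz +
    2 * algebraMap ZSeries ZField y * algebraMap ZSeries ZField U ^ 2 * hh'

/-- The two sides agree at order zero in `x₁`, and at order one they differ by `2H`, where `H` is
`evenSeries (qBKP F)` times `crossSeries F` minus the mixed derivative. So to first order the
identity is `H = 0`. -/
theorem fay3_iff_of_barReduced (hF : BarReduced F) :
    EqFirstOrder (fay3L F) (fay3R F) ↔ ReducedFay3 F := by
  obtain ⟨h, g, hh, hE⟩ := exists_subst_exp_eq (W := MvPowerSeries.X 1 * (2 * (MvPowerSeries.X 0 *
    inX 0 (crossSeries F)))) (constantCoeff_X_mul _ _)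
  rw [reducedFay3_iff_mul_crossSeries]
  set H := crossSeries F - shiftSeries F * (PowerSeries.X * crossSeries F) -
    PowerSeries.C (mixedSecond F) with hH
  have hiff : evenSeries (qBKP F) * crossSeries F = PowerSeries.C (mixedSecond F) ↔ H = 0 := by
    rw [hH, sub_eq_zero, mul_left_comm, ← mul_assoc, X_mul_shiftSeries, sub_mul, one_mul,
      sub_sub_cancel]
  have hdiff : ∃ k, fay3L F - fay3R F =
      incl (MvPowerSeries.X 1 * (2 * inX 0 H) + MvPowerSeries.X 1 ^ 2 * k) := by
    rw [fay3L, fay3R, two_mul_DB_DBbar hF, fexp, hE, onCoeffs_dT_add, onCoeffs_dT_sub,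
      DBbar_one_const hF, onCoeffs_dT_X1, onCoeffs_DB, hH, map_sub, map_sub, map_mul, map_mul, inX_X,
      inX_C]
    have hz := z_mul_incl_X 0
    set x : ZSeries := MvPowerSeries.X 0
    set y : ZSeries := MvPowerSeries.X 1
    set U := inX 0 (crossSeries F)
    set Q := inX 0 (shiftSeries F)
    set B := const (mixedSecond F)
    refine ⟨(U - Q * x * U) * (4 * x * U * h + 8 * y * x ^ 2 * U ^ 2 * g) -
      B * (2 * x * U + 4 * y * x ^ 2 * U ^ 2 * h + 8 * y ^ 2 * x ^ 3 * U ^ 3 * g), ?_⟩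
    simp only [incl, map_mul, map_add, map_sub, map_one, map_pow, map_ofNat]
    linear_combination (2 * algebraMap ZSeries ZField y * algebraMap ZSeries ZField U + 4 *
        algebraMap ZSeries ZField y ^ 2 * algebraMap ZSeries ZField x *
        algebraMap ZSeries ZField U ^ 2 * algebraMap ZSeries ZField h + 8 *
        algebraMap ZSeries ZField y ^ 3 * algebraMap ZSeries ZField x ^ 2 *
        algebraMap ZSeries ZField U ^ 3 * algebraMap ZSeries ZField g) * hz
  obtain ⟨k, hk⟩ := hdiff
  rw [hiff, EqFirstOrder, hk]
  constructor
  · rintro ⟨g', hg'⟩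
    have h1 := incl_injective hg'
    ext1 n
    have h2 := congrArg (MvPowerSeries.coeff (pt n 1)) h1
    rw [map_add, pow_two, mul_assoc, mul_assoc, coeff_pt_X1_mul, coeff_pt_X1_mul, coeff_pt_X1_mul,
      coeff_pt_zero_X1_mul, coeff_pt_zero_X1_mul, add_zero, coeff_two_mul, coeff_pt_inX_zero,
      if_pos rfl] at h2
    rw [map_zero]
    exact eq_zero_of_natCast_mul two_ne_zero (by exact_mod_cast h2)
  · intro h0
    exact ⟨k, by rw [h0, map_zero, mul_zero, mul_zero, zero_add]⟩

theorem solvesReduced2BKP_iff (hF : BarReduced F) :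
    SolvesReduced2BKP F ↔ fay1L F = fay1R F ∧ ReducedFay3 F :=
  ⟨fun h => ⟨h.fay1, (fay3_iff_of_barReduced hF).mp h.fay3⟩, fun h =>
    ⟨hF, h.1, fay2_of_barReduced hF, (fay3_iff_of_barReduced hF).mpr h.2, fay4_of_barReduced hF⟩⟩

end ReducedIdentities

/-! ### The change of variables -/

section ChangeOfVariables

/-- The time of the BKP hierarchy that corresponds to `t_k`. -/
def oldIndex : ℕ → ℕ ⊕ ℕ
  | 0 => Sum.inr 0
  | n + 1 => Sum.inl n

/-- A left inverse of `oldIndex`. -/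
def newIndex : ℕ ⊕ ℕ → ℕ := Sum.elim (fun n => n + 1) fun _ => 0

/-- The coefficients of the linear change of variables. -/
def timeScale : ℕ ⊕ ℕ → ℂ :=
  Sum.elim (fun n => 1 / (2 * (n : ℂ) + 1)) fun n => if n = 0 then 1 else 0

lemma newIndex_oldIndex (k : ℕ) : newIndex (oldIndex k) = k := by
  cases k <;> rfl

lemma oldIndex_injective : Function.Injective oldIndex :=
  Function.LeftInverse.injective newIndex_oldIndex

lemma oldIndex_newIndex {s : ℕ ⊕ ℕ} (hs : ∀ n, 1 ≤ n → s ≠ Sum.inr n) :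
    oldIndex (newIndex s) = s := by
  rcases s with n | n
  · rfl
  · rcases n with _ | n
    · rfl
    · exact absurd rfl (hs (n + 1) (by omega))

lemma timeScale_oldIndex_ne_zero (k : ℕ) : timeScale (oldIndex k) ≠ 0 := by
  rcases k with _ | n
  · simp [oldIndex, timeScale]
  · exact one_div_ne_zero (two_mul_add_one_ne_zero n)

lemma newTimes_eq (s : ℕ ⊕ ℕ) :
    newTimes s = MvPowerSeries.C (timeScale s) * MvPowerSeries.X (newIndex s) := by
  rcases s with n | n
  · rfl
  · by_cases h : n = 0 <;> simp [newTimes, timeScale, newIndex, h]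

lemma prod_newTimes (e : ℕ ⊕ ℕ →₀ ℕ) :
    (e.prod fun s m => newTimes s ^ m) =
      MvPowerSeries.monomial (e.mapDomain newIndex) (e.prod fun s m => timeScale s ^ m) := by
  induction e using Finsupp.induction_linear with
  | zero => simp
  | add e e' h h' =>
    rw [Finsupp.prod_add_index' (by simp) (by intros; rw [pow_add]),
      Finsupp.prod_add_index' (by simp) (by intros; rw [pow_add]), h, h', Finsupp.mapDomain_add,
      MvPowerSeries.monomial_mul_monomial]
  | single s m =>
    rw [Finsupp.prod_single_index (by simp), Finsupp.prod_single_index (by simp),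
      Finsupp.mapDomain_single, newTimes_eq, mul_pow, MvPowerSeries.X_pow_eq, ← map_pow,
      ← MvPowerSeries.monomial_zero_eq_C_apply, MvPowerSeries.monomial_mul_monomial, zero_add,
      mul_one]

/-- The exponent in the old times that corresponds to an exponent in the new times. -/
def oldExp (d : ℕ →₀ ℕ) : ℕ ⊕ ℕ →₀ ℕ := d.mapDomain oldIndex

lemma oldExp_oldIndex (d : ℕ →₀ ℕ) (k : ℕ) : oldExp d (oldIndex k) = d k :=
  Finsupp.mapDomain_apply oldIndex_injective _ _

lemma oldExp_inr (d : ℕ →₀ ℕ) {n : ℕ} (hn : 1 ≤ n) : oldExp d (Sum.inr n) = 0 := by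
  refine Finsupp.mapDomain_of_notMem_range _ _ ?_
  rintro ⟨k, hk⟩
  rcases k with _ | k
  · have := Sum.inr.inj hk; omega
  · exact Sum.inl_ne_inr hk

lemma oldExp_add (d d' : ℕ →₀ ℕ) : oldExp (d + d') = oldExp d + oldExp d' :=
  Finsupp.mapDomain_add

lemma oldExp_single (k m : ℕ) : oldExp (Finsupp.single k m) = Finsupp.single (oldIndex k) m :=
  Finsupp.mapDomain_single

lemma mapDomain_oldExp (d : ℕ →₀ ℕ) : (oldExp d).mapDomain newIndex = d := by
  rw [oldExp, ← Finsupp.mapDomain_comp]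
  rw [show newIndex ∘ oldIndex = id from funext newIndex_oldIndex, Finsupp.mapDomain_id]

lemma oldExp_mapDomain {e : ℕ ⊕ ℕ →₀ ℕ} (he : ∀ n, 1 ≤ n → e (Sum.inr n) = 0) :
    oldExp (e.mapDomain newIndex) = e := by
  rw [oldExp, ← Finsupp.mapDomain_comp]
  conv_rhs => rw [← Finsupp.mapDomain_id (v := e)]
  refine Finsupp.mapDomain_congr fun s hs => oldIndex_newIndex ?_
  rintro n hn rfl
  exact Finsupp.mem_support_iff.mp hs (he n hn)

/-- The factor by which the change of variables multiplies a coefficient. -/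
def expScale (d : ℕ →₀ ℕ) : ℂ := (oldExp d).prod fun s m => timeScale s ^ m

lemma expScale_ne_zero (d : ℕ →₀ ℕ) : expScale d ≠ 0 := by
  rw [expScale, Finsupp.prod, Finset.prod_ne_zero_iff]
  intro s hs
  refine pow_ne_zero _ ?_
  rw [← oldIndex_newIndex (s := s)]
  · exact timeScale_oldIndex_ne_zero _
  · rintro n hn rfl
    exact Finsupp.mem_support_iff.mp hs (oldExp_inr d hn)

lemma expScale_add_single (d : ℕ →₀ ℕ) (k : ℕ) :
    expScale (d + Finsupp.single k 1) = expScale d * timeScale (oldIndex k) := by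
  rw [expScale, oldExp_add, oldExp_single,
    Finsupp.prod_add_index' (by simp) (by intros; rw [pow_add]),
    Finsupp.prod_single_index (by simp), pow_one, expScale]

/-- The substitution of the new times as a homomorphism of algebras. -/
def inNewTimes : BKPSeries →ₐ[ℂ] TSeries := MvPowerSeries.substAlgHom hasSubst_newTimes

/-- Monomials containing a time `t̄_3, t̄_5, …` are sent to zero, and the others go bijectively to
multiples of monomials, so a single term of the substitution contributes. -/
lemma coeff_inNewTimes (G : BKPSeries) (d : ℕ →₀ ℕ) :
    MvPowerSeries.coeff d (inNewTimes G) = expScale d * MvPowerSeries.coeff (oldExp d) G := by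
  classical
  rw [inNewTimes, MvPowerSeries.coe_substAlgHom, MvPowerSeries.coeff_subst hasSubst_newTimes,
    finsum_eq_single _ (oldExp d)]
  · rw [prod_newTimes, mapDomain_oldExp, MvPowerSeries.coeff_monomial_same, smul_eq_mul, mul_comm]
    rfl
  · intro e he
    rw [prod_newTimes, MvPowerSeries.coeff_monomial]
    split_ifs with hd
    · suffices h : (e.prod fun s m => timeScale s ^ m) = 0 by rw [h, smul_zero]
      have : ∃ n, 1 ≤ n ∧ e (Sum.inr n) ≠ 0 := by
        by_contra! hcon
        exact he (by rw [hd, oldExp_mapDomain hcon])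
      obtain ⟨n, hn, hen⟩ := this
      refine Finset.prod_eq_zero (Finsupp.mem_support_iff.mpr hen) ?_
      change (if n = 0 then (1 : ℂ) else 0) ^ e (Sum.inr n) = 0
      rw [if_neg (by omega), zero_pow hen]
    · rw [smul_zero]

lemma dt_inNewTimes (k : ℕ) (G : BKPSeries) :
    dt k (inNewTimes G) =
      timeScale (oldIndex k) • inNewTimes (MvPowerSeries.pderiv ℂ (oldIndex k) G) := by
  ext d
  rw [dt, MvPowerSeries.coeff_pderiv, coeff_inNewTimes, MvPowerSeries.coeff_smul, coeff_inNewTimes,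
    MvPowerSeries.coeff_pderiv, oldExp_add, oldExp_single, oldExp_oldIndex, expScale_add_single]
  ring

lemma dt_zero_inNewTimes (G : BKPSeries) : dt 0 (inNewTimes G) = inNewTimes (dTbar 0 G) := by
  rw [dt_inNewTimes]
  change (if 0 = 0 then (1 : ℂ) else 0) • inNewTimes (dTbar 0 G) = _
  rw [if_pos rfl, one_smul]

lemma dt_succ_inNewTimes (n : ℕ) (G : BKPSeries) :
    dt (n + 1) (inNewTimes G) = inNewTimes ((1 / (2 * (n : ℂ) + 1)) • dT n G) := by
  rw [dt_inNewTimes, map_smul]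
  rfl

lemma changeVars_eq (F : BKPSeries) : changeVars F = inNewTimes (2 * F) := by
  rw [changeVars, inNewTimes, MvPowerSeries.coe_substAlgHom]

lemma coeff_eq_zero_of_barReduced {G : BKPSeries} (hG : BarReduced G) {e : ℕ ⊕ ℕ →₀ ℕ} {n : ℕ}
    (hn : 1 ≤ n) (he : e (Sum.inr n) ≠ 0) : MvPowerSeries.coeff e G = 0 := by
  have h := congrArg (MvPowerSeries.coeff (e - Finsupp.single (Sum.inr n) 1))
    ((barReduced_iff G).mp hG n hn)
  have hle : Finsupp.single (Sum.inr n) 1 ≤ e := by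
    rw [Finsupp.single_le_iff]; omega
  rw [dTbar, MvPowerSeries.coeff_pderiv, tsub_add_cancel_of_le hle, map_zero] at h
  exact (mul_eq_zero.mp h).resolve_right (Nat.cast_add_one_ne_zero _)

lemma eq_zero_of_inNewTimes_eq_zero {G : BKPSeries} (hG : BarReduced G) (h : inNewTimes G = 0) :
    G = 0 := by
  ext e
  by_cases he : ∃ n, 1 ≤ n ∧ e (Sum.inr n) ≠ 0
  · obtain ⟨n, hn, hen⟩ := he
    rw [coeff_eq_zero_of_barReduced hG hn hen, map_zero]
  · push Not at he
    have h1 := congrArg (MvPowerSeries.coeff (e.mapDomain newIndex)) h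
    rw [coeff_inNewTimes, oldExp_mapDomain he, map_zero] at h1
    exact (mul_eq_zero.mp h1).resolve_left (expScale_ne_zero _)

/-- The functions that do not depend on `t̄_3, t̄_5, …`. -/
def reducedSeries : Subalgebra ℂ BKPSeries where
  carrier := {G | ∀ n, 1 ≤ n → dTbar n G = 0}
  mul_mem' {G H} hG hH n hn := by
    rw [dTbar, Derivation.leibniz]
    have h1 : MvPowerSeries.pderiv ℂ (Sum.inr n) G = 0 := hG n hn
    have h2 : MvPowerSeries.pderiv ℂ (Sum.inr n) H = 0 := hH n hn
    rw [h1, h2, smul_zero, smul_zero, add_zero]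
  add_mem' {G H} hG hH n hn := by rw [dTbar_add, hG n hn, hH n hn, add_zero]
  algebraMap_mem' c n _ := (MvPowerSeries.pderiv ℂ (Sum.inr n)).map_algebraMap c

lemma mem_reducedSeries {G : BKPSeries} : G ∈ reducedSeries ↔ BarReduced G :=
  (barReduced_iff G).symm

lemma dT_mem_reducedSeries {G : BKPSeries} (hG : G ∈ reducedSeries) (a : ℕ) :
    dT a G ∈ reducedSeries := fun n hn => by rw [← dT_dTbar_comm, hG n hn, dT_zero]

lemma dTbar_mem_reducedSeries {G : BKPSeries} (hG : G ∈ reducedSeries) (a : ℕ) :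
    dTbar a G ∈ reducedSeries := fun n hn => by
  have : dTbar n (dTbar a G) = dTbar a (dTbar n G) := pderiv_pderiv_comm _ _ _
  rw [this, hG n hn, dTbar_zero]

lemma two_mul_mem_reducedSeries {G : BKPSeries} (hG : G ∈ reducedSeries) :
    2 * G ∈ reducedSeries := by
  rw [two_mul]; exact add_mem hG hG

lemma aeval_mem_reducedSeries {q : ℕ → BKPSeries} (hq : ∀ γ, q γ ∈ reducedSeries)
    (p : MvPolynomial ℕ ℚ) : MvPolynomial.aeval q p ∈ reducedSeries := by
  induction p using MvPolynomial.induction_on with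
  | C r =>
    rw [MvPolynomial.aeval_C, IsScalarTower.algebraMap_apply ℚ ℂ BKPSeries]
    exact Subalgebra.algebraMap_mem _ _
  | add p p' h h' => rw [map_add]; exact add_mem h h'
  | mul_X p i h => rw [map_mul, MvPolynomial.aeval_X]; exact mul_mem h (hq i)

lemma qBKP_mem_reducedSeries {F : BKPSeries} (hF : F ∈ reducedSeries) (γ : ℕ) :
    qBKP F γ ∈ reducedSeries :=
  Subalgebra.smul_mem _ (dT_mem_reducedSeries (dT_mem_reducedSeries hF _) _) _

lemma inNewTimes_inj {G H : BKPSeries} (hG : G ∈ reducedSeries) (hH : H ∈ reducedSeries) :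
    inNewTimes G = inNewTimes H ↔ G = H := by
  refine ⟨fun h => sub_eq_zero.mp (eq_zero_of_inNewTimes_eq_zero
    (mem_reducedSeries.mp (sub_mem hG hH)) ?_), fun h => h ▸ rfl⟩
  rw [map_sub, h, sub_self]

theorem bijOn_changeVars : Set.BijOn changeVars {F | BarReduced F} Set.univ := by
  refine ⟨Set.mapsTo_univ _ _, ?_, ?_⟩
  · intro F hF G hG h
    rw [Set.mem_ofPred_eq, ← mem_reducedSeries] at hF hG
    rw [changeVars_eq, changeVars_eq,
      inNewTimes_inj (two_mul_mem_reducedSeries hF) (two_mul_mem_reducedSeries hG)] at h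
    have h2 : (2 : BKPSeries) * (F - G) = 0 := by rw [mul_sub, h, sub_self]
    exact sub_eq_zero.mp (eq_zero_of_natCast_mul two_ne_zero (by exact_mod_cast h2))
  · classical
    intro f _
    -- The preimage: coefficients of `f` divided by `2` and by the scale factor, placed at the
    -- exponents without `t̄_3, t̄_5, …`.
    set G : BKPSeries := fun e =>
      if oldExp (e.mapDomain newIndex) = e then
        (expScale (e.mapDomain newIndex))⁻¹ * (2⁻¹ * MvPowerSeries.coeff (e.mapDomain newIndex) f)
      else 0 with hG
    have hcoeff : ∀ e, MvPowerSeries.coeff e G = if oldExp (e.mapDomain newIndex) = e then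
        (expScale (e.mapDomain newIndex))⁻¹ * (2⁻¹ * MvPowerSeries.coeff (e.mapDomain newIndex) f)
      else 0 := fun e => rfl
    refine ⟨G, ?_, ?_⟩
    · rw [Set.mem_ofPred_eq, barReduced_iff]
      intro n hn
      ext e
      rw [dTbar, MvPowerSeries.coeff_pderiv, hcoeff, if_neg, zero_mul, map_zero]
      intro h
      have := DFunLike.congr_fun h (Sum.inr n)
      rw [oldExp_inr _ hn] at this
      simp at this
    · rw [changeVars_eq, two_mul, map_add]
      ext d
      rw [map_add, coeff_inNewTimes, hcoeff, mapDomain_oldExp, if_pos rfl,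
        mul_inv_cancel_left₀ (expScale_ne_zero d)]
      ring

end ChangeOfVariables

/-! ### Comparison of the hierarchies -/

section Comparison

lemma diffQuot_one {A : Type*} [CommRing A] : diffQuot (1 : PowerSeries A) = 1 := by
  classical
  refine ext_pt fun n b => ?_
  rw [coeff_diffQuot, MvPowerSeries.coeff_one]
  simp only [pt_eq_zero, PowerSeries.coeff_one]
  split_ifs <;> first | rfl | omega | simp

lemma grunsky_one {A : Type*} [CommRing A] (b n : ℕ) : grunsky (1 : PowerSeries A) b n = 0 := by
  rw [grunsky, grunskySeries, diffQuot_one, MvPowerSeries.pderiv_one, mul_zero, zero_mul, map_zero]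

lemma evenSeries_zero {A : Type*} [CommRing A] : evenSeries (0 : ℕ → A) = 1 := by
  ext d
  rw [evenSeries, PowerSeries.coeff_mk, PowerSeries.coeff_one]
  simp

/-- At `q = 0` one has `p(z) = z` with difference quotient `1`. This matters because the sums in the
hierarchy omit the empty list. -/
lemma constantCoeff_flowPolyA (α β : ℕ) : MvPolynomial.constantCoeff (flowPolyA α β) = 0 := by
  have h := aeval_flowPolyA (0 : ℕ → ℚ) α β
  rw [evenSeries_zero, grunsky_one, mul_zero, MvPolynomial.aeval_zero] at h
  exact h

/-- At `q = 0` the series `1/D` is `1`, whose coefficients vanish in positive degree; `α = 1` is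
excluded because `flowPolyB 1` is the leading coefficient `1`. -/
lemma constantCoeff_flowPolyB {α : ℕ} (hα : 2 ≤ α) :
    MvPolynomial.constantCoeff (flowPolyB α) = 0 := by
  have h := aeval_flowPolyB (0 : ℕ → ℚ) (Dinv := 1) (by rw [evenSeries_zero, one_mul]) α
  rw [PowerSeries.coeff_one, if_neg (by omega), MvPolynomial.aeval_zero] at h
  exact h

variable {P : ℕ → MvPolynomial ℕ ℚ} {F : BKPSeries}

lemma dt_one_dt_changeVars (F : BKPSeries) {γ : ℕ} (hγ : 1 ≤ γ) :
    dt 1 (dt γ (changeVars F)) = inNewTimes (qBKP F γ) := by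
  obtain ⟨n, rfl⟩ : ∃ n, γ = n + 1 := ⟨γ - 1, by omega⟩
  rw [changeVars_eq, dt_succ_inNewTimes, dt_succ_inNewTimes 0, qBKP,
    dT_smul, dT_two_mul, dT_two_mul, Nat.add_sub_cancel, smul_smul,
    ← map_ofNat (algebraMap ℂ BKPSeries), ← Algebra.smul_def, smul_smul]
  congr 2
  push_cast
  rw [show 2 * ((n : ℂ) + 1) - 1 = 2 * n + 1 by ring]
  ring

/-- Membership in `lowVars` excludes the variable with number `0`, for which `qBKP` does not
correspond to `∂_1 ∂_0 f`. -/
lemma aeval_dt_changeVars (F : BKPSeries) {d : ℕ} {p : MvPolynomial ℕ ℚ} (hp : p ∈ lowVars d) :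
    MvPolynomial.aeval (fun γ => dt 1 (dt γ (changeVars F))) p =
      inNewTimes (MvPolynomial.aeval (qBKP F) p) := by
  have h : inNewTimes (MvPolynomial.aeval (qBKP F) p) =
      MvPolynomial.aeval (fun γ => inNewTimes (qBKP F γ)) p :=
    (MvPolynomial.comp_aeval_apply (qBKP F) (inNewTimes.restrictScalars ℚ) p)
  rw [h]
  exact aeval_congr_of_mem_supported (fun γ hγ => dt_one_dt_changeVars F hγ.1) hp

lemma finsum_stableA (hP : ∀ N : ℕ, 4 ≤ N → IsDPotential N (P N)) {α β : ℕ} (hα : 1 ≤ α)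
    (hβ : 1 ≤ β) (x : ℕ → TSeries) :
    ∑ᶠ (γ : List ℕ) (_ : γ ≠ []), (stableA P α β γ : ℂ) • (γ.map x).prod =
      MvPolynomial.aeval x (flowPolyA α β) := by
  rw [← finsum_derivAtZero (constantCoeff_flowPolyA α β) x]
  refine finsum_congr fun γ => finsum_congr fun _ => ?_
  rw [stableA_eq hP hα hβ, Rat.cast_smul_eq_qsmul]

lemma finsum_stableB (hP : ∀ N : ℕ, 4 ≤ N → IsDPotential N (P N)) {α : ℕ} (hα : 2 ≤ α)
    (x : ℕ → TSeries) :
    ∑ᶠ (γ : List ℕ) (_ : γ ≠ []), (stableB P α γ : ℂ) • (γ.map x).prod =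
      MvPolynomial.aeval x (flowPolyB α) := by
  rw [← finsum_derivAtZero (constantCoeff_flowPolyB hα) x]
  refine finsum_congr fun γ => finsum_congr fun _ => ?_
  rw [stableB_eq hP (by omega), Rat.cast_smul_eq_qsmul]

lemma flowA_changeVars_iff (hP : ∀ N : ℕ, 4 ≤ N → IsDPotential N (P N)) (hF : BarReduced F)
    (a b : ℕ) :
    (dt (a + 1) (dt (b + 1) (changeVars F)) = ∑ᶠ (γ : List ℕ) (_ : γ ≠ []),
      (stableA P (a + 1) (b + 1) γ : ℂ) •
        (γ.map (fun c => dt 1 (dt c (changeVars F)))).prod) ↔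
      (2 / ((2 * (a : ℂ) + 1) * (2 * b + 1))) • dT a (dT b F) =
        MvPolynomial.aeval (qBKP F) (flowPolyA (a + 1) (b + 1)) := by
  rw [← mem_reducedSeries] at hF
  have hL : dt (a + 1) (dt (b + 1) (changeVars F)) =
      inNewTimes ((2 / ((2 * (a : ℂ) + 1) * (2 * b + 1))) • dT a (dT b F)) := by
    rw [changeVars_eq, dt_succ_inNewTimes, dt_succ_inNewTimes, dT_smul, dT_two_mul, dT_two_mul,
      ← map_ofNat (algebraMap ℂ BKPSeries), ← Algebra.smul_def, smul_smul, smul_smul]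
    congr 2
    rw [one_div_mul_one_div, div_mul_eq_mul_div, one_mul]
  rw [finsum_stableA hP (by omega) (by omega), hL,
    aeval_dt_changeVars F (flowPolyA_mem (by omega) (by omega)), inNewTimes_inj
      (Subalgebra.smul_mem _ (dT_mem_reducedSeries (dT_mem_reducedSeries hF _) _) _)
      (aeval_mem_reducedSeries (qBKP_mem_reducedSeries hF) _)]

lemma flowB_changeVars_iff (hP : ∀ N : ℕ, 4 ≤ N → IsDPotential N (P N)) (hF : BarReduced F)
    {a : ℕ} (ha : 1 ≤ a) :
    (dt 0 (dt (a + 1) (changeVars F)) = dt 0 (dt 1 (changeVars F)) *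
      ∑ᶠ (γ : List ℕ) (_ : γ ≠ []), (stableB P (a + 1) γ : ℂ) •
        (γ.map (fun c => dt 1 (dt c (changeVars F)))).prod) ↔
      (1 / (2 * (a : ℂ) + 1)) • dT a (dTbar 0 (2 * F)) =
        mixedSecond F * MvPolynomial.aeval (qBKP F) (flowPolyB (a + 1)) := by
  rw [← mem_reducedSeries] at hF
  have h2F := two_mul_mem_reducedSeries hF
  have hmixed : mixedSecond F ∈ reducedSeries :=
    dTbar_mem_reducedSeries (dT_mem_reducedSeries h2F _) _
  have hL : ∀ n : ℕ, dt 0 (dt (n + 1) (changeVars F)) =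
      inNewTimes ((1 / (2 * (n : ℂ) + 1)) • dT n (dTbar 0 (2 * F))) := by
    intro n
    rw [changeVars_eq, dt_succ_inNewTimes, dt_zero_inNewTimes, dTbar_smul, dT_dTbar_comm]
  have h1 : dt 0 (dt 1 (changeVars F)) = inNewTimes (mixedSecond F) := by
    rw [hL 0, mixedSecond, dT_dTbar_comm]
    simp
  rw [finsum_stableB hP (by omega), hL, h1, aeval_dt_changeVars F (flowPolyB_mem _), ← map_mul,
    inNewTimes_inj (Subalgebra.smul_mem _
      (dT_mem_reducedSeries (dTbar_mem_reducedSeries h2F _) _) _)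
      (mul_mem hmixed (aeval_mem_reducedSeries (qBKP_mem_reducedSeries hF) _))]

theorem solvesDHierarchy_changeVars_iff (hP : ∀ N : ℕ, 4 ≤ N → IsDPotential N (P N))
    (hF : BarReduced F) : SolvesDHierarchy P (changeVars F) ↔ SolvesReduced2BKP F := by
  rw [solvesReduced2BKP_iff hF, fay1_iff_flowA, reducedFay3_iff_flowB]
  constructor
  · intro h
    exact ⟨fun a b ha hb => (flowA_changeVars_iff hP hF a b).mp
        (h.flowA (a + 1) (b + 1) (by omega) (by omega)),
      fun a ha => (flowB_changeVars_iff hP hF ha).mp (h.flowB (a + 1) (by omega))⟩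
  · rintro ⟨hA, hB⟩
    constructor
    · intro α β hα hβ
      obtain ⟨a, rfl⟩ : ∃ a, α = a + 1 := ⟨α - 1, by omega⟩
      obtain ⟨b, rfl⟩ : ∃ b, β = b + 1 := ⟨β - 1, by omega⟩
      exact (flowA_changeVars_iff hP hF a b).mpr (hA a b (by omega) (by omega))
    · intro α hα
      obtain ⟨a, rfl⟩ : ∃ a, α = a + 1 := ⟨α - 1, by omega⟩
      exact (flowB_changeVars_iff hP hF (by omega)).mpr (hB a (by omega))

end Comparison

end DHierarchy

end

theorem mainTheorem4 :
    (∀ N : ℕ, 4 ≤ N → ∃ F : MvPolynomial ℕ ℚ, DHierarchy.IsDPotential N F) ∧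
    ∀ P : ℕ → MvPolynomial ℕ ℚ, (∀ N : ℕ, 4 ≤ N → DHierarchy.IsDPotential N (P N)) →
      -- the coefficients of the hierarchy do not depend on `N` in the stable range
      (∀ (N α β : ℕ) (γ : List ℕ), 4 ≤ N → 1 ≤ α → 1 ≤ β → α + β ≤ N → γ ≠ [] →
        DHierarchy.coeffA N (P N) α β γ = DHierarchy.stableA P α β γ) ∧
      (∀ (N α : ℕ) (γ : List ℕ), 4 ≤ N → 1 ≤ α → α + 1 ≤ N → γ ≠ [] →
        DHierarchy.coeffB N (P N) α γ = DHierarchy.stableB P α γ) ∧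
      -- the reduced hierarchy, written out
      (∀ F₀ : DHierarchy.BKPSeries, DHierarchy.BarReduced F₀ →
        (DHierarchy.SolvesReduced2BKP F₀ ↔
          DHierarchy.fay1L F₀ = DHierarchy.fay1R F₀ ∧ DHierarchy.ReducedFay3 F₀)) ∧
      -- the two hierarchies coincide
      Set.BijOn DHierarchy.changeVars {F₀ | DHierarchy.BarReduced F₀} Set.univ ∧
      (∀ F₀ : DHierarchy.BKPSeries, DHierarchy.BarReduced F₀ →
        (DHierarchy.SolvesDHierarchy P (DHierarchy.changeVars F₀) ↔
          DHierarchy.SolvesReduced2BKP F₀)) := by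
  refine ⟨fun N hN => DHierarchy.exists_isDPotential hN, fun P hP => ⟨?_, ?_, ?_, ?_, ?_⟩⟩
  · intro N α β γ hN hα hβ hαβ _
    rw [DHierarchy.coeffA_eq hN (hP N hN) hα hβ hαβ, DHierarchy.stableA_eq hP hα hβ]
  · intro N α γ hN hα hαN _
    rw [DHierarchy.coeffB_eq hN (hP N hN) hα hαN, DHierarchy.stableB_eq hP hα]
  · exact fun F₀ hF => DHierarchy.solvesReduced2BKP_iff hF
  · exact DHierarchy.bijOn_changeVars
  · exact fun F₀ hF => DHierarchy.solvesDHierarchy_changeVars_iff hP hF
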